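/- **Setting.** Let $p_1,\dots,p_n\in\mathbb R^2$, $n\ge 2$, let $G=(V,E)$ be their unit disk graph ($V=\{1,\dots,n\}$; distinct $u,v$ are adjacent iff $\mathrm{dist}(u,v):=\|p_u-p_v\|\le 1$), assume that $G$ is connected, and let $\Delta(G)$ be its maximum degree. For $S\subseteq V$ let $N(S)$ be the set of nodes outside $S$ with a neighbour in $S$. $S$ is dominating if $N(S)\cup S=V$, and independent if no two of its nodes are adjacent. Algorithms 1 and 2 maintain a collection $\mathscr S$ of *active* subsets of $V$ with values $y(S)\in\mathbb R$ and indicators $g(S)\in\{0,1\}$; $S$ is *un-restricted* if $g(S)=1$. For node capacities $c_v$, the potential $\epsilon(v)$ is $\infty$ if $\sum_{S\in\mathscr S,\,v\in N(S)}g(S)=0$, and otherwise $$\epsilon(v)=\frac{c_v-\sum_{S\in\mathscr S,\,v\in N(S)}y(S)}{\sum_{S\in\mathscr S,\,v\in N(S)}g(S)} .$$ Ties and unspecified choices are resolved arbitrarily. By "raise with $v$" we mean: with $\epsilon=\epsilon(v)$, for each $S\in\mathscr S$ put $y(S)\leftarrow y(S)+g(S)\epsilon$, and then, if $v\in N(S)$,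 $g(S)\leftarrow 0$. By "activate $S$" we mean $\mathscr S\leftarrow\mathscr S\cup\{S\}$, $y(S)\leftarrow0$, $g(S)\leftarrow1$. **Algorithm 1** (input $G$ and $w:V\to(0,\infty)$). Put $c_v=\frac1{100}w(v)$, $ds=A=\emptyset$, $\mathscr S=\{\{v\}:v\in V\}$, $y=0$, $g=1$. Repeat the following until $ds$ is dominating. Find a node $v$ of minimum potential; add $v$ to $A$; if $v\notin N(ds)\cup ds$, add $v$ to $ds$; raise with $v$; for each $u\in V\setminus A$ with $\sum_{S\in\mathscr S,\,u\in N(S)}g(S)=0$ activate $V\setminus\{u\}$. Return $ds$ and $LB1=\sum_{v\in V}y(\{v\})$. **Algorithm 2** (input $G$, $w:V\to(0,\infty)$ and an independent dominating set $ds$). Put $c_v=\frac{99}{100}w(v)$, $cds=ds$, $\mathscr S=\{\{v\}:v\in ds\}$, $y(\{v\})=\frac{99}{500}(w(v)-2)$, $g=1$. Repeat the following until $\sum_{S\in\mathscr S}g(S)=1$. Find a node $v$ of minimum potential; let $\mathscr S^1$ be the collection of un-restricted $S\in\mathscr S$ with $S\cap N(\{v\})\neq\emptyset$, and $\mathscr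 S^2$ that of un-restricted $S\in\mathscr S$ with $S\cap N(\{v\})\cap cds\ne\emptyset$; if $\sum_{S\in\mathscr S,\,v\in N(S)}g(S)>1$, add to $cds$ the node $v$ and one neighbour of $v$ from each member of $\mathscr S^1\setminus\mathscr S^2$; raise with $v$; activate $\{v\}\cup\bigcup\mathscr S^1$. Return $cds$ and $LB2=\sum_{v\in ds}y(\{v\})$. **Algorithm 3** (input: $G$ and the points; constant $C=3+R_M+\pi(1+R_M)\bigl(1+\bigl\lceil\frac{1-R_M}{2R_M}\bigr\rceil\bigr)$ for a transmission range $0<R_M<0.3$ of the MULE). For each candidate location $m'\in V$, with weights $w_{m'}(v)=2\,\mathrm{dist}(m',v)+C$, run Algorithm 1 on $(G,w_{m'})$, obtaining $ds'$ and $LB1$, and Algorithm 2 on $(G,w_{m'},ds')$, obtaining $cds'$ and $LB2$. If this is the first location, or if $\sum_{v\in cds'}w_{m'}(v)$ is smaller than the weight $W$ kept so far, then keep $m=m'$, $cds=cds'$, $W=\sum_{v\in cds'}w_{m'}(v)$, $LB=LB1+LB2$ and $r$, the first node selected by Algorithm 1. Afterwards run breadth first search from $r$ in the subgraph of $G$ induced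 by $cds$; direct an edge from each node of $cds\setminus\{r\}$ to its predecessor, and from each $u\in V\setminus(cds\cup\{r\})$ to a nearest node of $cds$. Return these directed edges $E_T$, the location $m$, and $\alpha=W/LB$. **Machine.** A real RAM: programs consist of assignments, if-then-else and while loops over registers and arrays of nonnegative integers and of real numbers; constants, memory accesses, integer $+$, truncated $-$, the cast from integers to reals, real $+,-,\times,/,\sqrt{\ }$, comparisons and control actions cost one step each. The graph is given by $n$, the degrees, and adjacency lists in arbitrary order; subsets of $V$ are given by indicator arrays; Algorithm 3 also gets the coordinates of the points and the real number $C$, and lists $E_T$. **Theorem.** 1. There are a program and a constant $K$ such that, for every such $G$ and every $w:V\to(0,\infty)$, the program halts after at most $K\,n^2\,\Delta(G)$ steps with a pair $(ds,LB1)$ that Algorithm 1 can return on $(G,w)$. 2. There are a program and a constant $K$ such that, for every such $G$, every $w:V\to(0,\infty)$ and every independent dominating set $ds$ of $G$, the program halts after at most $K\,n^2\,\Delta(G)$ steps with a pair $(cds,LB2)$ that Algorithm 2 can return on $(G,w,ds)$. 3. There are a program and a constant $K$ such that, for every such $G$ and every $R_M\in(0,0.3)$, the program halts after at most $K\,n^3\,\Delta(G)$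 steps with a triple $(E_T,m,\alpha)$ that Algorithm 3 can return. 4. On every input as in 1, and for all choices it makes, Algorithm 1 has at most $2n$ active subsets at each step. 5. On every input as in 2, and for all choices it makes, at each step of Algorithm 2 every node is adjacent to (that is, lies in $N(S)$ for) at most five un-restricted active subsets $S$. -/

import Mathlib

open Finset

noncomputable section

namespace Mule

/-! ## Neighbourhoods and unit disk graphs -/

section Graph

variable {V : Type*} [Fintype V] [DecidableEq V] (G : SimpleGraph V) [DecidableRel G.Adj]

/-- `N(S)`: the nodes outside `S` that have a neighbour in `S`. -/
def nbr (S : Finset V) : Finset V := {u | u ∉ S ∧ ∃ v ∈ S, G.Adj v u}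

/-- `S` is dominating: `N(S) ∪ S = V`. -/
def IsDominating (S : Finset V) : Prop := nbr G S ∪ S = univ

/-- No two nodes of `S` are adjacent. -/
def IsIndependent (S : Finset V) : Prop := ∀ u ∈ S, ∀ v ∈ S, ¬ G.Adj u v

end Graph

/-- The unit disk graph of a family of points of the Euclidean plane. -/
def udg {n : ℕ} (p : Fin n → EuclideanSpace ℝ (Fin 2)) : SimpleGraph (Fin n) where
  Adj u v := u ≠ v ∧ dist (p u) (p v) ≤ 1
  symm := ⟨fun _ _ h => ⟨h.1.symm, by rw [dist_comm]; exact h.2⟩⟩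
  loopless := ⟨fun _ h => h.1 rfl⟩

instance udgDecidable {n : ℕ} (p : Fin n → EuclideanSpace ℝ (Fin 2)) :
    DecidableRel (udg p).Adj := Classical.decRel _

/-! ## The loop construct `repeat ... until ...` -/

/-- `RepeatUntil body halt a b`: executing `repeat body until halt` from `a` may end in `b`.
The body is executed at least once; it may be nondeterministic. -/
inductive RepeatUntil {α : Type*} (body : α → α → Prop) (halt : α → Prop) : α → α → Prop
  | last {a b : α} : body a b → halt b → RepeatUntil body halt a b
  | again {a b c : α} : body a b → ¬ halt b → RepeatUntil body halt b c →
      RepeatUntil body halt a c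

/-! ## The part of the state shared by the two primal-dual algorithms -/

/-- The collection of active subsets, with the values `y(S)` and the indicators `g(S)`.
Only the values at active subsets are ever used. A subset is restricted if `g(S) = 0` and
un-restricted if `g(S) = 1`. -/
structure Dual (V : Type*) where
  active : Finset (Finset V)
  y : Finset V → ℝ
  g : Finset V → ℕ

section Algorithms

variable {V : Type*} [Fintype V] [DecidableEq V] (G : SimpleGraph V) [DecidableRel G.Adj]

/-- The sum of `g(S)` over the active subsets `S` adjacent to `v`. -/
def sumG (D : Dual V) (v : V) : ℕ := ∑ S ∈ D.active with v ∈ nbr G S, D.g S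

/-- The sum of `y(S)` over the active subsets `S` adjacent to `v`. -/
def sumY (D : Dual V) (v : V) : ℝ := ∑ S ∈ D.active with v ∈ nbr G S, D.y S

/-- The potential `ε(v)` for node capacities `c`. -/
def potential (c : V → ℝ) (D : Dual V) (v : V) : WithTop ℝ :=
  if sumG G D v = 0 then ⊤ else (((c v - sumY G D v) / (sumG G D v : ℝ) : ℝ) : WithTop ℝ)

/-- `v` is a node of minimum potential, and its potential is the real number `ε`. -/
def Selects (c : V → ℝ) (D : Dual V) (v : V) (ε : ℝ) : Prop :=
  potential G c D v = (ε : WithTop ℝ) ∧ ∀ u, potential G c D v ≤ potential G c D u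

/-- For each active `S`: increase `y(S)` by `g(S) ε`; then set `g(S)` to `0` if `v ∈ N(S)`. -/
def raise (D : Dual V) (v : V) (ε : ℝ) : Dual V where
  active := D.active
  y S := if S ∈ D.active then D.y S + D.g S * ε else D.y S
  g S := if S ∈ D.active ∧ v ∈ nbr G S then 0 else D.g S

/-- Make all members `S` of `F` active with `y(S) = 0` and `g(S) = 1`. -/
def activate (D : Dual V) (F : Finset (Finset V)) : Dual V where
  active := D.active ∪ F
  y S := if S ∈ F then 0 else D.y S
  g S := if S ∈ F then 1 else D.g S

/-! ## Algorithm 1: independent dominating set -/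

/-- State of Algorithm 1. `A` is the set of selected nodes and `first` the node selected in the
first step. -/
structure DSState (V : Type*) where
  ds : Finset V
  A : Finset V
  first : Option V
  dual : Dual V

/-- State before the loop. -/
def dsStart : DSState V where
  ds := ∅
  A := ∅
  first := none
  dual :=
    { active := univ.image fun v => {v}
      y := fun _ => 0
      g := fun _ => 1 }

/-- The loop body after node `v` with potential `ε` has been found. The subset `V \ {u}` is
adjacent to `u` only, so the iterations of the loop over the non-selected nodes `u` do not
influence each other, and the subsets that it creates are collected in one step. -/
def dsUpdate (σ : DSState V) (v : V) (ε : ℝ) : DSState V :=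
  let A' := insert v σ.A
  let D := raise G σ.dual v ε
  { ds := if v ∉ nbr G σ.ds ∪ σ.ds then insert v σ.ds else σ.ds
    A := A'
    first := some (σ.first.getD v)
    dual := activate D ((univ.filter fun u => u ∉ A' ∧ sumG G D u = 0).image fun u => univ \ {u}) }

/-- One execution of the loop body, for node weights `w`. -/
def DSStep (w : V → ℝ) (σ σ' : DSState V) : Prop :=
  ∃ v ε, Selects G (fun x => 1 / 100 * w x) σ.dual v ε ∧ σ' = dsUpdate G σ v ε

/-- Algorithm 1 on `(G, w)` may return `ds` and `LB1`, with `r` the node selected first. -/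
def DSReturns (w : V → ℝ) (ds : Finset V) (LB1 : ℝ) (r : V) : Prop :=
  ∃ σ : DSState V, RepeatUntil (DSStep G w) (fun τ => IsDominating G τ.ds) dsStart σ ∧
    ds = σ.ds ∧ LB1 = ∑ v, σ.dual.y {v} ∧ σ.first = some r

/-! ## Algorithm 2: connected dominating set -/

/-- State of Algorithm 2. -/
structure CDSState (V : Type*) where
  cds : Finset V
  dual : Dual V

/-- State before the loop, for node weights `w` and the given set `ds`. -/
def cdsStart (w : V → ℝ) (ds : Finset V) : CDSState V where
  cds := ds
  dual :=
    { active := ds.image fun v => {v}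
      y := fun S => 99 / 500 * ((∑ v ∈ S, w v) - 2)
      g := fun _ => 1 }

/-- The un-restricted active subsets that contain a neighbour of `v`. -/
def coll1 (D : Dual V) (v : V) : Finset (Finset V) :=
  D.active.filter fun S => D.g S = 1 ∧ (S ∩ nbr G {v}).Nonempty

/-- The un-restricted active subsets that contain a neighbour of `v` belonging to `cds`. -/
def coll2 (D : Dual V) (cds : Finset V) (v : V) : Finset (Finset V) :=
  D.active.filter fun S => D.g S = 1 ∧ (S ∩ nbr G {v} ∩ cds).Nonempty

/-- The loop body after node `v` with potential `ε` has been found, where `f` chooses one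
neighbour of `v` from each of the subsets in `coll1 \ coll2`. -/
def cdsUpdate (σ : CDSState V) (v : V) (ε : ℝ) (f : Finset V → V) : CDSState V where
  cds :=
    if 1 < sumG G σ.dual v then
      insert v σ.cds ∪ (coll1 G σ.dual v \ coll2 G σ.dual σ.cds v).image f
    else σ.cds
  dual := activate (raise G σ.dual v ε) {insert v ((coll1 G σ.dual v).biUnion id)}

/-- One execution of the loop body, for node weights `w`. -/
def CDSStep (w : V → ℝ) (σ σ' : CDSState V) : Prop :=
  ∃ v ε f, Selects G (fun x => 99 / 100 * w x) σ.dual v ε ∧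
    (∀ S ∈ coll1 G σ.dual v \ coll2 G σ.dual σ.cds v, f S ∈ S ∩ nbr G {v}) ∧
    σ' = cdsUpdate G σ v ε f

/-- Algorithm 2 on `(G, w, ds)` may return `cds` and `LB2`. -/
def CDSReturns (w : V → ℝ) (ds cds : Finset V) (LB2 : ℝ) : Prop :=
  ∃ σ : CDSState V,
    RepeatUntil (CDSStep G w) (fun τ => ∑ S ∈ τ.dual.active, τ.dual.g S = 1)
      (cdsStart w ds) σ ∧
    cds = σ.cds ∧ LB2 = ∑ v ∈ ds, σ.dual.y {v}

/-! ## Algorithm 3: data gathering tree -/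

/-- The data kept for a candidate location `m` of the MULE. -/
structure Candidate (V : Type*) where
  m : V
  cds : Finset V
  weight : ℝ
  LB : ℝ
  r : V

/-- Running Algorithms 1 and 2 for the location `m` with node weights `w` may produce `a`. -/
def Produces (w : V → ℝ) (m : V) (a : Candidate V) : Prop :=
  ∃ ds LB1 LB2, DSReturns G w ds LB1 a.r ∧ CDSReturns G w ds a.cds LB2 ∧
    a.m = m ∧ a.weight = ∑ v ∈ a.cds, w v ∧ a.LB = LB1 + LB2

/-- Replace the best candidate so far (`none` before the first one) by a strictly lighter one. -/
def keepBetter (best : Option (Candidate V)) (a : Candidate V) : Option (Candidate V) :=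
  match best with
  | none => some a
  | some b => if a.weight < b.weight then some a else some b

/-- The loop over the candidate locations in the given list; `W m` are the node weights for the
location `m`. The second argument is the best candidate before the loop, the third one after. -/
inductive Search (W : V → V → ℝ) :
    List V → Option (Candidate V) → Option (Candidate V) → Prop
  | nil (best : Option (Candidate V)) : Search W [] best best
  | cons {m : V} {l : List V} {best res : Option (Candidate V)} {a : Candidate V} :
      Produces G (W m) m a → Search W l (keepBetter best a) res → Search W (m :: l) best res

/-- Breadth first search in the subgraph induced by `U`. `BFS G U q vis pre pre'`: from the queue
`q`, the visited nodes `vis` and the predecessors `pre`, it may end with the predecessors `pre'`.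
In each round the first node `u` of the queue is removed, and its unvisited neighbours, in any
order `l`, are visited, get the predecessor `u`, and are appended to the queue. -/
inductive BFS (U : Finset V) :
    List V → Finset V → (V → Option V) → (V → Option V) → Prop
  | nil (vis : Finset V) (pre : V → Option V) : BFS U [] vis pre pre
  | cons {u : V} {q l : List V} {vis : Finset V} {pre pre' : V → Option V} :
      l.Nodup → (∀ x, x ∈ l ↔ x ∈ U ∧ x ∉ vis ∧ G.Adj u x) →
      BFS U (q ++ l) (vis ∪ l.toFinset) (fun x => if x ∈ l then some u else pre x) pre' →
      BFS U (u :: q) vis pre pre'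

end Algorithms

/-- The additive constant in the node weights, for MULE transmission range `RM`. -/
def weightConst (RM : ℝ) : ℝ :=
  3 + RM + Real.pi * (1 + RM) * (1 + (⌈(1 - RM) / (2 * RM)⌉ : ℝ))

/-- Algorithm 3 on the unit disk graph of `p`, with the constant `C` in the node weights, may
return the tree with edge set `E` (directed towards the root), the location `m` and the ratio
`α`. -/
def TreeReturns {n : ℕ} (p : Fin n → EuclideanSpace ℝ (Fin 2)) (C : ℝ)
    (E : Finset (Fin n × Fin n)) (m : Fin n) (α : ℝ) : Prop :=
  ∃ (order : List (Fin n)) (b : Candidate (Fin n)) (pre : Fin n → Option (Fin n))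
    (near : Fin n → Fin n),
    order.Nodup ∧ (∀ v, v ∈ order) ∧
    Search (udg p) (fun m' v => 2 * dist (p m') (p v) + C) order none (some b) ∧
    BFS (udg p) b.cds [b.r] {b.r} (fun _ => none) pre ∧
    (∀ u, u ∉ b.cds ∪ {b.r} →
      near u ∈ b.cds ∧ ∀ x ∈ b.cds, dist (p u) (p (near u)) ≤ dist (p u) (p x)) ∧
    E = univ.filter (fun e : Fin n × Fin n =>
      (e.1 ∈ b.cds \ {b.r} ∧ pre e.1 = some e.2) ∨ (e.1 ∉ b.cds ∪ {b.r} ∧ e.2 = near e.1)) ∧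
    m = b.m ∧ α = b.weight / b.LB

/-! ## The machine: a real RAM with structured programs and unit-cost operations

The memory consists of integer registers, real registers, two-dimensional integer arrays and
one-dimensional real arrays. A program is a finite text that fixes which registers and arrays it
uses; only array indices are computed at run time. Every arithmetic operation, comparison, memory
access, constant and control action costs one unit. There is no conversion from reals to
integers. -/

/-- Memory contents. -/
structure Store where
  nat : ℕ → ℕ
  real : ℕ → ℝ
  natArr : ℕ → ℕ → ℕ → ℕ
  realArr : ℕ → ℕ → ℝ

/-- Integer expressions. -/
inductive NExp
  | const (k : ℕ)
  | reg (x : ℕ)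
  | cell (a : ℕ) (i j : NExp)
  | add (e f : NExp)
  | sub (e f : NExp)

/-- Value of an integer expression (subtraction is truncated at `0`). -/
def NExp.eval (s : Store) : NExp → ℕ
  | const k => k
  | reg x => s.nat x
  | cell a i j => s.natArr a (i.eval s) (j.eval s)
  | add e f => e.eval s + f.eval s
  | sub e f => e.eval s - f.eval s

/-- Number of unit operations of an integer expression. -/
def NExp.cost : NExp → ℕ
  | const _ => 1
  | reg _ => 1
  | cell _ i j => i.cost + j.cost + 1
  | add e f => e.cost + f.cost + 1
  | sub e f => e.cost + f.cost + 1

/-- Real expressions. -/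
inductive RExp
  | ofNat (e : NExp)
  | reg (x : ℕ)
  | cell (a : ℕ) (i : NExp)
  | add (e f : RExp)
  | sub (e f : RExp)
  | mul (e f : RExp)
  | div (e f : RExp)
  | sqrt (e : RExp)

/-- Value of a real expression. -/
def RExp.eval (s : Store) : RExp → ℝ
  | ofNat e => (e.eval s : ℝ)
  | reg x => s.real x
  | cell a i => s.realArr a (i.eval s)
  | add e f => e.eval s + f.eval s
  | sub e f => e.eval s - f.eval s
  | mul e f => e.eval s * f.eval s
  | div e f => e.eval s / f.eval s
  | sqrt e => Real.sqrt (e.eval s)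

/-- Number of unit operations of a real expression. -/
def RExp.cost : RExp → ℕ
  | ofNat e => e.cost + 1
  | reg _ => 1
  | cell _ i => i.cost + 1
  | add e f => e.cost + f.cost + 1
  | sub e f => e.cost + f.cost + 1
  | mul e f => e.cost + f.cost + 1
  | div e f => e.cost + f.cost + 1
  | sqrt e => e.cost + 1

/-- Tests. -/
inductive Test
  | natLt (e f : NExp)
  | natEq (e f : NExp)
  | realLt (e f : RExp)
  | neg (b : Test)
  | conj (b c : Test)

/-- Truth of a test. -/
def Test.Holds (s : Store) : Test → Prop
  | natLt e f => e.eval s < f.eval s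
  | natEq e f => e.eval s = f.eval s
  | realLt e f => e.eval s < f.eval s
  | neg b => ¬ b.Holds s
  | conj b c => b.Holds s ∧ c.Holds s

/-- Number of unit operations of a test. -/
def Test.cost : Test → ℕ
  | natLt e f => e.cost + f.cost + 1
  | natEq e f => e.cost + f.cost + 1
  | realLt e f => e.cost + f.cost + 1
  | neg b => b.cost + 1
  | conj b c => b.cost + c.cost + 1

/-- Programs. -/
inductive Prog
  | skip
  | setNat (x : ℕ) (e : NExp)
  | setReal (x : ℕ) (e : RExp)
  | putNat (a : ℕ) (i j e : NExp)
  | putReal (a : ℕ) (i : NExp) (e : RExp)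
  | seq (c d : Prog)
  | branch (b : Test) (c d : Prog)
  | loop (b : Test) (c : Prog)

/-- `Exec c s s' t`: started in `s`, the program `c` halts in `s'` after exactly `t` steps.
`branch` is if-then-else, and `loop b c` repeats `c` as long as `b` holds. -/
inductive Exec : Prog → Store → Store → ℕ → Prop
  | skip (s : Store) : Exec .skip s s 1
  | setNat (x : ℕ) (e : NExp) (s : Store) :
      Exec (.setNat x e) s
        { s with nat := fun z => if z = x then e.eval s else s.nat z } (e.cost + 1)
  | setReal (x : ℕ) (e : RExp) (s : Store) :
      Exec (.setReal x e) s
        { s with real := fun z => if z = x then e.eval s else s.real z } (e.cost + 1)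
  | putNat (a : ℕ) (i j e : NExp) (s : Store) :
      Exec (.putNat a i j e) s
        { s with natArr := fun b k l =>
            if b = a ∧ k = i.eval s ∧ l = j.eval s then e.eval s else s.natArr b k l }
        (i.cost + j.cost + e.cost + 1)
  | putReal (a : ℕ) (i : NExp) (e : RExp) (s : Store) :
      Exec (.putReal a i e) s
        { s with realArr := fun b k =>
            if b = a ∧ k = i.eval s then e.eval s else s.realArr b k }
        (i.cost + e.cost + 1)
  | seq {c d : Prog} {s s' s'' : Store} {t t' : ℕ} :
      Exec c s s' t → Exec d s' s'' t' → Exec (.seq c d) s s'' (t + t')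
  | branchTrue {b : Test} {c d : Prog} {s s' : Store} {t : ℕ} :
      b.Holds s → Exec c s s' t → Exec (.branch b c d) s s' (b.cost + 1 + t)
  | branchFalse {b : Test} {c d : Prog} {s s' : Store} {t : ℕ} :
      ¬ b.Holds s → Exec d s s' t → Exec (.branch b c d) s s' (b.cost + 1 + t)
  | loopFalse {b : Test} {c : Prog} {s : Store} :
      ¬ b.Holds s → Exec (.loop b c) s s (b.cost + 1)
  | loopTrue {b : Test} {c : Prog} {s s' s'' : Store} {t t' : ℕ} :
      b.Holds s → Exec c s s' t → Exec (.loop b c) s' s'' t' →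
      Exec (.loop b c) s s'' (b.cost + 1 + t + t')

/-! ## How inputs and outputs are stored -/

section Encoding

variable {n : ℕ}

/-- The graph is stored by adjacency lists: integer register `0` holds the number of nodes, column
`0` of array `1` holds the degrees, and row `v` of array `0` begins with the neighbours of `v`, in
any order. (A row lists all `deg v` neighbours in `deg v` places, so there are no repetitions.) -/
structure StoresGraph (G : SimpleGraph (Fin n)) [DecidableRel G.Adj] (s : Store) : Prop where
  size : s.nat 0 = n
  deg : ∀ v : Fin n, s.natArr 1 v 0 = G.degree v
  adj : ∀ v u : Fin n, G.Adj v u ↔ ∃ j < G.degree v, s.natArr 0 v j = u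

/-- Column `0` of integer array `a` is the indicator function of `S`. -/
def StoresSet (a : ℕ) (S : Finset (Fin n)) (s : Store) : Prop :=
  ∀ v : Fin n, s.natArr a v 0 = if v ∈ S then 1 else 0

/-- Real array `a` holds the values of `f`. -/
def StoresReals (a : ℕ) (f : Fin n → ℝ) (s : Store) : Prop :=
  ∀ v : Fin n, s.realArr a v = f v

/-- Integer register `2` holds the number of directed edges, which are listed, in any order and
without repetition, in column `0` of the integer arrays `4` (tails) and `5` (heads). -/
structure StoresEdges (E : Finset (Fin n × Fin n)) (s : Store) : Prop where
  size : s.nat 2 = E.card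
  edge : ∀ u v : Fin n, (u, v) ∈ E ↔
    ∃ i < E.card, s.natArr 4 i 0 = u ∧ s.natArr 5 i 0 = v

end Encoding

end Mule

end

open Mule

open Mule

/-! Each round of Algorithms 1 and 2 can be carried out in O(nΔ) steps without storing the active
sets. A raise changes the sum of `y` over the sets adjacent to a node by ε times the sum of `g`
(`sumY_raise`), so two sums per node suffice for all potentials, provided that no activation
overwrites a set that is already active.

In Algorithm 1 only sets `{x}` and `V \ {u}` ever become active, whence the bound 2n
(`card_active_le`). The set `V \ {u}` is adjacent to `u` alone; `{x}` is restricted iff `x` has a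
selected neighbour, and `V \ {u}` iff `u` is selected (`DSInv`). The sum of `g` at `u` is therefore
computed from the neighbours of `u`. Selected nodes have infinite potential and all others finite
potential, so each round selects a new node; selected nodes are dominated, so at most n rounds are
made.

In Algorithm 2 the un-restricted active sets are the classes of a partition of a set `U`, namely
`ds` and the nodes selected so far, and adjacent nodes of `U` lie in the same class (`CDSInv`). The
partition is stored by labels. A node of `U` is adjacent to no class, any other node to as many
classes as there are labels among its neighbours in `U`; marking labels counts them in O(Δ). The
selected node lies outside `U`, so `U` grows in each round. If no potential were finite,
connectivity would give `U = V` and a single class.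

For the bound five, take a neighbour of `u` in each un-restricted set adjacent to `u`. These lie in
different classes, so they are points of a unit disk at pairwise distances above one. By
`card_le_five` there are at most five: cut the disk into six sectors of 60° with one of the points
on a boundary ray; the two sectors at that ray contain no other point, and the remaining four at
most one each.

For the running time, the programs are written in the language `Code`, whose loops are bounded by n
or Δ and whose semantics is a function. By `exec_run` and `cost_le` a time bound is a statement
about nesting depth: two levels of n (three for Algorithm 3) and one of Δ. Correctness is a
simulation, in which `DSRep`, `CDSRep` and `BFSRep` relate memory and abstract state. -/

namespace Mule

/-! ## Bounded-loop code with a functional semantics -/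

/-- Store `k` in integer register `x`. -/
def Store.setN (s : Store) (x k : ℕ) : Store :=
  { s with nat := fun z => if z = x then k else s.nat z }

/-- Programs whose only loops are `for i < (register b)`. -/
inductive Code
  | skip
  | setNat (x : ℕ) (e : NExp)
  | setReal (x : ℕ) (e : RExp)
  | putNat (a : ℕ) (i e : NExp)
  | putReal (a : ℕ) (i : NExp) (e : RExp)
  | seq (c d : Code)
  | branch (b : Test) (c d : Code)
  | forN (i b : ℕ) (c : Code)

namespace Code

/-- The store after `k` rounds of a loop with index register `i`. -/
def rounds (f : Store → Store) (i : ℕ) (s : Store) : ℕ → Store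
  | 0 => s.setN i 0
  | k + 1 => (f (rounds f i s k)).setN i (k + 1)

open scoped Classical in
/-- The final store. -/
noncomputable def run : Code → Store → Store
  | skip, s => s
  | setNat x e, s => { s with nat := fun z => if z = x then e.eval s else s.nat z }
  | setReal x e, s => { s with real := fun z => if z = x then e.eval s else s.real z }
  | putNat a i e, s =>
    { s with natArr := fun a' k l =>
        if a' = a ∧ k = i.eval s ∧ l = 0 then e.eval s else s.natArr a' k l }
  | putReal a i e, s =>
    { s with realArr := fun a' k =>
        if a' = a ∧ k = i.eval s then e.eval s else s.realArr a' k }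
  | seq c d, s => d.run (c.run s)
  | branch b c d, s => if b.Holds s then c.run s else d.run s
  | forN i b c, s => rounds c.run i s (s.nat b)

theorem run_seq (c d : Code) (s : Store) : (seq c d).run s = d.run (c.run s) := rfl

theorem run_pos {b : Test} {c d : Code} {s : Store} (h : b.Holds s) :
    (branch b c d).run s = c.run s := if_pos h

theorem run_neg {b : Test} {c d : Code} {s : Store} (h : ¬ b.Holds s) :
    (branch b c d).run s = d.run s := if_neg h

/-- Translation to programs of the machine. -/
def compile : Code → Prog
  | skip => .skip
  | setNat x e => .setNat x e
  | setReal x e => .setReal x e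
  | putNat a i e => .putNat a i (.const 0) e
  | putReal a i e => .putReal a i e
  | seq c d => .seq c.compile d.compile
  | branch b c d => .branch b c.compile d.compile
  | forN i b c => .seq (.setNat i (.const 0)) (.loop (.natLt (.reg i) (.reg b))
      (.seq c.compile (.setNat i (.add (.reg i) (.const 1)))))

/-- Is integer register `x` written? -/
def wN : Code → ℕ → Bool
  | setNat y _, x => x == y
  | seq c d, x => c.wN x || d.wN x
  | branch _ c d, x => c.wN x || d.wN x
  | forN i _ c, x => x == i || c.wN x
  | _, _ => false

/-- Is real register `x` written? -/
def wR : Code → ℕ → Bool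
  | setReal y _, x => x == y
  | seq c d, x => c.wR x || d.wR x
  | branch _ c d, x => c.wR x || d.wR x
  | forN _ _ c, x => c.wR x
  | _, _ => false

/-- Is integer array `x` written? -/
def wNA : Code → ℕ → Bool
  | putNat y _ _, x => x == y
  | seq c d, x => c.wNA x || d.wNA x
  | branch _ c d, x => c.wNA x || d.wNA x
  | forN _ _ c, x => c.wNA x
  | _, _ => false

/-- Is real array `x` written? -/
def wRA : Code → ℕ → Bool
  | putReal y _ _, x => x == y
  | seq c d, x => c.wRA x || d.wRA x
  | branch _ c d, x => c.wRA x || d.wRA x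
  | forN _ _ c, x => c.wRA x
  | _, _ => false

/-- `s` and `s'` agree on everything that `c` does not write. -/
structure Agrees (c : Code) (s s' : Store) : Prop where
  nat : ∀ x, c.wN x = false → s'.nat x = s.nat x
  real : ∀ x, c.wR x = false → s'.real x = s.real x
  natArr : ∀ a, c.wNA a = false → s'.natArr a = s.natArr a
  realArr : ∀ a, c.wRA a = false → s'.realArr a = s.realArr a

theorem Agrees.refl (c : Code) (s : Store) : c.Agrees s s :=
  ⟨fun _ _ => rfl, fun _ _ => rfl, fun _ _ => rfl, fun _ _ => rfl⟩

theorem Agrees.trans {c : Code} {s s' s'' : Store} (h : c.Agrees s s') (h' : c.Agrees s' s'') :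
    c.Agrees s s'' :=
  ⟨fun x hx => (h'.nat x hx).trans (h.nat x hx), fun x hx => (h'.real x hx).trans (h.real x hx),
    fun x hx => (h'.natArr x hx).trans (h.natArr x hx),
    fun x hx => (h'.realArr x hx).trans (h.realArr x hx)⟩

theorem Agrees.mono {c d : Code} {s s' : Store} (h : c.Agrees s s')
    (h1 : ∀ x, d.wN x = false → c.wN x = false) (h2 : ∀ x, d.wR x = false → c.wR x = false)
    (h3 : ∀ x, d.wNA x = false → c.wNA x = false)
    (h4 : ∀ x, d.wRA x = false → c.wRA x = false) : d.Agrees s s' :=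
  ⟨fun x hx => h.nat x (h1 x hx), fun x hx => h.real x (h2 x hx),
    fun x hx => h.natArr x (h3 x hx), fun x hx => h.realArr x (h4 x hx)⟩

theorem agrees_setN {i b : ℕ} {c : Code} (s : Store) (k : ℕ) :
    (forN i b c).Agrees s (s.setN i k) :=
  ⟨fun x hx => by
    have : x ≠ i := by rintro rfl; simp [wN] at hx
    simp [Store.setN, this], fun _ _ => rfl, fun _ _ => rfl, fun _ _ => rfl⟩

theorem agrees_body {i b : ℕ} {c : Code} {s s' : Store} (h : c.Agrees s s') :
    (forN i b c).Agrees s s' :=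
  h.mono (fun x hx => by simp_all [wN]) (fun x hx => by simp_all [wR])
    (fun x hx => by simp_all [wNA]) (fun x hx => by simp_all [wRA])

theorem agrees_rounds {i b : ℕ} {c : Code} (hc : ∀ s, c.Agrees s (c.run s)) (s : Store) (k : ℕ) :
    (forN i b c).Agrees s (rounds c.run i s k) := by
  induction k with
  | zero => exact agrees_setN s 0
  | succ k ih => exact (ih.trans (agrees_body (hc _))).trans (agrees_setN _ _)

/-- This is the frame rule. The write sets are Boolean functions of the program text, so that a
concrete program leaves a register or an array alone is later proved by `rfl`. -/
theorem agrees_run (c : Code) (s : Store) : c.Agrees s (c.run s) := by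
  induction c generalizing s with
  | skip => exact Agrees.refl _ _
  | setNat y e =>
    exact ⟨fun x hx => by simp_all [wN, run], fun _ _ => rfl, fun _ _ => rfl, fun _ _ => rfl⟩
  | setReal y e =>
    exact ⟨fun _ _ => rfl, fun x hx => by simp_all [wR, run], fun _ _ => rfl, fun _ _ => rfl⟩
  | putNat a i e =>
    exact ⟨fun _ _ => rfl, fun _ _ => rfl, fun x hx => by
      funext k l; simp_all [wNA, run], fun _ _ => rfl⟩
  | putReal a i e =>
    exact ⟨fun _ _ => rfl, fun _ _ => rfl, fun _ _ => rfl, fun x hx => by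
      funext k; simp_all [wRA, run]⟩
  | seq c d ihc ihd =>
    exact ((ihc s).mono (fun x hx => by simp_all [wN]) (fun x hx => by simp_all [wR])
      (fun x hx => by simp_all [wNA]) (fun x hx => by simp_all [wRA])).trans
      ((ihd _).mono (fun x hx => by simp_all [wN]) (fun x hx => by simp_all [wR])
      (fun x hx => by simp_all [wNA]) (fun x hx => by simp_all [wRA]))
  | branch b c d ihc ihd =>
    simp only [run]
    split_ifs
    · exact ((ihc s).mono (fun x hx => by simp_all [wN]) (fun x hx => by simp_all [wR])
        (fun x hx => by simp_all [wNA]) (fun x hx => by simp_all [wRA]))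
    · exact ((ihd _).mono (fun x hx => by simp_all [wN]) (fun x hx => by simp_all [wR])
        (fun x hx => by simp_all [wNA]) (fun x hx => by simp_all [wRA]))
  | forN i b c ih => exact agrees_rounds ih s _

/-! ### Running time of bounded-loop code -/

/-- Loops do not change their bounds and indices, and all bounds are registers `0` or `3`. -/
def wf : Code → Bool
  | seq c d => c.wf && d.wf
  | branch _ c d => c.wf && d.wf
  | forN i b c => !c.wN i && (!c.wN b && (i != b && ((b == 0 || b == 3) && c.wf)))
  | _ => true

/-- Bound on the number of steps, when registers `0` and `3` hold `N` and `D`. -/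
def cost (N D : ℕ) : Code → ℕ
  | skip => 1
  | setNat _ e => e.cost + 1
  | setReal _ e => e.cost + 1
  | putNat _ i e => i.cost + 1 + e.cost + 1
  | putReal _ i e => i.cost + e.cost + 1
  | seq c d => c.cost N D + d.cost N D
  | branch b c d => b.cost + 1 + (c.cost N D + d.cost N D)
  | forN _ b c => 6 + (if b = 0 then N else D) * (8 + c.cost N D)

/-- By `wf` the body changes neither index nor bound, so the translated while loop makes exactly as
many rounds as the bound register says at its start. Besides the body a round costs 4 for the test
and 4 for the increment; initialization and the last, failing test cost 2 + 4. -/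
theorem exec_run (c : Code) (hw : c.wf = true) (h0 : c.wN 0 = false) (h3 : c.wN 3 = false)
    (N D : ℕ) (s : Store) (hN : s.nat 0 = N) (hD : s.nat 3 = D) :
    ∃ t, t ≤ c.cost N D ∧ Exec c.compile s (c.run s) t := by
  induction c generalizing s with
  | skip => exact ⟨_, le_rfl, Exec.skip s⟩
  | setNat y e => exact ⟨_, le_rfl, Exec.setNat y e s⟩
  | setReal y e => exact ⟨_, le_rfl, Exec.setReal y e s⟩
  | putNat a i e => exact ⟨_, le_rfl, Exec.putNat a i (.const 0) e s⟩
  | putReal a i e => exact ⟨_, le_rfl, Exec.putReal a i e s⟩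
  | seq c d ihc ihd =>
    simp only [wf, wN, Bool.and_eq_true, Bool.or_eq_false_iff] at hw h0 h3
    obtain ⟨t, ht, h⟩ := ihc hw.1 h0.1 h3.1 s hN hD
    obtain ⟨t', ht', h'⟩ := ihd hw.2 h0.2 h3.2 (c.run s)
      (((agrees_run c s).nat 0 h0.1).trans hN) (((agrees_run c s).nat 3 h3.1).trans hD)
    exact ⟨_, add_le_add ht ht', Exec.seq h h'⟩
  | branch b c d ihc ihd =>
    simp only [wf, wN, Bool.and_eq_true, Bool.or_eq_false_iff] at hw h0 h3
    by_cases hb : b.Holds s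
    · obtain ⟨t, ht, h⟩ := ihc hw.1 h0.1 h3.1 s hN hD
      refine ⟨b.cost + 1 + t, by simp only [cost]; omega, ?_⟩
      simpa only [compile, run, if_pos hb] using Exec.branchTrue hb h
    · obtain ⟨t, ht, h⟩ := ihd hw.2 h0.2 h3.2 s hN hD
      refine ⟨b.cost + 1 + t, by simp only [cost]; omega, ?_⟩
      simpa only [compile, run, if_neg hb] using Exec.branchFalse hb h
  | forN i b c ih =>
    simp only [wf, wN, Bool.and_eq_true, Bool.or_eq_false_iff, Bool.not_eq_true', bne_iff_ne,
      Bool.or_eq_true, beq_iff_eq] at hw h0 h3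
    obtain ⟨hwi, hwb, hib, hb, hwc⟩ := hw
    set M := s.nat b with hM
    have hMb : M = if b = 0 then N else D := by
      rcases hb with rfl | rfl
      · simpa using hN
      · simpa using hD
    have ag : ∀ k, (forN i b c).Agrees s (rounds c.run i s k) := agrees_rounds (agrees_run c) s
    have wb : (forN i b c).wN b = false := by simp [wN, hwb, hib.symm]
    have w0 : (forN i b c).wN 0 = false := by simpa [wN] using h0
    have w3 : (forN i b c).wN 3 = false := by simpa [wN] using h3
    have hri : ∀ k, (rounds c.run i s k).nat i = k := by
      intro k; cases k <;> simp [rounds, Store.setN]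
    -- An execution of a loop is assembled from its last round backwards, so the induction is on the
    -- number `k` of rounds still to come.
    have main : ∀ k, k ≤ M → ∃ t, t ≤ k * (8 + c.cost N D) + 4 ∧
        Exec (.loop (.natLt (.reg i) (.reg b)) (.seq c.compile
          (.setNat i (.add (.reg i) (.const 1))))) (rounds c.run i s (M - k))
          (rounds c.run i s M) t := by
      intro k
      induction k with
      | zero =>
        intro _
        refine ⟨4, by omega, Exec.loopFalse ?_⟩
        simp [Test.Holds, NExp.eval, hri, (ag _).nat b wb, ← hM]
      | succ k ihk =>
        intro hk
        obtain ⟨t, ht, h⟩ := ihk (by omega)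
        obtain ⟨t', ht', h'⟩ := ih hwc h0.2 h3.2 (rounds c.run i s (M - (k + 1)))
          (((ag _).nat 0 w0).trans hN) (((ag _).nat 3 w3).trans hD)
        have e : M - k = M - (k + 1) + 1 := by omega
        have h2 : Exec (.setNat i (.add (.reg i) (.const 1)))
            (c.run (rounds c.run i s (M - (k + 1)))) (rounds c.run i s (M - k)) 4 := by
          have := Exec.setNat i (.add (.reg i) (.const 1)) (c.run (rounds c.run i s (M - (k + 1))))
          rw [e]
          convert this using 1
          · simp [rounds, Store.setN, NExp.eval, (agrees_run c _).nat i hwi, hri]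
          · rfl
        refine ⟨4 + (t' + 4) + t, by rw [add_mul]; omega, Exec.loopTrue ?_ (Exec.seq h' h2) h⟩
        simp only [Test.Holds, NExp.eval, hri, (ag _).nat b wb, ← hM]
        omega
    obtain ⟨t, ht, h⟩ := main M le_rfl
    refine ⟨2 + t, by simp only [cost, ← hMb]; omega, ?_⟩
    rw [Nat.sub_self] at h
    exact Exec.seq (Exec.setNat i (.const 0) s) h

/-- Nesting depth of the loops bounded by register `0`. -/
def depN : Code → ℕ
  | seq c d => max c.depN d.depN
  | branch _ c d => max c.depN d.depN
  | forN _ b c => (if b = 0 then 1 else 0) + c.depN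
  | _ => 0

/-- Nesting depth of the other loops. -/
def depD : Code → ℕ
  | seq c d => max c.depD d.depD
  | branch _ c d => max c.depD d.depD
  | forN _ b c => (if b = 0 then 0 else 1) + c.depD
  | _ => 0

/-- `c.cost 1 1` counts every loop as one round and depends on the text alone. Each level of nesting
contributes one factor `N` or `D`; terms of lower order are absorbed because both are at least 1. -/
theorem cost_le (c : Code) {N D : ℕ} (hN : 1 ≤ N) (hD : 1 ≤ D) {p q : ℕ} (hp : c.depN ≤ p)
    (hq : c.depD ≤ q) : c.cost N D ≤ c.cost 1 1 * (N ^ p * D ^ q) := by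
  induction c generalizing p q with
  | seq c d ihc ihd =>
    simp only [depN, depD, max_le_iff] at hp hq
    simp only [cost, add_mul]
    exact add_le_add (ihc hp.1 hq.1) (ihd hp.2 hq.2)
  | branch b c d ihc ihd =>
    simp only [depN, depD, max_le_iff] at hp hq
    simp only [cost]
    rw [add_mul, add_mul (c.cost 1 1)]
    exact add_le_add (Nat.le_mul_of_pos_right _ (by positivity))
      (add_le_add (ihc hp.1 hq.1) (ihd hp.2 hq.2))
  | forN i b c ih =>
    simp only [depN, depD, cost] at hp hq ⊢
    have key : ∀ {p q : ℕ}, c.depN ≤ p → c.depD ≤ q →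
        8 + c.cost N D ≤ (8 + c.cost 1 1) * (N ^ p * D ^ q) := fun h h' => by
      rw [add_mul]
      exact add_le_add (Nat.le_mul_of_pos_right _ (by positivity)) (ih h h')
    rw [add_mul]
    refine add_le_add (Nat.le_mul_of_pos_right _ (by positivity)) ?_
    split_ifs at hp hq ⊢ with hb
    -- One factor `N` pays for the rounds of this loop, the remaining power for its body.
    · obtain ⟨p, rfl⟩ : ∃ p', p = p' + 1 := ⟨p - 1, by omega⟩
      calc N * (8 + c.cost N D) ≤ N * ((8 + c.cost 1 1) * (N ^ p * D ^ q)) :=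
            Nat.mul_le_mul_left _ (key (by omega) (by omega))
        _ = _ := by ring
    · obtain ⟨q, rfl⟩ : ∃ q', q = q' + 1 := ⟨q - 1, by omega⟩
      calc D * (8 + c.cost N D) ≤ D * ((8 + c.cost 1 1) * (N ^ p * D ^ q)) :=
            Nat.mul_le_mul_left _ (key (by omega) (by omega))
        _ = _ := by ring
  | _ => exact Nat.le_mul_of_pos_right _ (by positivity)

/-! ## Loop rules -/

/-- Loop rule for an invariant indexed by the number of rounds. -/
theorem forN_rule {i b : ℕ} {c : Code} {s₀ : Store} {M : ℕ} (hM : s₀.nat b = M)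
    (Inv : ℕ → Store → Prop) (h0 : Inv 0 s₀)
    (hi : ∀ k s m, Inv k s → Inv k (s.setN i m))
    (hstep : ∀ k s, k < M → s.nat i = k → (forN i b c).Agrees s₀ s → Inv k s →
      Inv (k + 1) (c.run s)) :
    Inv M ((forN i b c).run s₀) := by
  simp only [run, hM]
  have : ∀ k, k ≤ M → Inv k (rounds c.run i s₀ k) := by
    intro k
    induction k with
    | zero => exact fun _ => hi _ _ _ h0
    | succ k ih =>
      intro hk
      refine hi _ _ _ (hstep k _ (by omega) ?_ (agrees_rounds (agrees_run c) s₀ k) (ih (by omega)))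
      cases k <;> simp [rounds, Store.setN]
  exact this M le_rfl

/-- Loop rule for a loop over all nodes, with an invariant indexed by the set of nodes treated. -/
theorem forN_rule_univ {n i b : ℕ} {c : Code} {s₀ : Store} (hn : s₀.nat b = n)
    (Inv : Finset (Fin n) → Store → Prop) (h0 : Inv ∅ s₀)
    (hi : ∀ T s m, Inv T s → Inv T (s.setN i m))
    (hstep : ∀ T (u : Fin n) s, u ∉ T → s.nat i = (u : ℕ) → (forN i b c).Agrees s₀ s → Inv T s →
      Inv (insert u T) (c.run s)) :
    Inv univ ((forN i b c).run s₀) := by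
  have := forN_rule hn (fun k s => Inv (univ.filter fun u : Fin n => (u : ℕ) < k) s)
    (c := c) (i := i) (by simpa using h0) (fun k s m h => hi _ s m h) (by
      intro k s hk his ag h
      have := hstep _ ⟨k, hk⟩ s (by simp) his ag h
      convert this using 1
      ext u
      simp only [mem_filter, mem_univ, true_and, mem_insert, Fin.ext_iff]
      omega)
  simpa using this

/-- Loop rule for a loop that treats the nodes independently of each other. -/
theorem forN_pointwise {n i b : ℕ} {c : Code} {s₀ : Store} (hn : s₀.nat b = n)
    (Old Post : Fin n → Store → Prop) (h0 : ∀ u, Old u s₀)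
    (hi : ∀ u s m, Old u s → Old u (s.setN i m))
    (hi' : ∀ u s m, Post u s → Post u (s.setN i m))
    (hstep : ∀ (u : Fin n) s, s.nat i = (u : ℕ) → (forN i b c).Agrees s₀ s → Old u s →
      Post u (c.run s) ∧ ∀ x, x ≠ u → (Old x s → Old x (c.run s)) ∧ (Post x s → Post x (c.run s))) :
    ∀ u, Post u ((forN i b c).run s₀) := by
  have := forN_rule_univ hn (fun T s => ∀ u, if u ∈ T then Post u s else Old u s)
    (c := c) (i := i) (by simpa using h0) (by
      intro T s m h u
      have := h u
      split_ifs at this ⊢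
      exacts [hi' _ _ _ this, hi _ _ _ this]) (by
      intro T u s hu his ag h x
      have hu' := h u
      rw [if_neg hu] at hu'
      obtain ⟨h1, h2⟩ := hstep u s his ag hu'
      by_cases hx : x = u
      · subst hx; simpa using h1
      · have := h x
        simp only [mem_insert, hx, false_or]
        split_ifs at this ⊢
        exacts [(h2 x hx).2 this, (h2 x hx).1 this])
  intro u
  simpa using this u

/-! ### The graph in memory and loops over neighbours -/

/-- The memory holds the graph, and register `3` its maximum degree. -/
structure Graphed {n : ℕ} (G : SimpleGraph (Fin n)) [DecidableRel G.Adj] (s : Store) : Prop where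
  graph : StoresGraph G s
  deg : s.nat 3 = G.maxDegree

theorem Graphed.congr {n : ℕ} {G : SimpleGraph (Fin n)} [DecidableRel G.Adj] {s s' : Store}
    (h : Graphed G s) (h0 : s'.nat 0 = s.nat 0) (h3 : s'.nat 3 = s.nat 3)
    (ha : s'.natArr 0 = s.natArr 0) (hb : s'.natArr 1 = s.natArr 1) : Graphed G s' :=
  ⟨⟨h0 ▸ h.graph.size, fun v => by rw [hb]; exact h.graph.deg v,
    fun v u => by rw [ha]; exact h.graph.adj v u⟩, h3 ▸ h.deg⟩

theorem Graphed.of_agrees {n : ℕ} {G : SimpleGraph (Fin n)} [DecidableRel G.Adj] {s s' : Store}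
    (h : Graphed G s) {c : Code} (hc : c.Agrees s s') (h0 : c.wN 0 = false := by rfl)
    (h3 : c.wN 3 = false := by rfl) (ha : c.wNA 0 = false := by rfl)
    (hb : c.wNA 1 = false := by rfl) : Graphed G s' :=
  h.congr (hc.nat 0 h0) (hc.nat 3 h3) (hc.natArr 0 ha) (hc.natArr 1 hb)

/-- Loop over the neighbours of the node in register `v`; the neighbour is put into register
`13`, and register `12` is the index of the loop. -/
def forNbr (v : ℕ) (c : Code) : Code :=
  .forN 12 3 (.branch (.natLt (.reg 12) (.cell 1 (.reg v) (.const 0)))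
    (.seq (.setNat 13 (.cell 0 (.reg v) (.reg 12))) c) .skip)

/-- The loop makes Δ rounds for every node and skips the places beyond the degree. A row has `deg v`
places for `deg v` neighbours, so each neighbour occurs exactly once, and the invariant can be
indexed by the set of neighbours treated. -/
theorem forNbr_rule {n : ℕ} {G : SimpleGraph (Fin n)} [DecidableRel G.Adj] {v : ℕ} {c : Code}
    {s₀ : Store} (hg : Graphed G s₀) {v₀ : Fin n} (hv : s₀.nat v = (v₀ : ℕ))
    (Inv : Finset (Fin n) → Store → Prop) (h0 : Inv ∅ s₀)
    (hi : ∀ T s m, Inv T s → Inv T (s.setN 12 m))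
    (hi' : ∀ T s m, Inv T s → Inv T (s.setN 13 m))
    (hstep : ∀ T (u : Fin n) s, u ∉ T → G.Adj v₀ u → s.nat 13 = (u : ℕ) → (forNbr v c).Agrees s₀ s →
      Inv T s → Inv (insert u T) (c.run s))
    (hwv : (forNbr v c).wN v = false := by rfl)
    (h1 : (forNbr v c).wNA 0 = false := by rfl) (h2 : (forNbr v c).wNA 1 = false := by rfl) :
    Inv (G.neighborFinset v₀) ((forNbr v c).run s₀) := by
  set d := G.degree v₀
  have hdD : d ≤ s₀.nat 3 := by rw [hg.deg]; exact G.degree_le_maxDegree v₀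
  have hex : ∀ j, j < d → ∃ u : Fin n, s₀.natArr 0 v₀ j = u := by
    -- the `d` neighbours occupy `d` places
    have hsub : (G.neighborFinset v₀).image (fun u : Fin n => (u : ℕ)) ⊆
        (range d).image (fun j => s₀.natArr 0 v₀ j) := by
      intro k hk
      obtain ⟨u, hu, rfl⟩ := mem_image.1 hk
      obtain ⟨j, hj, e⟩ := (hg.graph.adj v₀ u).1 (by simpa using hu)
      exact mem_image.2 ⟨j, by simpa using hj, e⟩
    have hcard : ((G.neighborFinset v₀).image (fun u : Fin n => (u : ℕ))).card = d := by
      rw [card_image_of_injective _ Fin.val_injective, G.card_neighborFinset_eq_degree]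
    have heq := eq_of_subset_of_card_le hsub (by
      rw [hcard]; exact card_image_le.trans (by simp))
    intro j hj
    have : s₀.natArr 0 v₀ j ∈ (range d).image (fun j => s₀.natArr 0 v₀ j) :=
      mem_image.2 ⟨j, by simpa using hj, rfl⟩
    rw [← heq] at this
    obtain ⟨u, -, hu⟩ := mem_image.1 this
    exact ⟨u, hu.symm⟩
  -- Counting again: no neighbour occupies two places, so the current one has not been treated
  -- before.
  have hinj : Set.InjOn (fun j => s₀.natArr 0 v₀ j) (range d : Finset ℕ) := by
    rw [← card_image_iff]
    refine le_antisymm card_image_le ?_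
    rw [card_range]
    calc d = ((G.neighborFinset v₀).image (fun u : Fin n => (u : ℕ))).card := by
          rw [card_image_of_injective _ Fin.val_injective, G.card_neighborFinset_eq_degree]
      _ ≤ _ := card_le_card (by
          intro k hk
          obtain ⟨u, hu, rfl⟩ := mem_image.1 hk
          obtain ⟨j, hj, e⟩ := (hg.graph.adj v₀ u).1 (by simpa using hu)
          exact mem_image.2 ⟨j, by simpa using hj, e⟩)
  have := forN_rule (b := 3) (i := 12) (M := s₀.nat 3) rfl
    (fun k s => Inv (univ.filter fun u : Fin n => ∃ j, j < d ∧ j < k ∧ s₀.natArr 0 v₀ j = u) s)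
    (c := .branch (.natLt (.reg 12) (.cell 1 (.reg v) (.const 0)))
    (.seq (.setNat 13 (.cell 0 (.reg v) (.reg 12))) c) .skip) (s₀ := s₀) (by simpa using h0)
    (fun k s m h => hi _ s m h) (by
      intro k s hk his ag h
      have ev : s.nat v = v₀ := (ag.nat v hwv).trans hv
      have e0 : s.natArr 0 = s₀.natArr 0 := ag.natArr 0 h1
      have e1 : s.natArr 1 v₀ 0 = d := by rw [ag.natArr 1 h2]; exact hg.graph.deg v₀
      by_cases hkd : k < d
      · obtain ⟨u, hu⟩ := hex k hkd
        have hb : (Test.natLt (.reg 12) (.cell 1 (.reg v) (.const 0))).Holds s := by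
          simpa [Test.Holds, NExp.eval, his, ev, e1] using hkd
        simp only [run, if_pos hb]
        have hval : NExp.eval s (.cell 0 (.reg v) (.reg 12)) = u := by
          simpa [NExp.eval, his, ev, e0] using hu
        rw [hval]
        have h13 : (forNbr v c).Agrees s (s.setN 13 u) :=
          ⟨fun x hx => by
            have : x ≠ 13 := by rintro rfl; simp [forNbr, wN] at hx
            simp [Store.setN, this], fun _ _ => rfl, fun _ _ => rfl, fun _ _ => rfl⟩
        have := hstep _ u (s.setN 13 u) ?_ ((hg.graph.adj v₀ u).2 ⟨k, hkd, hu⟩)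
          (by simp [Store.setN]) (ag.trans h13) (hi' _ _ _ h)
        · refine cast (congrArg (fun T => Inv T (c.run (s.setN 13 u))) ?_) this
          ext x
          simp only [mem_filter, mem_univ, true_and, mem_insert]
          constructor
          · rintro (rfl | ⟨j, hj, hjk, hx⟩)
            · exact ⟨k, hkd, by omega, hu⟩
            · exact ⟨j, hj, by omega, hx⟩
          · rintro ⟨j, hj, hjk, hx⟩
            rcases Nat.lt_succ_iff_lt_or_eq.1 hjk with h | rfl
            · exact Or.inr ⟨j, hj, h, hx⟩
            · exact Or.inl (Fin.ext (hx.symm.trans hu))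
        · simp only [mem_filter, mem_univ, true_and, not_exists, not_and]
          intro j hj hjk hx
          have := hinj (by simpa using hj) (by simpa using hkd) (hx.trans hu.symm)
          omega
      · have hb : ¬ (Test.natLt (.reg 12) (.cell 1 (.reg v) (.const 0))).Holds s := by
          simpa [Test.Holds, NExp.eval, his, ev, e1] using hkd
        simp only [run, if_neg hb]
        convert h using 1
        ext x
        simp only [mem_filter, mem_univ, true_and]
        exact exists_congr fun j => and_congr_right fun hj =>
          ⟨fun h => ⟨by omega, h.2⟩, fun h => ⟨by omega, h.2⟩⟩)
  refine cast (congrArg (fun T => Inv T ((forNbr v c).run s₀)) ?_) this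
  ext x
  simp only [SimpleGraph.mem_neighborFinset, mem_filter, mem_univ, true_and, hg.graph.adj v₀ x]
  exact exists_congr fun j => ⟨fun h => ⟨h.1, h.2.2⟩, fun h => ⟨h.1, by omega, h.2⟩⟩

end Code

end Mule

namespace Mule

namespace Code

/-! ## Maximum degree and running time -/

/-- Put the maximum degree into register `4`. -/
def maxDeg : Code :=
  .seq (.setNat 4 (.const 0)) (.forN 11 0
    (.branch (.natLt (.reg 4) (.cell 1 (.reg 11) (.const 0)))
      (.setNat 4 (.cell 1 (.reg 11) (.const 0))) .skip))

theorem maxDeg_spec {n : ℕ} {G : SimpleGraph (Fin n)} [DecidableRel G.Adj] {s : Store}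
    (hg : StoresGraph G s) : (maxDeg.run s).nat 4 = G.maxDegree := by
  have := forN_rule_univ (n := n) (i := 11) (b := 0)
    (c := .branch (.natLt (.reg 4) (.cell 1 (.reg 11) (.const 0)))
      (.setNat 4 (.cell 1 (.reg 11) (.const 0))) .skip)
    (s₀ := (Code.setNat 4 (.const 0)).run s) hg.size
    (fun T s => s.nat 4 = T.sup fun v => G.degree v) (by simp [run, NExp.eval])
    (fun _ _ _ h => h) (by
      intro T u s' hu his ag h
      have e : s'.natArr 1 u 0 = G.degree u := by rw [ag.natArr 1 rfl]; exact hg.deg u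
      have hb : (Test.natLt (.reg 4) (.cell 1 (.reg 11) (.const 0))).Holds s' ↔
          T.sup (fun v => G.degree v) < G.degree u := by
        simp [Test.Holds, NExp.eval, his, e, h]
      rw [sup_insert]
      simp only [run, hb]
      split_ifs with hlt
      · simp [NExp.eval, his, e, sup_eq_left.2 hlt.le]
      · simp [h, sup_eq_right.2 (not_lt.1 hlt)])
  refine Eq.trans this (le_antisymm (Finset.sup_le fun v _ => G.degree_le_maxDegree v)
    (G.maxDegree_le_of_forall_degree_le _ fun v => ?_))
  exact Finset.le_sup (f := fun v => G.degree v) (mem_univ v)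

/-- Compute the maximum degree, then run `c`. -/
def withDegree (c : Code) : Prog :=
  .seq maxDeg.compile (.seq (.setNat 3 (.reg 4)) c.compile)

/-- `exec_run` requires register `3` to be constant, so Δ is built up in register `4` and then
copied. Connectivity and `2 ≤ n` give Δ ≥ 1, so the linear time spent on Δ is absorbed by the final
bound. -/
theorem exec_withDegree (c : Code) (hw : c.wf = true) (h0 : c.wN 0 = false)
    (h3 : c.wN 3 = false) {p : ℕ} (hp : c.depN ≤ p + 1) (hq : c.depD ≤ 1) :
    ∃ K : ℕ, ∀ (n : ℕ) (G : SimpleGraph (Fin n)) [DecidableRel G.Adj] (s : Store), 2 ≤ n →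
      G.Connected → StoresGraph G s → ∃ (s₁ : Store) (t : ℕ), Graphed G s₁ ∧
        s₁.natArr = s.natArr ∧ s₁.real = s.real ∧ s₁.realArr = s.realArr ∧
        Exec c.withDegree s (c.run s₁) t ∧ t ≤ K * (n ^ (p + 1) * G.maxDegree) := by
  refine ⟨maxDeg.cost 1 1 + 2 + c.cost 1 1, fun n G _ s hn hG hg => ?_⟩
  have hn1 : 1 ≤ n := by omega
  have hD : 1 ≤ G.maxDegree := by
    have : Nontrivial (Fin n) := Fin.nontrivial_iff_two_le.2 hn
    exact (hG.preconnected.degree_pos_of_nontrivial ⟨0, by omega⟩).trans_le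
      (G.degree_le_maxDegree _)
  obtain ⟨t, ht, h⟩ := exec_run maxDeg rfl rfl rfl n (s.nat 3) s hg.size rfl
  set s₁ := (maxDeg.run s).setN 3 G.maxDegree with hs₁
  have ag := agrees_run maxDeg s
  have hG₁ : Graphed G s₁ := by
    refine ⟨⟨(ag.nat 0 rfl).trans hg.size, fun v => ?_, fun v u => ?_⟩, rfl⟩
    · exact (congrFun (congrFun (ag.natArr 1 rfl) _) _).trans (hg.deg v)
    · rw [show s₁.natArr 0 = s.natArr 0 from ag.natArr 0 rfl]; exact hg.adj v u
  obtain ⟨t', ht', h'⟩ := exec_run c hw h0 h3 n G.maxDegree s₁ hG₁.graph.size hG₁.deg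
  have hset : Exec (.setNat 3 (.reg 4)) (maxDeg.run s) s₁ 2 := by
    have := Exec.setNat 3 (.reg 4) (maxDeg.run s)
    rwa [show NExp.eval (maxDeg.run s) (.reg 4) = G.maxDegree from maxDeg_spec hg] at this
  refine ⟨s₁, _, hG₁, ?_, ?_, ?_, Exec.seq h (Exec.seq hset h'), ?_⟩
  · exact funext fun a => ag.natArr a rfl
  · exact funext fun a => ag.real a rfl
  · exact funext fun a => ag.realArr a rfl
  · have h1 : t ≤ maxDeg.cost 1 1 * (n ^ (p + 1) * G.maxDegree ^ 1) := ht.trans (by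
      -- No loop of `maxDeg` is bounded by register `3`, whose initial content is arbitrary and must
      -- not enter the bound.
      have : maxDeg.cost n (s.nat 3) = maxDeg.cost n 1 := rfl
      rw [this]
      refine (cost_le maxDeg hn1 le_rfl (p := p + 1) (q := 0) (by simp [maxDeg, depN]) le_rfl).trans
        (Nat.mul_le_mul_left _ ?_)
      simpa using Nat.le_mul_of_pos_right _ hD)
    have h2 := ht'.trans (cost_le c hn1 hD hp hq)
    rw [pow_one] at h1 h2
    have h3 : 2 ≤ 2 * (n ^ (p + 1) * G.maxDegree) :=
      Nat.le_mul_of_pos_right _ (by positivity)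
    rw [add_mul, add_mul]
    omega

/-! ## Minimum and sum loops -/

/-- Put a node that minimizes `val` among those with `cond` into register `5`, and the minimum
into real register `2`. The conditions and values refer to the node in register `11`. -/
def argmin (cond : Test) (val : RExp) : Code :=
  .seq (.setNat 6 (.const 0)) (.forN 11 0 (.branch cond
    (.seq (.setReal 3 val)
      (.branch (.neg (.conj (.natEq (.reg 6) (.const 1)) (.neg (.realLt (.reg 3) (.reg 2)))))
        (.seq (.setReal 2 (.reg 3)) (.seq (.setNat 5 (.reg 11)) (.setNat 6 (.const 1)))) .skip))
    .skip))

/-- Register `6` tells whether a node with the condition has been met, so the minimum needs no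
initial value. Condition and value may read whatever the loop does not write; therefore `hc` is
asked for all stores that agree with `s` there. -/
theorem argmin_spec {n : ℕ} {cond : Test} {val : RExp} {s : Store} (hn : s.nat 0 = n)
    (P : Fin n → Prop) (F : Fin n → ℝ)
    (hc : ∀ s' (u : Fin n), (argmin cond val).Agrees s s' → s'.nat 11 = (u : ℕ) →
      (cond.Holds s' ↔ P u) ∧ val.eval s' = F u) (hne : ∃ u, P u) :
    ∃ v : Fin n, ((argmin cond val).run s).nat 5 = v ∧ P v ∧
      ((argmin cond val).run s).real 2 = F v ∧ ∀ u, P u → F v ≤ F u := by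
  have := forN_rule_univ (n := n) (i := 11) (b := 0)
    (c := .branch cond (.seq (.setReal 3 val)
      (.branch (.neg (.conj (.natEq (.reg 6) (.const 1)) (.neg (.realLt (.reg 3) (.reg 2)))))
        (.seq (.setReal 2 (.reg 3)) (.seq (.setNat 5 (.reg 11)) (.setNat 6 (.const 1)))) .skip))
      .skip) (s₀ := (Code.setNat 6 (.const 0)).run s) hn
    (fun T s => (s.nat 6 = 0 ∧ ∀ u ∈ T, ¬ P u) ∨ (s.nat 6 = 1 ∧ ∃ v ∈ T, s.nat 5 = (v : ℕ) ∧ P v ∧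
      s.real 2 = F v ∧ ∀ u ∈ T, P u → F v ≤ F u)) (by simp [run, NExp.eval])
    (fun _ _ _ h => h) (by
      intro T u s' hu his ag h
      obtain ⟨hP, hF⟩ := hc s' u
        (((agrees_run (Code.setNat 6 (.const 0)) s).mono
          (fun x hx => by simp_all [wN, argmin]) (fun _ _ => rfl) (fun _ _ => rfl)
          (fun _ _ => rfl)).trans
        (ag.mono (fun x hx => by simp_all [wN, argmin]) (fun x hx => by simp_all [wR, argmin])
          (fun _ _ => rfl) (fun _ _ => rfl))) his
      have hb : Test.Holds ((setReal 3 val).run s')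
          (.neg (.conj (.natEq (.reg 6) (.const 1)) (.neg (.realLt (.reg 3) (.reg 2))))) ↔
          (s'.nat 6 = 1 → F u < s'.real 2) := by
        simp [Test.Holds, run, NExp.eval, RExp.eval, hF]
      by_cases hPu : P u
      · rw [run_pos (hP.2 hPu), run_seq]
        by_cases hlt : s'.nat 6 = 1 → F u < s'.real 2
        · rw [run_pos (hb.2 hlt)]
          right
          refine ⟨by simp [run, NExp.eval], u, by simp, by simp [run, NExp.eval, his], hPu,
            by simp [run, RExp.eval, hF], ?_⟩
          intro x hx hPx
          rcases mem_insert.1 hx with rfl | hx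
          · exact le_rfl
          rcases h with ⟨-, h⟩ | ⟨h6, v, hv, h5, hPv, h2, hmin⟩
          · exact absurd hPx (h x hx)
          · exact (h2 ▸ hlt h6).le.trans (hmin x hx hPx)
        · rw [run_neg (mt hb.1 hlt)]
          rcases h with ⟨h6, h⟩ | ⟨h6, v, hv, h5, hPv, h2, hmin⟩
          · exact absurd (fun h => by omega) hlt
          · right
            refine ⟨h6, v, mem_insert_of_mem hv, h5, hPv, by simpa [run] using h2, ?_⟩
            intro x hx hPx
            rcases mem_insert.1 hx with rfl | hx
            · rw [h2] at hlt
              exact not_lt.1 fun h => hlt fun _ => h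
            · exact hmin x hx hPx
      · rw [run_neg (mt hP.1 hPu)]
        rcases h with ⟨h6, h⟩ | ⟨h6, v, hv, h5, hPv, h2, hmin⟩
        · left
          refine ⟨h6, fun x hx => ?_⟩
          rcases mem_insert.1 hx with rfl | hx
          exacts [hPu, h x hx]
        · right
          refine ⟨h6, v, mem_insert_of_mem hv, h5, hPv, h2, fun x hx hPx => ?_⟩
          rcases mem_insert.1 hx with rfl | hx
          exacts [absurd hPx hPu, hmin x hx hPx])
  rcases this with ⟨-, h⟩ | ⟨-, v, -, h5, hPv, h2, hmin⟩
  · obtain ⟨u, hu⟩ := hne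
    exact absurd hu (h u (mem_univ u))
  · exact ⟨v, h5, hPv, h2, fun u hu => hmin u (mem_univ u) hu⟩

/-- Put the sum of `val` over the nodes with `cond` into real register `0`. -/
def sumReal (cond : Test) (val : RExp) : Code :=
  .seq (.setReal 0 (.ofNat (.const 0)))
    (.forN 11 0 (.branch cond (.setReal 0 (.add (.reg 0) val)) .skip))

theorem sumReal_spec {n : ℕ} {cond : Test} {val : RExp} {s : Store} (hn : s.nat 0 = n)
    (U : Finset (Fin n)) (F : Fin n → ℝ)
    (hc : ∀ s' (u : Fin n), (sumReal cond val).Agrees s s' → s'.nat 11 = (u : ℕ) →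
      (cond.Holds s' ↔ u ∈ U) ∧ (u ∈ U → val.eval s' = F u)) :
    ((sumReal cond val).run s).real 0 = ∑ u ∈ U, F u := by
  have := forN_rule_univ (n := n) (i := 11) (b := 0)
    (c := .branch cond (.setReal 0 (.add (.reg 0) val)) .skip)
    (s₀ := (Code.setReal 0 (.ofNat (.const 0))).run s) hn
    (fun T s => s.real 0 = ∑ u ∈ T with u ∈ U, F u) (by simp [run, NExp.eval, RExp.eval])
    (fun _ _ _ h => h) (by
      intro T u s' hu his ag h
      obtain ⟨hP, hF⟩ := hc s' u
        (((agrees_run (Code.setReal 0 (.ofNat (.const 0))) s).mono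
          (fun _ _ => rfl) (fun x hx => by simp_all [wR, sumReal]) (fun _ _ => rfl)
          (fun _ _ => rfl)).trans
        (ag.mono (fun x hx => by simp_all [wN, sumReal]) (fun x hx => by simp_all [wR, sumReal])
          (fun _ _ => rfl) (fun _ _ => rfl))) his
      simp only [run, hP, filter_insert]
      split_ifs with hPu
      · rw [sum_insert (by simp [hu])]
        simp [RExp.eval, hF hPu, h, add_comm]
      · exact h)
  refine Eq.trans this ?_
  rw [filter_mem_eq_inter, univ_inter]

/-! ## Selecting a node and raising the values -/

/-- Find a node of minimum potential; the capacities are in real array `3`, the sums of the values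
in real array `4` and those of the indicators in integer array `6`. -/
def select : Code :=
  argmin (.natLt (.const 0) (.cell 6 (.reg 11) (.const 0)))
    (.div (.sub (.cell 3 (.reg 11)) (.cell 4 (.reg 11))) (.ofNat (.cell 6 (.reg 11) (.const 0))))

/-- Raise the sums of the values, and the values of the singletons in real array `5`, whose
indicators are in integer array `9`. -/
def raiseSums : Code :=
  .forN 11 0 (.seq
    (.putReal 4 (.reg 11) (.add (.cell 4 (.reg 11))
      (.mul (.reg 2) (.ofNat (.cell 6 (.reg 11) (.const 0))))))
    (.putReal 5 (.reg 11) (.add (.cell 5 (.reg 11))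
      (.mul (.ofNat (.cell 9 (.reg 11) (.const 0))) (.reg 2)))))

/-- Restrict the singletons adjacent to the selected node. -/
def restrict : Code := forNbr 5 (.putNat 9 (.reg 13) (.const 0))

/-- The part of the loop body common to both algorithms. -/
def selectRaise : Code := .seq select (.seq raiseSums restrict)

variable {n : ℕ} {G : SimpleGraph (Fin n)} [DecidableRel G.Adj] {s : Store}

/-- Nodes of potential `⊤` are those with sum zero. The search skips them, which is harmless because
some potential is finite. -/
theorem select_spec (hn : s.nat 0 = n) {c : Fin n → ℝ} {D : Dual (Fin n)}
    (hc : ∀ u : Fin n, s.realArr 3 u = c u) (hY : ∀ u : Fin n, s.realArr 4 u = sumY G D u)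
    (hG : ∀ u : Fin n, s.natArr 6 u 0 = sumG G D u) (hne : ∃ u, sumG G D u ≠ 0) :
    ∃ (v : Fin n) (ε : ℝ), Selects G c D v ε ∧ sumG G D v ≠ 0 ∧ (select.run s).nat 5 = v ∧
      (select.run s).real 2 = ε := by
  obtain ⟨v, h5, hP, h2, hmin⟩ := argmin_spec hn (fun u => sumG G D u ≠ 0)
    (fun u => (c u - sumY G D u) / (sumG G D u : ℝ))
    (cond := .natLt (.const 0) (.cell 6 (.reg 11) (.const 0)))
    (val := .div (.sub (.cell 3 (.reg 11)) (.cell 4 (.reg 11)))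
      (.ofNat (.cell 6 (.reg 11) (.const 0)))) (fun s' u ag hu => by
        simp [Test.Holds, NExp.eval, RExp.eval, hu, ag.natArr 6 rfl, ag.realArr 3 rfl,
          ag.realArr 4 rfl, hc, hY, hG, Nat.pos_iff_ne_zero]) hne
  refine ⟨v, _, ⟨by rw [potential, if_neg hP], fun u => ?_⟩, hP, h5, h2⟩
  rw [potential, if_neg hP, potential]
  split_ifs with hu
  · exact le_top
  · exact WithTop.coe_le_coe.2 (hmin u hu)

theorem raiseSums_spec (hn : s.nat 0 = n) : ∀ u : Fin n,
    (raiseSums.run s).realArr 4 u = s.realArr 4 u + s.real 2 * s.natArr 6 u 0 ∧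
    (raiseSums.run s).realArr 5 u = s.realArr 5 u + s.natArr 9 u 0 * s.real 2 := by
  refine forN_pointwise hn
    (fun u s' => s'.realArr 4 u = s.realArr 4 u ∧ s'.realArr 5 u = s.realArr 5 u)
    (fun u s' => s'.realArr 4 u = s.realArr 4 u + s.real 2 * s.natArr 6 u 0 ∧
      s'.realArr 5 u = s.realArr 5 u + s.natArr 9 u 0 * s.real 2)
    (fun u => ⟨rfl, rfl⟩) (fun _ _ _ h => h) (fun _ _ _ h => h) ?_
  intro u s' hu ag h
  refine ⟨?_, fun x hx => ?_⟩
  · simp [run, NExp.eval, RExp.eval, hu, ag.natArr 6 rfl, ag.natArr 9 rfl, ag.real 2 rfl, h]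
  · simp [run, NExp.eval, hu, Fin.val_inj, hx]

theorem restrict_spec (hg : Graphed G s) {v : Fin n} (hv : s.nat 5 = v) (u : Fin n) :
    (restrict.run s).natArr 9 u 0 = if G.Adj v u then 0 else s.natArr 9 u 0 := by
  have := forNbr_rule hg hv (c := .putNat 9 (.reg 13) (.const 0))
    (fun T s' => ∀ u : Fin n, s'.natArr 9 u 0 = if u ∈ T then 0 else s.natArr 9 u 0)
    (by simp) (fun _ _ _ h => h) (fun _ _ _ h => h) (by
      intro T x s' hx hadj h13 ag h u
      simp only [run, NExp.eval, h13, Fin.val_inj, h, mem_insert]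
      split_ifs <;> simp_all)
  simpa [restrict] using this u

/-- This makes it unnecessary to store the sets: a raise acts on the sum of the values only through
the sum of the indicators. -/
theorem sumY_raise (D : Dual (Fin n)) (v : Fin n) (ε : ℝ) (u : Fin n) :
    sumY G (raise G D v ε) u = sumY G D u + ε * sumG G D u := by
  simp only [sumY, sumG, raise, Nat.cast_sum, mul_sum, ← sum_add_distrib]
  refine sum_congr rfl fun S hS => ?_
  rw [if_pos (mem_filter.1 hS).1, mul_comm]

/-- New sets have value 0. Disjointness matters: activating an active set would reset its value. -/
theorem sumY_activate (D : Dual (Fin n)) {F : Finset (Finset (Fin n))} (hF : Disjoint D.active F)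
    (u : Fin n) : sumY G (activate D F) u = sumY G D u := by
  simp only [sumY, activate, filter_union]
  rw [sum_union (disjoint_filter_filter hF)]
  have h1 : ∀ S ∈ F.filter (fun S => u ∈ nbr G S), (if S ∈ F then (0 : ℝ) else D.y S) = 0 :=
    fun S hS => if_pos (mem_filter.1 hS).1
  have h2 : ∀ S ∈ D.active.filter (fun S => u ∈ nbr G S),
      (if S ∈ F then (0 : ℝ) else D.y S) = D.y S :=
    fun S hS => if_neg fun h => disjoint_left.1 hF (mem_filter.1 hS).1 h
  rw [sum_congr rfl h2, sum_eq_zero h1, add_zero]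

/-- The values are raised with the old indicators before any set is restricted, as in `raise`. Array
`6` keeps the old sums of indicators; each algorithm recomputes it in its own way. -/
theorem selectRaise_spec (hg : Graphed G s) {c : Fin n → ℝ} {D : Dual (Fin n)}
    (hc : ∀ u : Fin n, s.realArr 3 u = c u) (hY : ∀ u : Fin n, s.realArr 4 u = sumY G D u)
    (hG : ∀ u : Fin n, s.natArr 6 u 0 = sumG G D u) (hne : ∃ u, sumG G D u ≠ 0) :
    ∃ (v : Fin n) (ε : ℝ), Selects G c D v ε ∧ sumG G D v ≠ 0 ∧ (selectRaise.run s).nat 5 = v ∧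
      (∀ u : Fin n, (selectRaise.run s).realArr 4 u = sumY G (raise G D v ε) u) ∧
      (∀ u : Fin n, (selectRaise.run s).realArr 5 u = s.realArr 5 u + s.natArr 9 u 0 * ε) ∧
      (∀ u : Fin n, (selectRaise.run s).natArr 9 u 0 =
        if G.Adj v u then 0 else s.natArr 9 u 0) := by
  obtain ⟨v, ε, hs, hv, h5, h2⟩ := select_spec hg.graph.size hc hY hG hne
  have a1 := agrees_run select s
  have g1 := hg.of_agrees a1
  have a2 := agrees_run raiseSums (select.run s)
  have g2 := g1.of_agrees a2
  have a3 := agrees_run restrict (raiseSums.run (select.run s))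
  have r := raiseSums_spec g1.graph.size
  have t := restrict_spec g2 ((a2.nat 5 rfl).trans h5)
  refine ⟨v, ε, hs, hv, ?_, fun u => ?_, fun u => ?_, fun u => ?_⟩ <;> simp only [selectRaise, run]
  · rw [a3.nat 5 rfl, a2.nat 5 rfl, h5]
  · rw [a3.realArr 4 rfl, (r u).1, h2, a1.realArr 4 rfl, a1.natArr 6 rfl, hY, hG, sumY_raise]
  · rw [a3.realArr 5 rfl, (r u).2, h2, a1.realArr 5 rfl, a1.natArr 9 rfl]
  · rw [t u, a2.natArr 9 rfl, a1.natArr 9 rfl]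

end Code

end Mule

namespace Mule

/-! ## Invariants of Algorithm 1 -/

section

variable {V : Type*} [Fintype V] [DecidableEq V] {G : SimpleGraph V} [DecidableRel G.Adj]

theorem mem_nbr {S : Finset V} {u : V} : u ∈ nbr G S ↔ u ∉ S ∧ ∃ v ∈ S, G.Adj v u := by
  simp [nbr]

theorem mem_nbr_singleton {x u : V} : u ∈ nbr G {x} ↔ G.Adj x u := by
  simp only [mem_nbr, mem_singleton, exists_eq_left, and_iff_right_iff_imp]
  rintro h rfl
  exact G.irrefl h

theorem mem_nbr_compl {x u : V} (hu : ∃ y, G.Adj u y) : x ∈ nbr G (univ \ {u}) ↔ x = u := by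
  simp only [mem_nbr, mem_sdiff, mem_univ, true_and, mem_singleton, not_not]
  refine ⟨fun h => h.1, ?_⟩
  rintro rfl
  obtain ⟨y, hy⟩ := hu
  exact ⟨rfl, y, hy.ne', hy.symm⟩

theorem compl_singleton_injective : Function.Injective fun u : V => (univ \ {u} : Finset V) := by
  intro u v h
  have : u ∉ (univ \ {v} : Finset V) := by
    rw [← show (univ \ {u} : Finset V) = univ \ {v} from h]; simp
  simpa using this

theorem sumG_activate (D : Dual V) {F : Finset (Finset V)} (hF : Disjoint D.active F) (u : V) :
    sumG G (activate D F) u = sumG G D u + (F.filter fun S => u ∈ nbr G S).card := by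
  simp only [sumG, activate, filter_union]
  rw [sum_union (disjoint_filter_filter hF), card_eq_sum_ones]
  refine congrArg₂ _ (sum_congr rfl fun S hS => ?_) (sum_congr rfl fun S hS => ?_)
  · exact if_neg fun h => disjoint_left.1 hF (mem_filter.1 hS).1 h
  · exact if_pos (mem_filter.1 hS).1

/-- By `hns` singletons and complements are disjoint families. The only complement that can be
adjacent to `u` is `V \ {u}`, which leaves the neighbours of `u` and a single further term. -/
theorem sumG_of_active {D : Dual V} {B : Finset V} (hd : ∀ u, ∃ y, G.Adj u y)
    (hact : D.active = univ.image (fun v => {v}) ∪ B.image fun u => univ \ {u})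
    (hns : ∀ u ∈ B, ∀ x : V, univ \ {u} ≠ ({x} : Finset V)) (u : V) :
    sumG G D u = ∑ x ∈ G.neighborFinset u, D.g {x} + if u ∈ B then D.g (univ \ {u}) else 0 := by
  have hdisj : Disjoint (univ.image fun v : V => ({v} : Finset V))
      (B.image fun u => univ \ {u}) := by
    rw [disjoint_left]
    intro S h1 h2
    obtain ⟨x, -, rfl⟩ := mem_image.1 h1
    obtain ⟨b, hb, e⟩ := mem_image.1 h2
    exact hns b hb x e
  rw [sumG, hact, filter_union, sum_union (disjoint_filter_filter hdisj)]
  congr 1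
  · rw [filter_image, sum_image fun a _ b _ h => singleton_injective h]
    refine sum_congr (ext fun x => ?_) fun _ _ => rfl
    simp [mem_nbr_singleton, G.adj_comm]
  · rw [filter_image, sum_image fun a _ b _ h => compl_singleton_injective h]
    have : (B.filter fun b => u ∈ nbr G (univ \ {b})) = if u ∈ B then {u} else ∅ := by
      ext x
      simp only [mem_filter, mem_nbr_compl (hd x)]
      split_ifs with h <;> simp <;> aesop
    rw [this]
    split_ifs <;> simp

/-- Invariant of Algorithm 1; `B` is the set of the nodes `u` for which `V \ {u}` has been made
active. -/
structure DSInv (G : SimpleGraph V) [DecidableRel G.Adj] (σ : DSState V) (B : Finset V) :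
    Prop where
  active : σ.dual.active = univ.image (fun v => {v}) ∪ B.image fun u => univ \ {u}
  not_singleton : ∀ u ∈ B, ∀ x : V, univ \ {u} ≠ ({x} : Finset V)
  g_singleton : ∀ x, σ.dual.g {x} = if ∃ a ∈ σ.A, G.Adj a x then 0 else 1
  g_compl : ∀ u ∈ B, σ.dual.g (univ \ {u}) = if u ∈ σ.A then 0 else 1
  pos : ∀ u ∉ σ.A, sumG G σ.dual u ≠ 0
  selected : σ.A ⊆ nbr G σ.ds ∪ σ.ds
  independent : IsIndependent G σ.ds

theorem DSInv.start (hd : ∀ u, ∃ y, G.Adj u y) : DSInv G dsStart ∅ where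
  active := by simp [dsStart]
  not_singleton := by simp
  g_singleton := by simp [dsStart]
  g_compl := by simp
  pos u _ := by
    rw [sumG_of_active hd (B := ∅) (by simp [dsStart]) (by simp)]
    obtain ⟨y, hy⟩ := hd u
    simp only [dsStart, sum_const, smul_eq_mul, mul_one, notMem_empty, if_false, add_zero]
    exact card_ne_zero_of_mem (G.mem_neighborFinset u y |>.2 hy)
  selected := by simp [dsStart]
  independent := by simp [IsIndependent, dsStart]

theorem sumG_start (hd : ∀ u, ∃ y, G.Adj u y) (u : V) :
    sumG G (dsStart (V := V)).dual u = G.degree u := by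
  rw [sumG_of_active hd (B := ∅) (by simp [dsStart]) (by simp)]
  simp [dsStart]

/-- Selecting a node restricts every active set adjacent to it, and nothing is activated for
selected nodes; so a selected node never again has finite potential. This bounds the number of
rounds by n. -/
theorem DSInv.not_mem {σ : DSState V} {B : Finset V} (h : DSInv G σ B)
    (hd : ∀ u, ∃ y, G.Adj u y) {v : V} (hv : sumG G σ.dual v ≠ 0) : v ∉ σ.A := by
  intro hA
  refine hv ?_
  rw [sumG_of_active hd h.active h.not_singleton, sum_eq_zero, zero_add]
  · split_ifs with hB
    · rw [h.g_compl v hB, if_pos hA]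
    · rfl
  · intro x hx
    rw [h.g_singleton, if_pos ⟨v, hA, by simpa using hx⟩]

/-- The nodes `u` for which `V \ {u}` becomes active. -/
def newNodes (G : SimpleGraph V) [DecidableRel G.Adj] (σ : DSState V) (v : V) (ε : ℝ) :
    Finset V :=
  univ.filter fun u => u ∉ insert v σ.A ∧ sumG G (raise G σ.dual v ε) u = 0

/-! ### One round of Algorithm 1 -/

section Step

variable {σ : DSState V} {B : Finset V} (h : DSInv G σ B) (hd : ∀ u, ∃ y, G.Adj u y) (v : V)
  (ε : ℝ)

include h

theorem DSInv.raise_g_singleton (x : V) :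
    (raise G σ.dual v ε).g {x} = if G.Adj v x then 0 else σ.dual.g {x} := by
  have : ({x} : Finset V) ∈ σ.dual.active := by rw [h.active]; simp
  simp [raise, this, mem_nbr_singleton, G.adj_comm]

include hd

theorem DSInv.raise_g_compl {u : V} (hu : u ∈ B) :
    (raise G σ.dual v ε).g (univ \ {u}) = if u ∈ insert v σ.A then 0 else 1 := by
  have : (univ \ {u} : Finset V) ∈ σ.dual.active := by
    rw [h.active]; exact mem_union_right _ (mem_image_of_mem _ hu)
  simp only [raise, this, true_and, mem_nbr_compl (hd u), mem_insert, h.g_compl u hu]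
  by_cases e : v = u <;> simp [e, eq_comm]

/-- The form is that of the computation in `dsCount`: the entry of array `10` plus the entries of
array `9` at the neighbours. -/
theorem DSInv.sumG_raise (u : V) : sumG G (raise G σ.dual v ε) u =
    (if u ∈ B ∧ u ∉ insert v σ.A then 1 else 0) +
      ∑ x ∈ G.neighborFinset u, if G.Adj v x then 0 else σ.dual.g {x} := by
  rw [sumG_of_active (D := raise G σ.dual v ε) hd h.active h.not_singleton, add_comm]
  congr 1
  · by_cases hu : u ∈ B
    · rw [if_pos hu, h.raise_g_compl hd v ε hu]
      by_cases hA : u ∈ insert v σ.A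
      · rw [if_pos hA, if_neg fun h => h.2 hA]
      · rw [if_neg hA, if_pos ⟨hu, hA⟩]
    · rw [if_neg hu, if_neg fun h => hu h.1]
  · exact sum_congr rfl fun x _ => h.raise_g_singleton v ε x

/-- If `V \ {u}` is already active and `u` is not selected, that set is still un-restricted, so the
sum at `u` is not zero. -/
theorem DSInv.newNodes_disjoint : Disjoint B (newNodes G σ v ε) := by
  rw [disjoint_left]
  intro u hu hN
  simp only [newNodes, mem_filter, mem_univ, true_and] at hN
  have := h.sumG_raise hd v ε u
  rw [hN.2, if_pos ⟨hu, hN.1⟩] at this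
  omega

/-- This is the danger in a graph with two nodes. If `V \ {u} = {x}`, then `x` is the only neighbour
of `u`. The sum at `u` is zero, so `{x}` is restricted and `x` has a selected neighbour; it can only
be `u`, which is not selected. -/
theorem DSInv.newNodes_not_singleton {u : V} (hu : u ∈ newNodes G σ v ε) (x : V) :
    univ \ {u} ≠ ({x} : Finset V) := by
  intro e
  simp only [newNodes, mem_filter, mem_univ, true_and] at hu
  obtain ⟨y, hy⟩ := hd u
  have key : ∀ z, z ≠ u → z = x := fun z hz => by
    have : z ∈ (univ \ {u} : Finset V) := by simpa using hz
    simpa [e] using this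
  obtain rfl := key y hy.ne'
  have h0 := h.sumG_raise hd v ε u
  rw [hu.2] at h0
  have h1 : (if G.Adj v y then 0 else σ.dual.g {y}) = 0 := by
    have := single_le_sum (f := fun x => if G.Adj v x then 0 else σ.dual.g {x})
      (fun _ _ => Nat.zero_le _) (G.mem_neighborFinset u y |>.2 hy)
    omega
  have h2 : ∃ a ∈ insert v σ.A, G.Adj a y := by
    split_ifs at h1 with hv
    · exact ⟨v, mem_insert_self _ _, hv⟩
    · rw [h.g_singleton] at h1
      split_ifs at h1 with ha
      obtain ⟨a, ha, hay⟩ := ha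
      exact ⟨a, mem_insert_of_mem ha, hay⟩
  obtain ⟨a, ha, hay⟩ := h2
  have : a = u := by
    by_contra hne
    exact hay.ne (key a hne)
  exact hu.1 (this ▸ ha)

/-- Activation therefore never resets a value or an indicator, as `sumY_activate` and
`sumG_activate` require. -/
theorem DSInv.disjoint_active : Disjoint (raise G σ.dual v ε).active
    ((newNodes G σ v ε).image fun u => univ \ {u}) := by
  rw [disjoint_left]
  intro S hS hN
  obtain ⟨u, hu, rfl⟩ := mem_image.1 hN
  rw [show (raise G σ.dual v ε).active = _ from h.active, mem_union] at hS
  rcases hS with hS | hS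
  · obtain ⟨x, -, e⟩ := mem_image.1 hS
    exact h.newNodes_not_singleton hd v ε hu x e.symm
  · obtain ⟨u', hu', e⟩ := mem_image.1 hS
    obtain rfl := compl_singleton_injective e
    exact disjoint_left.1 (h.newNodes_disjoint hd v ε) hu' hu

theorem DSInv.singleton_not_mem (x : V) :
    ({x} : Finset V) ∉ (newNodes G σ v ε).image fun u => univ \ {u} := by
  intro hx
  obtain ⟨u, hu, e⟩ := mem_image.1 hx
  exact h.newNodes_not_singleton hd v ε hu x e

theorem DSInv.g_update (x : V) :
    (dsUpdate G σ v ε).dual.g {x} = if G.Adj v x then 0 else σ.dual.g {x} := by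
  rw [← h.raise_g_singleton v ε x]
  exact if_neg (h.singleton_not_mem hd v ε x)

theorem DSInv.y_update (x : V) :
    (dsUpdate G σ v ε).dual.y {x} = σ.dual.y {x} + σ.dual.g {x} * ε := by
  have : ({x} : Finset V) ∈ σ.dual.active := by rw [h.active]; simp
  refine (if_neg (h.singleton_not_mem hd v ε x)).trans ?_
  simp [raise, this]

theorem DSInv.sumG_update (u : V) : sumG G (dsUpdate G σ v ε).dual u =
    if u ∈ newNodes G σ v ε then 1 else sumG G (raise G σ.dual v ε) u := by
  refine (sumG_activate _ (h.disjoint_active hd v ε) u).trans ?_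
  rw [filter_image, card_image_of_injective _ compl_singleton_injective]
  have : ((newNodes G σ v ε).filter fun b => u ∈ nbr G (univ \ {b})) =
      if u ∈ newNodes G σ v ε then {u} else ∅ := by
    ext x
    simp only [mem_filter, mem_nbr_compl (hd x)]
    split_ifs with h <;> simp <;> aesop
  rw [this]
  split_ifs with hu
  · rw [(mem_filter.1 hu).2.2, card_singleton]
  · rfl

theorem DSInv.update : DSInv G (dsUpdate G σ v ε) (B ∪ newNodes G σ v ε) where
  active := by
    change σ.dual.active ∪ (newNodes G σ v ε).image (fun u => univ \ {u}) = _
    rw [h.active, image_union, union_assoc]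
  not_singleton u hu x := by
    rcases mem_union.1 hu with hu | hu
    exacts [h.not_singleton u hu x, h.newNodes_not_singleton hd v ε hu x]
  g_singleton x := by
    rw [h.g_update hd v ε, h.g_singleton]
    simp only [dsUpdate, exists_mem_insert]
    by_cases h1 : G.Adj v x <;> by_cases h2 : ∃ a ∈ σ.A, G.Adj a x <;>
      simp only [h1, h2, if_true, if_false, or_self, or_true, true_or]
  g_compl u hu := by
    by_cases hN : u ∈ newNodes G σ v ε
    · have h1 : u ∉ insert v σ.A := (mem_filter.1 hN).2.1
      rw [show (dsUpdate G σ v ε).A = insert v σ.A from rfl, if_neg h1]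
      exact if_pos (mem_image_of_mem _ hN)
    · have hB : u ∈ B := (mem_union.1 hu).resolve_right hN
      refine (if_neg ?_).trans (h.raise_g_compl hd v ε hB)
      intro hm
      obtain ⟨u', hu', e⟩ := mem_image.1 hm
      exact hN (compl_singleton_injective e ▸ hu')
  -- A non-selected node left with sum zero belongs to `newNodes` and gets a set of its own.
  pos u hu := by
    rw [h.sumG_update hd v ε]
    split_ifs with hN
    · exact one_ne_zero
    · intro h0
      exact hN (by simp only [newNodes, mem_filter, mem_univ, true_and]; exact ⟨hu, h0⟩)
  -- `ds` only grows, and `v` is either dominated already or inserted.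
  selected u hu := by
    change u ∈ insert v σ.A at hu
    have hv : u ∈ insert v (nbr G σ.ds ∪ σ.ds) := by
      rcases mem_insert.1 hu with rfl | hu
      exacts [mem_insert_self _ _, mem_insert_of_mem (h.selected hu)]
    simp only [dsUpdate]
    split_ifs with hm
    · rcases mem_insert.1 hv with rfl | hv
      exacts [hm, hv]
    · simp only [mem_insert, mem_union, mem_nbr] at hv ⊢
      by_cases hu' : u = v ∨ u ∈ σ.ds
      · exact Or.inr hu'
      · rcases hv with rfl | ⟨h1, a, ha, hau⟩ | h1
        · exact Or.inr (Or.inl rfl)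
        · exact Or.inl ⟨hu', a, Or.inr ha, hau⟩
        · exact Or.inr (Or.inr h1)
  independent := by
    simp only [dsUpdate]
    split_ifs with hm
    · exact h.independent
    · have hm' : ∀ x ∈ σ.ds, ¬ G.Adj x v := fun x hx hxv => hm (by
        simp only [mem_union, mem_nbr]
        by_cases hvd : v ∈ σ.ds
        exacts [Or.inr hvd, Or.inl ⟨hvd, x, hx, hxv⟩])
      intro a ha b hb hab
      rcases mem_insert.1 ha with rfl | ha' <;> rcases mem_insert.1 hb with rfl | hb'
      exacts [G.irrefl hab, hm' b hb' hab.symm, hm' a ha' hab, h.independent a ha' b hb' hab]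

end Step

/-- Only the shape of the sets counts: there are n singletons and n complements at most. No
invariant is needed. -/
theorem card_active_le {w : V → ℝ} {σ : DSState V}
    (h : Relation.ReflTransGen (DSStep G w) dsStart σ) :
    σ.dual.active.card ≤ 2 * Fintype.card V := by
  have key : σ.dual.active ⊆ univ.image (fun v => {v}) ∪ univ.image fun u => univ \ {u} := by
    induction h with
    | refl => simp [dsStart]
    | tail _ hs ih =>
      obtain ⟨v, ε, -, rfl⟩ := hs
      exact union_subset ih ((image_subset_image (filter_subset _ _)).trans subset_union_right)
  calc _ ≤ _ := card_le_card key
    _ ≤ _ := card_union_le _ _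
    _ ≤ Fintype.card V + Fintype.card V := add_le_add card_image_le card_image_le
    _ = _ := by ring

end

end Mule

namespace Mule

namespace Code

/-! ## Loops `repeat ... until ...` with a bounded number of rounds -/

/-- Repeat `c` until register `7` is no longer `0`, at most as often as register `0` says. -/
def repeatBounded (c : Code) : Code :=
  .forN 10 0 (.branch (.natEq (.reg 7) (.const 0)) c .skip)

/-- `Rep` is the representation and `Live` the reason why another round is possible. The counter `k`
rises in every round and is below `n` in a live state, so `n` rounds suffice; once register `7` is
set, the remaining ones are idle. The start `k₀` need not be zero: for Algorithm 2 it is the size of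
`ds`. -/
theorem repeatBounded_rule {α : Type*} {c : Code} {body : α → α → Prop} {halt : α → Prop}
    {start : α} {s₀ : Store} {n : ℕ} (hn : s₀.nat 0 = n) (h7 : s₀.nat 7 = 0)
    (Rep Live : ℕ → α → Store → Prop) (k₀ : ℕ) (h0 : Rep k₀ start s₀) (hl0 : Live k₀ start s₀)
    (hi : ∀ k σ s m, Rep k σ s → Rep k σ (s.setN 10 m))
    (hi' : ∀ k σ s m, Live k σ s → Live k σ (s.setN 10 m))
    (hlive : ∀ k σ s, Rep k σ s → Live k σ s → k < n)
    (hstep : ∀ k σ s, Rep k σ s → Live k σ s → ∃ σ', body σ σ' ∧ Rep (k + 1) σ' (c.run s) ∧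
      (halt σ' ∧ (c.run s).nat 7 = 1 ∨
        ¬ halt σ' ∧ (c.run s).nat 7 = 0 ∧ Live (k + 1) σ' (c.run s))) :
    ∃ k σ, RepeatUntil body halt start σ ∧ Rep k σ (c.repeatBounded.run s₀) := by
  have := forN_rule (i := 10) (b := 0) (c := .branch (.natEq (.reg 7) (.const 0)) c .skip) hn
    -- `RepeatUntil` is assembled from its last round, so the invariant carries a way to extend any
    -- continuation from `σ` to an execution from `start`.
    (fun j s => (s.nat 7 = 0 ∧ ∃ k σ, j ≤ k ∧ Rep k σ s ∧ Live k σ s ∧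
        ∀ b, RepeatUntil body halt σ b → RepeatUntil body halt start b) ∨
      (s.nat 7 = 1 ∧ ∃ k σ, RepeatUntil body halt start σ ∧ Rep k σ s))
    (Or.inl ⟨h7, k₀, start, Nat.zero_le _, h0, hl0, fun _ h => h⟩) (by
      rintro j s m (⟨h, k, σ, hj, hR, hL, hb⟩ | ⟨h, k, σ, hb, hR⟩)
      · exact Or.inl ⟨h, k, σ, hj, hi _ _ _ _ hR, hi' _ _ _ _ hL, hb⟩
      · exact Or.inr ⟨h, k, σ, hb, hi _ _ _ _ hR⟩) (by
      rintro j s - - - (⟨h, k, σ, hj, hR, hL, hb⟩ | ⟨h, k, σ, hb, hR⟩)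
      · rw [run_pos (by simpa [Test.Holds, NExp.eval] using h)]
        obtain ⟨σ', hσ, hR', h' | h'⟩ := hstep k σ s hR hL
        · exact Or.inr ⟨h'.2, _, σ', hb _ (.last hσ h'.1), hR'⟩
        · exact Or.inl ⟨h'.2.1, _, σ', by omega, hR', h'.2.2, fun b hr => hb _ (.again hσ h'.1 hr)⟩
      · rw [run_neg (by simp [Test.Holds, NExp.eval, h])]
        exact Or.inr ⟨h, k, σ, hb, hR⟩)
  rcases this with ⟨-, k, σ, hj, hR, hL, -⟩ | ⟨-, k, σ, hb, hR⟩
  · exact absurd (hlive _ _ _ hR hL) (by omega)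
  · exact ⟨k, σ, hb, hR⟩

/-! ## Program for Algorithm 1 -/

/-- Record the selected node as selected, and put it into the independent set if possible. -/
def dsMark : Code :=
  .seq (.putNat 7 (.reg 5) (.const 1))
  (.seq (.branch (.natEq (.cell 8 (.reg 5) (.const 0)) (.const 0))
    (.seq (.putNat 2 (.reg 5) (.const 1)) (.seq (.putNat 8 (.reg 5) (.const 1))
      (forNbr 5 (.putNat 8 (.reg 13) (.const 1))))) .skip)
  (.seq (.branch (.natEq (.reg 9) (.const 0))
    (.seq (.setNat 8 (.reg 5)) (.setNat 9 (.const 1))) .skip)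
  (.putNat 10 (.reg 5) (.const 0))))

/-- Recompute the sums of the indicators, and activate the sets `V \ {u}`. -/
def dsCount : Code :=
  .forN 11 0 (.seq (.putNat 6 (.reg 11) (.cell 10 (.reg 11) (.const 0)))
    (.seq (forNbr 11 (.putNat 6 (.reg 11)
      (.add (.cell 6 (.reg 11) (.const 0)) (.cell 9 (.reg 13) (.const 0)))))
    (.branch (.conj (.natEq (.cell 7 (.reg 11) (.const 0)) (.const 0))
        (.natEq (.cell 6 (.reg 11) (.const 0)) (.const 0)))
      (.seq (.putNat 10 (.reg 11) (.const 1)) (.putNat 6 (.reg 11) (.const 1))) .skip)))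

/-- Test whether all nodes are dominated. -/
def dsTest : Code :=
  .seq (.setNat 7 (.const 1)) (.forN 11 0
    (.branch (.natEq (.cell 8 (.reg 11) (.const 0)) (.const 0)) (.setNat 7 (.const 0)) .skip))

/-- The loop body of Algorithm 1. -/
def dsBody : Code := .seq selectRaise (.seq dsMark (.seq dsCount dsTest))

/-- The initialization of the data of one node. -/
def dsInitNode : Code :=
  .seq (.putNat 2 (.reg 11) (.const 0)) (.seq (.putNat 7 (.reg 11) (.const 0))
  (.seq (.putNat 8 (.reg 11) (.const 0)) (.seq (.putNat 9 (.reg 11) (.const 1))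
  (.seq (.putNat 10 (.reg 11) (.const 0))
  (.seq (.putNat 6 (.reg 11) (.cell 1 (.reg 11) (.const 0)))
  (.seq (.putReal 3 (.reg 11)
    (.mul (.div (.ofNat (.const 1)) (.ofNat (.const 100))) (.cell 0 (.reg 11))))
  (.seq (.putReal 4 (.reg 11) (.ofNat (.const 0)))
    (.putReal 5 (.reg 11) (.ofNat (.const 0))))))))))

/-- The initialization of Algorithm 1. -/
def dsInit : Code :=
  .seq (.setNat 7 (.const 0)) (.seq (.setNat 9 (.const 0)) (.forN 11 0 dsInitNode))

/-- Algorithm 1. -/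
def dsCode : Code :=
  .seq dsInit (.seq dsBody.repeatBounded (sumReal (.natEq (.const 0) (.const 0)) (.cell 5 (.reg 11))))

variable {n : ℕ} {G : SimpleGraph (Fin n)} [DecidableRel G.Adj] {s : Store}

/-- Array `8` marks `N(ds) ∪ ds`, so deciding whether `v` joins `ds` takes constant time and
updating the marks O(Δ). Clearing entry `v` of array `10` restricts `V \ {v}`. -/
theorem dsMark_spec (hg : Graphed G s) {v : Fin n} (hv : s.nat 5 = v) :
    (∀ u : Fin n, (dsMark.run s).natArr 7 u 0 = if u = v then 1 else s.natArr 7 u 0) ∧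
    (∀ u : Fin n, (dsMark.run s).natArr 2 u 0 =
      if s.natArr 8 v 0 = 0 ∧ u = v then 1 else s.natArr 2 u 0) ∧
    (∀ u : Fin n, (dsMark.run s).natArr 8 u 0 =
      if s.natArr 8 v 0 = 0 ∧ (u = v ∨ G.Adj v u) then 1 else s.natArr 8 u 0) ∧
    (∀ u : Fin n, (dsMark.run s).natArr 10 u 0 = if u = v then 0 else s.natArr 10 u 0) ∧
    (dsMark.run s).nat 8 = (if s.nat 9 = 0 then (v : ℕ) else s.nat 8) ∧
    (dsMark.run s).nat 9 = (if s.nat 9 = 0 then 1 else s.nat 9) := by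
  set s₁ := (Code.putNat 7 (.reg 5) (.const 1)).run s with hs₁
  set c₂ : Code := .branch (.natEq (.cell 8 (.reg 5) (.const 0)) (.const 0))
    (.seq (.putNat 2 (.reg 5) (.const 1)) (.seq (.putNat 8 (.reg 5) (.const 1))
      (forNbr 5 (.putNat 8 (.reg 13) (.const 1))))) .skip with hc₂
  set s₂ := c₂.run s₁ with hs₂
  have a2 : c₂.Agrees s₁ s₂ := agrees_run _ _
  have h1 : ∀ u : Fin n, s₁.natArr 7 u 0 = if u = v then 1 else s.natArr 7 u 0 := fun u => by
    simp [hs₁, run, NExp.eval, hv, Fin.val_inj]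
  have key : (∀ u : Fin n, s₂.natArr 2 u 0 =
        if s.natArr 8 v 0 = 0 ∧ u = v then 1 else s.natArr 2 u 0) ∧
      (∀ u : Fin n, s₂.natArr 8 u 0 =
        if s.natArr 8 v 0 = 0 ∧ (u = v ∨ G.Adj v u) then 1 else s.natArr 8 u 0) := by
    by_cases h8 : s.natArr 8 v 0 = 0
    · rw [hs₂, hc₂, run_pos (by simp [Test.Holds, NExp.eval, hs₁, run, hv, h8]), run_seq, run_seq]
      set t := (Code.putNat 8 (.reg 5) (.const 1)).run
        ((Code.putNat 2 (.reg 5) (.const 1)).run s₁) with ht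
      have hgt : Graphed G t := hg.congr rfl rfl rfl rfl
      have := forNbr_rule hgt (v := 5) (v₀ := v) hv (c := .putNat 8 (.reg 13) (.const 1))
        (fun T s' => ∀ u : Fin n, s'.natArr 8 u 0 = if u ∈ T then 1 else t.natArr 8 u 0)
        (by simp) (fun _ _ _ h => h) (fun _ _ _ h => h) (by
          intro T x s' hx hadj h13 ag h u
          simp only [run, NExp.eval, h13, Fin.val_inj, h, mem_insert]
          split_ifs <;> simp_all)
      refine ⟨fun u => ?_, fun u => ?_⟩
      · rw [(agrees_run (forNbr 5 (.putNat 8 (.reg 13) (.const 1))) t).natArr 2 rfl]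
        simp [ht, hs₁, run, NExp.eval, hv, Fin.val_inj, h8]
      · rw [this u]
        simp only [SimpleGraph.mem_neighborFinset, ht, hs₁, run, NExp.eval, hv, Fin.val_inj, h8]
        by_cases e : u = v <;> by_cases e' : G.Adj v u <;> simp [e, e']
    · rw [hs₂, hc₂, run_neg (by simp [Test.Holds, NExp.eval, hs₁, run, hv, h8])]
      simp [run, h8, hs₁]
  have e5 : s₂.nat 5 = v := (a2.nat 5 rfl).trans hv
  have e9 : s₂.nat 9 = s.nat 9 := a2.nat 9 rfl
  have e8 : s₂.nat 8 = s.nat 8 := a2.nat 8 rfl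
  have e7 : s₂.natArr 7 = s₁.natArr 7 := a2.natArr 7 rfl
  have e10 : s₂.natArr 10 = s.natArr 10 := a2.natArr 10 rfl
  have hrun : dsMark.run s = (Code.seq (.branch (.natEq (.reg 9) (.const 0))
    (.seq (.setNat 8 (.reg 5)) (.setNat 9 (.const 1))) .skip)
    (.putNat 10 (.reg 5) (.const 0))).run s₂ := rfl
  rw [hrun, run_seq]
  by_cases h9 : s.nat 9 = 0
  · rw [run_pos (by simp [Test.Holds, NExp.eval, e9, h9])]
    simp [run, NExp.eval, h9, key, e5, e7, e10, h1, Fin.val_inj]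
  · rw [run_neg (by simp [Test.Holds, NExp.eval, e9, h9])]
    simp [run, NExp.eval, h9, key, e5, e7, e10, h1, Fin.val_inj, e8, e9]

/-- `t u` is the sum at `u` before the activations. Because `V \ {u}` concerns the node `u` only,
counting and activating can be done node by node in one pass. -/
theorem dsCount_spec (hg : Graphed G s) (t : Fin n → ℕ)
    (ht : ∀ u : Fin n, t u = s.natArr 10 u 0 + ∑ x ∈ G.neighborFinset u, s.natArr 9 x 0) :
    ∀ u : Fin n, (dsCount.run s).natArr 6 u 0 =
        (if s.natArr 7 u 0 = 0 ∧ t u = 0 then 1 else t u) ∧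
      (dsCount.run s).natArr 10 u 0 =
        if s.natArr 7 u 0 = 0 ∧ t u = 0 then 1 else s.natArr 10 u 0 := by
  refine forN_pointwise hg.graph.size
    (fun u s' => s'.natArr 10 u 0 = s.natArr 10 u 0)
    (fun u s' => s'.natArr 6 u 0 = (if s.natArr 7 u 0 = 0 ∧ t u = 0 then 1 else t u) ∧
      s'.natArr 10 u 0 = if s.natArr 7 u 0 = 0 ∧ t u = 0 then 1 else s.natArr 10 u 0)
    (fun u => rfl) (fun _ _ _ h => h) (fun _ _ _ h => h) ?_
  intro u s' hu ag h10
  rw [run_seq, run_seq]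
  set s₁ := (Code.putNat 6 (.reg 11) (.cell 10 (.reg 11) (.const 0))).run s' with hs₁
  have hg' : Graphed G s' := hg.of_agrees ag
  have hg₁ : Graphed G s₁ := hg'.congr rfl rfl rfl rfl
  set c₂ := forNbr 11 (.putNat 6 (.reg 11)
      (.add (.cell 6 (.reg 11) (.const 0)) (.cell 9 (.reg 13) (.const 0)))) with hc₂
  set s₂ := c₂.run s₁ with hs₂
  have a2 : c₂.Agrees s₁ s₂ := agrees_run _ _
  have key := forNbr_rule hg₁ (v := 11) (v₀ := u) hu (c := .putNat 6 (.reg 11)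
      (.add (.cell 6 (.reg 11) (.const 0)) (.cell 9 (.reg 13) (.const 0))))
    (fun T r => r.natArr 6 u 0 = s.natArr 10 u 0 + ∑ x ∈ T, s.natArr 9 x 0 ∧
      ∀ x : Fin n, x ≠ u → r.natArr 6 x 0 = s'.natArr 6 x 0)
    ⟨by simp [hs₁, run, NExp.eval, hu, h10], fun x hx => by
      simp [hs₁, run, NExp.eval, hu, Fin.val_inj, hx]⟩ (fun _ _ _ h => h) (fun _ _ _ h => h) (by
      intro T x r hx hadj h13 ar h
      have e11 : r.nat 11 = u := (ar.nat 11 rfl).trans hu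
      have e9 : r.natArr 9 = s.natArr 9 := (ar.natArr 9 rfl).trans (ag.natArr 9 rfl)
      rw [sum_insert hx]
      refine ⟨?_, fun y hy => ?_⟩
      · simp only [run, NExp.eval, e11, h13, h.1, e9, and_self, if_true]
        omega
      · simp [run, NExp.eval, e11, h.2 y hy, Fin.val_inj, hy])
  rw [← hc₂, ← hs₂, ← ht] at key
  have e11 : s₂.nat 11 = u := (a2.nat 11 rfl).trans hu
  have e7 : s₂.natArr 7 = s.natArr 7 := (a2.natArr 7 rfl).trans (ag.natArr 7 rfl)
  have e10 : s₂.natArr 10 = s'.natArr 10 := a2.natArr 10 rfl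
  have hT : (Test.conj (.natEq (.cell 7 (.reg 11) (.const 0)) (.const 0))
        (.natEq (.cell 6 (.reg 11) (.const 0)) (.const 0))).Holds s₂ ↔
      s.natArr 7 u 0 = 0 ∧ t u = 0 := by
    simp [Test.Holds, NExp.eval, e11, e7, key.1]
  by_cases hb : s.natArr 7 u 0 = 0 ∧ t u = 0
  · rw [run_pos (hT.2 hb)]
    refine ⟨by simp [run, NExp.eval, e11, hb], fun x hx => ?_⟩
    simp [run, NExp.eval, e11, Fin.val_inj, hx, key.2 x hx, e10]
  · rw [run_neg (mt hT.1 hb)]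
    refine ⟨by simp [run, hb, key.1, e10, h10], fun x hx => ?_⟩
    simp [run, key.2 x hx, e10]

theorem dsTest_spec (hn : s.nat 0 = n) :
    (dsTest.run s).nat 7 = if ∃ u : Fin n, s.natArr 8 u 0 = 0 then 0 else 1 := by
  have := forN_rule_univ (n := n) (i := 11) (b := 0)
    (c := .branch (.natEq (.cell 8 (.reg 11) (.const 0)) (.const 0)) (.setNat 7 (.const 0)) .skip)
    (s₀ := (Code.setNat 7 (.const 1)).run s) hn
    (fun T s' => s'.nat 7 = if ∃ u ∈ T, s.natArr 8 u 0 = 0 then 0 else 1)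
    (by simp [run, NExp.eval]) (fun _ _ _ h => h) (by
      intro T u s' hu his ag h
      have hT : (Test.natEq (.cell 8 (.reg 11) (.const 0)) (.const 0)).Holds s' ↔
          s.natArr 8 u 0 = 0 := by
        simp only [Test.Holds, NExp.eval, his, ag.natArr 8 rfl]; rfl
      by_cases hb : s.natArr 8 u 0 = 0
      · rw [run_pos (hT.2 hb)]
        simp [run, NExp.eval, hb]
      · rw [run_neg (mt hT.1 hb)]
        simp only [run, h, exists_mem_insert, hb, false_or])
  refine Eq.trans this ?_
  simp

/-- The memory represents the state of Algorithm 1 after `k` rounds. -/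
structure DSRep (G : SimpleGraph (Fin n)) [DecidableRel G.Adj] (w : Fin n → ℝ) (k : ℕ)
    (σ : DSState (Fin n)) (B : Finset (Fin n)) (s : Store) : Prop where
  inv : DSInv G σ B
  card : σ.A.card = k
  graphed : Graphed G s
  cap : ∀ u : Fin n, s.realArr 3 u = 1 / 100 * w u
  ds : ∀ u : Fin n, s.natArr 2 u 0 = if u ∈ σ.ds then 1 else 0
  A : ∀ u : Fin n, s.natArr 7 u 0 = if u ∈ σ.A then 1 else 0
  dom : ∀ u : Fin n, s.natArr 8 u 0 = if u ∈ nbr G σ.ds ∪ σ.ds then 1 else 0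
  flag : ∀ u : Fin n, s.natArr 9 u 0 = σ.dual.g {u}
  compl : ∀ u : Fin n, s.natArr 10 u 0 = if u ∈ B ∧ u ∉ σ.A then 1 else 0
  sumG : ∀ u : Fin n, s.natArr 6 u 0 = Mule.sumG G σ.dual u
  sumY : ∀ u : Fin n, s.realArr 4 u = Mule.sumY G σ.dual u
  y : ∀ u : Fin n, s.realArr 5 u = σ.dual.y {u}
  first : s.nat 9 = 0 ∧ σ.first = none ∨
    s.nat 9 = 1 ∧ ∃ r : Fin n, σ.first = some r ∧ s.nat 8 = r

theorem mem_nbr_insert {S : Finset (Fin n)} {u v : Fin n} :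
    u ∈ nbr G (insert v S) ∪ insert v S ↔ (u = v ∨ G.Adj v u) ∨ u ∈ nbr G S ∪ S := by
  simp only [mem_union, mem_nbr, mem_insert, not_or, exists_eq_or_imp]
  by_cases h1 : u = v <;> by_cases h2 : u ∈ S <;> by_cases h3 : G.Adj v u <;> simp [h1, h2, h3]

theorem dsBody_spec (hd : ∀ u, ∃ y, G.Adj u y) {w : Fin n → ℝ} {k : ℕ} {σ : DSState (Fin n)}
    {B : Finset (Fin n)} (h : DSRep G w k σ B s) (hk : k < n) :
    ∃ σ', DSStep G w σ σ' ∧ (∃ B', DSRep G w (k + 1) σ' B' (dsBody.run s)) ∧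
      (IsDominating G σ'.ds ∧ (dsBody.run s).nat 7 = 1 ∨
        ¬ IsDominating G σ'.ds ∧ (dsBody.run s).nat 7 = 0 ∧ k + 1 < n) := by
  -- If all sums were zero, all nodes would be selected, against `|A| = k < n`.
  have hne : ∃ u, Mule.sumG G σ.dual u ≠ 0 := by
    by_contra! hcon
    have : σ.A = univ := eq_univ_of_forall fun u => by
      by_contra hu
      exact h.inv.pos u hu (hcon u)
    have := congrArg Finset.card this
    rw [h.card, card_fin] at this
    omega
  obtain ⟨v, ε, hs, hv, h5, hY, hy, hf⟩ :=
    selectRaise_spec h.graphed h.cap h.sumY h.sumG hne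
  have hvA := h.inv.not_mem hd hv
  set s₁ := selectRaise.run s with hs₁
  set s₂ := dsMark.run s₁ with hs₂
  set s₃ := dsCount.run s₂ with hs₃
  have a1 : selectRaise.Agrees s s₁ := agrees_run _ _
  have a2 : dsMark.Agrees s₁ s₂ := agrees_run _ _
  have a3 : dsCount.Agrees s₂ s₃ := agrees_run _ _
  have a4 : dsTest.Agrees s₃ (dsTest.run s₃) := agrees_run _ _
  have g1 := h.graphed.of_agrees a1
  have g2 := g1.of_agrees a2
  have g3 := g2.of_agrees a3
  obtain ⟨m7, m2, m8, m10, mr, mf⟩ := dsMark_spec g1 h5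
  rw [← hs₂] at m7 m2 m8 m10 mr mf
  have hA : ∀ u : Fin n, s₂.natArr 7 u 0 = if u ∈ insert v σ.A then 1 else 0 := fun u => by
    rw [m7, a1.natArr 7 rfl, h.A]
    by_cases e : u = v <;> simp [e]
  have hC : ∀ u : Fin n, s₂.natArr 10 u 0 = if u ∈ B ∧ u ∉ insert v σ.A then 1 else 0 :=
    fun u => by
      rw [m10, a1.natArr 10 rfl, h.compl]
      by_cases e : u = v <;> simp [e]
  have hF : ∀ u : Fin n, s₂.natArr 9 u 0 = (dsUpdate G σ v ε).dual.g {u} := fun u => by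
    rw [a2.natArr 9 rfl, hf, h.flag, h.inv.g_update hd v ε]
  have cnt := dsCount_spec g2 (fun u => Mule.sumG G (raise G σ.dual v ε) u) (fun u => by
    rw [h.inv.sumG_raise hd v ε u, hC u]
    congr 1
    exact sum_congr rfl fun x _ => by rw [hF x, h.inv.g_update hd v ε])
  have hcond : ∀ u : Fin n, (s₂.natArr 7 u 0 = 0 ∧ Mule.sumG G (raise G σ.dual v ε) u = 0) ↔
      u ∈ newNodes G σ v ε := fun u => by
    rw [hA u]; simp [newNodes]
  have hD : ∀ u : Fin n, s₂.natArr 8 u 0 =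
      if u ∈ nbr G (dsUpdate G σ v ε).ds ∪ (dsUpdate G σ v ε).ds then 1 else 0 := fun u => by
    rw [m8, a1.natArr 8 rfl, h.dom, h.dom]
    by_cases e : v ∈ nbr G σ.ds ∪ σ.ds
    · simp [dsUpdate, e]
    · simp only [dsUpdate, e, not_false_eq_true, if_true, if_false, true_and, mem_nbr_insert]
      by_cases e1 : u = v ∨ G.Adj v u
      · rw [if_pos e1, if_pos (Or.inl e1)]
      · rw [if_neg e1]
        simp only [e1, false_or]
  have hrep : DSRep G w (k + 1) (dsUpdate G σ v ε) (B ∪ newNodes G σ v ε) (dsBody.run s) := by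
    change DSRep G w (k + 1) (dsUpdate G σ v ε) (B ∪ newNodes G σ v ε) (dsTest.run s₃)
    refine ⟨h.inv.update hd v ε, ?_, g3.of_agrees a4, fun u => ?_, fun u => ?_, fun u => ?_,
      fun u => ?_, fun u => ?_, fun u => ?_, fun u => ?_, fun u => ?_, fun u => ?_, ?_⟩
    · exact (card_insert_of_notMem hvA).trans (by rw [h.card])
    · rw [a4.realArr 3 rfl, a3.realArr 3 rfl, a2.realArr 3 rfl, a1.realArr 3 rfl, h.cap]
    · rw [a4.natArr 2 rfl, a3.natArr 2 rfl, m2, a1.natArr 8 rfl, h.dom, a1.natArr 2 rfl, h.ds]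
      by_cases e : v ∈ nbr G σ.ds ∪ σ.ds
      · simp [dsUpdate, e]
      · simp only [dsUpdate, e, not_false_eq_true, if_true, if_false, true_and, mem_insert]
        by_cases e1 : u = v <;> simp [e1]
    · rw [a4.natArr 7 rfl, a3.natArr 7 rfl, hA]; rfl
    · rw [a4.natArr 8 rfl, a3.natArr 8 rfl, hD]
    · rw [a4.natArr 9 rfl, a3.natArr 9 rfl, hF]
    · rw [a4.natArr 10 rfl, (cnt u).2, hC]
      simp only [hcond]
      have : (dsUpdate G σ v ε).A = insert v σ.A := rfl
      rw [this]
      by_cases e : u ∈ newNodes G σ v ε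
      · have : u ∉ insert v σ.A := (mem_filter.1 e).2.1
        rw [if_pos e, if_pos ⟨mem_union_right _ e, this⟩]
      · simp [e]
    · rw [a4.natArr 6 rfl, (cnt u).1, h.inv.sumG_update hd v ε]
      simp only [hcond]
    · rw [a4.realArr 4 rfl, a3.realArr 4 rfl, a2.realArr 4 rfl, hY]
      exact (sumY_activate _ (h.inv.disjoint_active hd v ε) u).symm
    · rw [a4.realArr 5 rfl, a3.realArr 5 rfl, a2.realArr 5 rfl, hy, h.y, h.flag,
        h.inv.y_update hd v ε]
    · right
      rw [a4.nat 9 rfl, a3.nat 9 rfl, a4.nat 8 rfl, a3.nat 8 rfl, mf, mr, a1.nat 9 rfl,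
        a1.nat 8 rfl]
      rcases h.first with ⟨h9, hf⟩ | ⟨h9, r, hf, h8⟩
      · exact ⟨by simp [h9], v, by simp [dsUpdate, hf], by simp [h9]⟩
      · exact ⟨by simp [h9], r, by simp [dsUpdate, hf], by simp [h9, h8]⟩
  refine ⟨_, ⟨v, ε, hs, rfl⟩, ⟨_, hrep⟩, ?_⟩
  have ht : (dsBody.run s).nat 7 = if ∃ u : Fin n, s₃.natArr 8 u 0 = 0 then 0 else 1 :=
    dsTest_spec g3.graph.size
  rw [a3.natArr 8 rfl] at ht
  simp only [hD] at ht
  by_cases hdom : IsDominating G (dsUpdate G σ v ε).ds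
  · left
    refine ⟨hdom, ht.trans (if_neg ?_)⟩
    rintro ⟨u, hu⟩
    rw [show nbr G (dsUpdate G σ v ε).ds ∪ (dsUpdate G σ v ε).ds = univ from hdom] at hu
    simp at hu
  · right
    refine ⟨hdom, ht.trans (if_pos ?_), ?_⟩
    · by_contra! hcon
      refine hdom (eq_univ_of_forall fun u => ?_)
      by_contra hu
      exact hcon u (if_neg hu)
    -- After `n` rounds every node is selected, hence dominated; a loop that goes on has `k + 1 <
    -- n`.
    · by_contra hlt
      refine hdom (eq_univ_of_forall fun u => hrep.inv.selected ?_)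
      have : (dsUpdate G σ v ε).A = univ := (card_eq_iff_eq_univ _).1
        (le_antisymm (card_le_univ _) (by rw [hrep.card, Fintype.card_fin]; omega))
      rw [this]
      exact mem_univ u

theorem dsInit_spec (hg : Graphed G s) (hd : ∀ u, ∃ y, G.Adj u y) {w : Fin n → ℝ}
    (hw : StoresReals 0 w s) :
    (dsInit.run s).nat 7 = 0 ∧ DSRep G w 0 dsStart ∅ (dsInit.run s) := by
  set s₂ := (Code.setNat 9 (.const 0)).run ((Code.setNat 7 (.const 0)).run s) with hs₂
  have a := agrees_run dsInit s
  have key := forN_pointwise (n := n) (i := 11) (b := 0) (s₀ := s₂) (c := dsInitNode) hg.graph.size (fun _ _ => True)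
    (fun u s' => s'.natArr 2 u 0 = 0 ∧ s'.natArr 7 u 0 = 0 ∧ s'.natArr 8 u 0 = 0 ∧
      s'.natArr 9 u 0 = 1 ∧ s'.natArr 10 u 0 = 0 ∧ s'.natArr 6 u 0 = G.degree u ∧
      s'.realArr 3 u = 1 / 100 * w u ∧ s'.realArr 4 u = 0 ∧ s'.realArr 5 u = 0)
    (fun _ => trivial) (fun _ _ _ h => h) (fun _ _ _ h => h) (by
      intro u s' hu ag _
      have e1 : s'.natArr 1 u 0 = G.degree u := by
        rw [ag.natArr 1 rfl]; exact hg.graph.deg u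
      have e0 : s'.realArr 0 u = w u := by
        rw [ag.realArr 0 rfl]; exact hw u
      refine ⟨?_, fun x hx => ⟨fun _ => trivial, ?_⟩⟩
      · simp [dsInitNode, run, NExp.eval, RExp.eval, hu, e1, e0]
      · simp [dsInitNode, run, NExp.eval, hu, Fin.val_inj, hx])
  have hrun : dsInit.run s = (Code.forN 11 0 dsInitNode).run s₂ := rfl
  have a' := agrees_run (Code.forN 11 0 dsInitNode) s₂
  rw [← hrun] at key a'
  refine ⟨a'.nat 7 rfl, DSInv.start hd, by simp [dsStart], hg.of_agrees a,
    fun u => (key u).2.2.2.2.2.2.1, fun u => ?_, fun u => ?_, fun u => ?_, fun u => ?_, fun u => ?_,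
    fun u => ?_, fun u => ?_, fun u => ?_, Or.inl ⟨a'.nat 9 rfl, rfl⟩⟩
  · simp [key u, dsStart]
  · simp [key u, dsStart]
  · simp [key u, dsStart, nbr]
  · simp [key u, dsStart]
  · simp [key u]
  · simp [key u, sumG_start hd]
  · simp [key u, Mule.sumY, dsStart]
  · simp [key u, dsStart]

theorem dsCode_spec (hg : Graphed G s) (hn : 1 ≤ n) (hd : ∀ u, ∃ y, G.Adj u y) {w : Fin n → ℝ}
    (hw : StoresReals 0 w s) :
    ∃ (ds : Finset (Fin n)) (LB1 : ℝ) (r : Fin n), DSReturns G w ds LB1 r ∧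
      IsIndependent G ds ∧ IsDominating G ds ∧
      StoresSet 2 ds (dsCode.run s) ∧ (dsCode.run s).real 0 = LB1 ∧ (dsCode.run s).nat 8 = r := by
  obtain ⟨h7, h0⟩ := dsInit_spec hg hd hw
  obtain ⟨k, σ, hrep, B, h⟩ := repeatBounded_rule (n := n) (c := dsBody) (body := DSStep G w)
    (halt := fun τ => IsDominating G τ.ds) h0.graphed.graph.size h7
    (fun k σ s => ∃ B, DSRep G w k σ B s) (fun k _ _ => k < n) 0 ⟨_, h0⟩ hn
    (fun k σ s m ⟨B, h⟩ => ⟨B, h.inv, h.card, h.graphed.congr rfl rfl rfl rfl, h.cap, h.ds, h.A,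
      h.dom, h.flag, h.compl, h.sumG, h.sumY, h.y, h.first⟩)
    (fun _ _ _ _ h => h) (fun _ _ _ _ h => h)
    (fun k σ s ⟨B, h⟩ hk => dsBody_spec hd h hk)
  set s₂ := dsBody.repeatBounded.run (dsInit.run s)
  have a := agrees_run (sumReal (.natEq (.const 0) (.const 0)) (.cell 5 (.reg 11))) s₂
  have hsum := sumReal_spec (cond := .natEq (.const 0) (.const 0)) (val := .cell 5 (.reg 11))
    h.graphed.graph.size (univ : Finset (Fin n)) (fun u => σ.dual.y {u}) (fun s' u ag hu => by
      simp [Test.Holds, NExp.eval, RExp.eval, hu, ag.realArr 5 rfl, h.y])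
  -- The body is executed at least once, so a first node has been recorded when the loop ends.
  have hstep : ∀ {a b : DSState (Fin n)},
      RepeatUntil (DSStep G w) (fun τ => IsDominating G τ.ds) a b → IsDominating G b.ds ∧
        ∃ r, b.first = some r := by
    intro a b hab
    induction hab with
    | last hs hh =>
      obtain ⟨v, ε, -, rfl⟩ := hs
      exact ⟨hh, _, rfl⟩
    | again _ _ _ ih => exact ih
  obtain ⟨hdom, r', hr'⟩ := hstep hrep
  rcases h.first with ⟨-, hf⟩ | ⟨-, r, hf, h8⟩
  · rw [hf] at hr'; cases hr'
  exact ⟨σ.ds, _, r, ⟨σ, hrep, rfl, rfl, hf⟩, h.inv.independent, hdom, fun u =>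
    (congrFun (congrFun (a.natArr 2 rfl) _) _).trans (h.ds u), hsum, (a.nat 8 rfl).trans h8⟩

end Code

end Mule

namespace Mule

/-! ## At most five points of the unit disk have pairwise distances above one -/

/-- In a basis of unit vectors at 60° this says that two points of the unit disk in one closed
sector are at distance at most one. If the differences of the coordinates have equal signs, the form
is bounded by its value at one of the two points; otherwise it is `p² - pq + q² ≤ max(p, q)²`, and
all coordinates are at most one. -/
theorem cone_dist_le {a b c d : ℝ} (ha : 0 ≤ a) (hb : 0 ≤ b) (hc : 0 ≤ c) (hd : 0 ≤ d)
    (h1 : a ^ 2 + a * b + b ^ 2 ≤ 1) (h2 : c ^ 2 + c * d + d ^ 2 ≤ 1) :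
    (a - c) ^ 2 + (a - c) * (b - d) + (b - d) ^ 2 ≤ 1 := by
  have key : ∀ {x y z : ℝ}, 0 ≤ x → 0 ≤ z → x ^ 2 ≤ 1 → z ^ 2 ≤ 1 → ∀ {p q : ℝ}, 0 ≤ p → p ≤ x →
      0 ≤ q → q ≤ z → p ^ 2 - p * q + q ^ 2 ≤ 1 := by
    intro x y z hx hz hx1 hz1 p q hp hpx hq hqz
    rcases le_total p q with h | h
    · nlinarith [mul_nonneg hp (sub_nonneg.2 h), mul_nonneg hq (sub_nonneg.2 hqz)]
    · nlinarith [mul_nonneg hq (sub_nonneg.2 h), mul_nonneg hp (sub_nonneg.2 hpx)]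
  have a1 : a ^ 2 ≤ 1 := by nlinarith [mul_nonneg ha hb, sq_nonneg b]
  have b1 : b ^ 2 ≤ 1 := by nlinarith [mul_nonneg ha hb, sq_nonneg a]
  have c1 : c ^ 2 ≤ 1 := by nlinarith [mul_nonneg hc hd, sq_nonneg d]
  have d1 : d ^ 2 ≤ 1 := by nlinarith [mul_nonneg hc hd, sq_nonneg c]
  rcases le_total a c with h | h <;> rcases le_total b d with h' | h'
  · have : (c - a) ^ 2 + (c - a) * (d - b) + (d - b) ^ 2 ≤ c ^ 2 + c * d + d ^ 2 := by
      gcongr <;> linarith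
    nlinarith
  · have := key (y := 0) hc hb c1 b1 (p := c - a) (q := b - d) (by linarith) (by linarith)
      (by linarith) (by linarith)
    nlinarith
  · have := key (y := 0) ha hd a1 d1 (p := a - c) (q := d - b) (by linarith) (by linarith)
      (by linarith) (by linarith)
    nlinarith
  · have : (a - c) ^ 2 + (a - c) * (b - d) + (b - d) ^ 2 ≤ a ^ 2 + a * b + b ^ 2 := by
      gcongr <;> linarith
    nlinarith

/-- The squared length of the vector with coordinates `a`, `b` in a basis of unit vectors that
enclose an angle of `π / 3`. -/
def hexNorm (z : ℝ × ℝ) : ℝ := z.1 ^ 2 + z.1 * z.2 + z.2 ^ 2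

/-- The cones that do not contain the first basis vector. -/
noncomputable def hexCone (z : ℝ × ℝ) : ℕ :=
  if 0 ≤ z.2 then (if 0 ≤ z.1 + z.2 then 0 else 1) else (if z.1 ≤ 0 then 2 else 3)

/-- The ray of `(r, 0)` bounds two sectors, and a point farther than one from `(r, 0)` lies in
neither. The other four are told apart by `hexCone`; in each of them the coordinates with respect to
its own boundary rays reduce the claim to `cone_dist_le`. -/
theorem hexNorm_sub_le {z w : ℝ × ℝ} {r : ℝ} (hr : 0 ≤ r) (hr1 : r ≤ 1) (hz : hexNorm z ≤ 1)
    (hw : hexNorm w ≤ 1) (hz0 : 1 < hexNorm (z - (r, 0))) (hw0 : 1 < hexNorm (w - (r, 0)))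
    (hzw : hexCone z = hexCone w) : hexNorm (z - w) ≤ 1 := by
  obtain ⟨a, b⟩ := z
  obtain ⟨c, d⟩ := w
  simp only [hexNorm, Prod.fst_sub, Prod.snd_sub, hexCone, sub_zero] at *
  -- The sector above the ray has coordinates `(a, b)`, the one below it `(-b, a + b)`. The point
  -- `(r, 0)` belongs to both.
  have out : ∀ {a b : ℝ}, a ^ 2 + a * b + b ^ 2 ≤ 1 → 1 < (a - r) ^ 2 + (a - r) * b + b ^ 2 →
      ¬ (0 ≤ a ∧ 0 ≤ b) ∧ ¬ (b ≤ 0 ∧ 0 ≤ a + b) := by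
    intro a b h h'
    refine ⟨fun ⟨ha, hb⟩ => ?_, fun ⟨hb, hab⟩ => ?_⟩
    · have := cone_dist_le ha hb hr le_rfl h (by nlinarith)
      simp only [sub_zero] at this
      linarith
    · have := cone_dist_le (a := -b) (b := a + b) (c := 0) (d := r) (by linarith) hab le_rfl hr
        (by nlinarith) (by nlinarith)
      nlinarith
  have hz' := out hz hz0
  have hw' := out hw hw0
  simp only [not_and, not_le] at hz' hw'
  split_ifs at hzw with h1 h2 h3 h4 h3 h4 h2 h3 h4 h3 h4 <;> try omega
  · have h5 : a ≤ 0 := by by_contra! h; linarith [hz'.1 h.le]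
    have h6 : c ≤ 0 := by by_contra! h; linarith [hw'.1 h.le]
    have := cone_dist_le (a := a + b) (b := -a) (c := c + d) (d := -c) (by linarith) (by linarith)
      (by linarith) (by linarith) (by nlinarith) (by nlinarith)
    nlinarith
  · have := cone_dist_le (a := b) (b := -a - b) (c := d) (d := -c - d) (by linarith) (by linarith)
      (by linarith) (by linarith) (by nlinarith) (by nlinarith)
    nlinarith
  · have := cone_dist_le (a := -a) (b := -b) (c := -c) (d := -d) (by linarith) (by linarith)
      (by linarith) (by linarith) (by nlinarith) (by nlinarith)
    nlinarith
  · have h5 : a + b ≤ 0 := (hz'.2 (by linarith)).le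
    have h6 : c + d ≤ 0 := (hw'.2 (by linarith)).le
    have := cone_dist_le (a := -a - b) (b := a) (c := -c - d) (d := c) (by linarith) (by linarith)
      (by linarith) (by linarith) (by nlinarith) (by nlinarith)
    nlinarith

/-- A rotation turns `(x₀, y₀)` to the positive first axis. If `X`, `Y` are the coordinates after
it, then `(X - Y / √3, 2 Y / √3)` are those with respect to unit vectors at 0° and 60°. -/
theorem exists_hex_coordinates (x₀ y₀ : ℝ) (h : 0 < x₀ ^ 2 + y₀ ^ 2) :
    ∃ φ : ℝ → ℝ → ℝ × ℝ, (∀ x y x' y', φ (x - x') (y - y') = φ x y - φ x' y') ∧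
      (∀ x y, hexNorm (φ x y) = x ^ 2 + y ^ 2) ∧ φ x₀ y₀ = (Real.sqrt (x₀ ^ 2 + y₀ ^ 2), 0) := by
  set r := Real.sqrt (x₀ ^ 2 + y₀ ^ 2) with hr
  have hr2 : r ^ 2 = x₀ ^ 2 + y₀ ^ 2 := Real.sq_sqrt h.le
  have hr0 : 0 < r := Real.sqrt_pos.2 h
  set t := Real.sqrt 3 with ht
  have ht2 : t ^ 2 = 3 := Real.sq_sqrt (by norm_num)
  have ht0 : 0 < t := Real.sqrt_pos.2 (by norm_num)
  refine ⟨fun x y => ((x * x₀ + y * y₀) / r - (y * x₀ - x * y₀) / r / t,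
    2 * ((y * x₀ - x * y₀) / r) / t), fun x y x' y' => ?_, fun x y => ?_, ?_⟩
  · ext <;> simp only [Prod.fst_sub, Prod.snd_sub] <;> ring
  · have e : ∀ X Y : ℝ, hexNorm (X - Y / t, 2 * Y / t) = X ^ 2 + Y ^ 2 := by
      intro X Y
      simp only [hexNorm]
      field_simp
      rw [show t ^ 2 = 3 from ht2]
      linear_combination X ^ 2 * ht2
    rw [e]
    field_simp
    rw [hr2]
    ring
  · ext
    · simp only
      rw [show y₀ * x₀ - x₀ * y₀ = 0 by ring]
      field_simp
      rw [hr2]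
      ring
    · simp only
      rw [show y₀ * x₀ - x₀ * y₀ = 0 by ring]
      simp

/-- Let the first axis point to one of the points. Six or more points would leave at least five for
the four sectors away from this axis, and two in the same sector are at distance at most one. -/
theorem card_le_five {ι : Type*} [DecidableEq ι] (T : Finset ι) (q : ι → EuclideanSpace ℝ (Fin 2))
    (c : EuclideanSpace ℝ (Fin 2)) (h1 : ∀ i ∈ T, dist c (q i) ≤ 1)
    (h2 : ∀ i ∈ T, ∀ j ∈ T, i ≠ j → 1 < dist (q i) (q j)) : T.card ≤ 5 := by
  by_contra! hT
  have hd : ∀ a b : EuclideanSpace ℝ (Fin 2), dist a b ^ 2 = (a 0 - b 0) ^ 2 + (a 1 - b 1) ^ 2 := by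
    intro a b
    rw [EuclideanSpace.dist_eq, Real.sq_sqrt (by positivity), Fin.sum_univ_two, Real.dist_eq,
      Real.dist_eq, sq_abs, sq_abs]
  obtain ⟨i₀, hi₀⟩ : T.Nonempty := card_pos.1 (by omega)
  obtain ⟨i₁, hi₁, hne⟩ := exists_mem_ne (by omega : 1 < T.card) i₀
  set x : ι → ℝ := fun i => q i 0 - c 0 with hx
  set y : ι → ℝ := fun i => q i 1 - c 1 with hy
  have hxy : ∀ i ∈ T, x i ^ 2 + y i ^ 2 ≤ 1 := fun i hi => by
    have h := hd c (q i)
    have := h1 i hi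
    have h0 : 0 ≤ dist c (q i) := dist_nonneg
    simp only [hx, hy]
    nlinarith
  have hxy2 : ∀ i ∈ T, ∀ j ∈ T, i ≠ j → 1 < (x i - x j) ^ 2 + (y i - y j) ^ 2 :=
    fun i hi j hj hij => by
      have h := hd (q i) (q j)
      have := h2 i hi j hj hij
      simp only [hx, hy]
      nlinarith
  -- A point at the centre would be within distance one of every other point.
  have hpos : 0 < x i₀ ^ 2 + y i₀ ^ 2 := by
    by_contra! hle
    have hx0 : x i₀ = 0 := by nlinarith [sq_nonneg (x i₀), sq_nonneg (y i₀)]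
    have hy0 : y i₀ = 0 := by nlinarith [sq_nonneg (x i₀), sq_nonneg (y i₀)]
    have := hxy2 i₁ hi₁ i₀ hi₀ hne
    have := hxy i₁ hi₁
    simp only [hx0, hy0, sub_zero] at *
    linarith
  obtain ⟨φ, hsub, hnorm, h0⟩ := exists_hex_coordinates _ _ hpos
  obtain ⟨i, hi, j, hj, hij, he⟩ := exists_ne_map_eq_of_card_lt_of_maps_to
    (s := T.erase i₀) (t := range 4) (f := fun i => hexCone (φ (x i) (y i)))
    (by rw [card_erase_of_mem hi₀, card_range]; omega) (fun i _ => by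
      simp only [hexCone, coe_range, Set.mem_Iio]
      split_ifs <;> omega)
  obtain ⟨hi', hi⟩ := mem_erase.1 hi
  obtain ⟨hj', hj⟩ := mem_erase.1 hj
  have := hexNorm_sub_le (Real.sqrt_nonneg _) (Real.sqrt_le_one.2 (hxy i₀ hi₀))
    ((hnorm _ _).trans_le (hxy i hi)) ((hnorm _ _).trans_le (hxy j hj))
    (by rw [← h0, ← hsub, hnorm]; exact hxy2 i hi i₀ hi₀ hi')
    (by rw [← h0, ← hsub, hnorm]; exact hxy2 j hj i₀ hi₀ hj') he
  rw [← hsub, hnorm] at this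
  exact absurd this (not_le.2 (hxy2 i hi j hj hij))

end Mule

namespace Mule

/-! ## Invariants of Algorithm 2 -/

section

variable {V : Type*} [Fintype V] [DecidableEq V] {G : SimpleGraph V} [DecidableRel G.Adj]

/-- The nodes of `U` with the same label as `x`. -/
def labelClass (U : Finset V) (lab : V → V) (x : V) : Finset V := U.filter fun y => lab y = lab x

omit [Fintype V] in
theorem mem_labelClass {U : Finset V} {lab : V → V} {x y : V} :
    y ∈ labelClass U lab x ↔ y ∈ U ∧ lab y = lab x := by simp [labelClass]

-- The classes in question are non-empty since `T ⊆ U`, so a class determines its label, and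
-- counting classes is counting labels.
omit [Fintype V] in
theorem card_image_labelClass {U T : Finset V} {lab : V → V} (hT : T ⊆ U) :
    (T.image (labelClass U lab)).card = (T.image lab).card := by
  have : T.image (labelClass U lab) = (T.image lab).image fun l => U.filter fun y => lab y = l := by
    rw [image_image]; rfl
  rw [this, card_image_of_injOn]
  intro l hl l' _ h
  obtain ⟨x, hx, rfl⟩ := mem_image.1 (mem_coe.1 hl)
  have hm : x ∈ U.filter fun y => lab y = lab x := by simp [hT hx]
  rw [show (U.filter fun y => lab y = lab x) = U.filter fun y => lab y = l' from h] at hm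
  exact (mem_filter.1 hm).2

/-- Invariant of Algorithm 2: the un-restricted active sets are the classes of the nodes of `U`
with equal labels. -/
structure CDSInv (G : SimpleGraph V) [DecidableRel G.Adj] (ds : Finset V) (D : Dual V)
    (U : Finset V) (lab : V → V) : Prop where
  active_subset : ∀ S ∈ D.active, S ⊆ U
  g_eq : ∀ S ∈ D.active, D.g S = 0 ∨ D.g S = 1
  free : ∀ S, (S ∈ D.active ∧ D.g S = 1) ↔ ∃ x ∈ U, S = labelClass U lab x
  adj : ∀ x ∈ U, ∀ y ∈ U, G.Adj x y → lab x = lab y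
  lab_mem : ∀ x ∈ U, lab x ∈ U
  singleton_mem : ∀ d ∈ ds, {d} ∈ D.active
  nonempty : U.Nonempty

/-- Independence is what allows every node of `ds` its own label. -/
theorem CDSInv.start {ds : Finset V} (w : V → ℝ) (hi : IsIndependent G ds) (hne : ds.Nonempty) :
    CDSInv G ds (cdsStart w ds).dual ds id where
  active_subset S hS := by
    obtain ⟨d, hd, rfl⟩ := mem_image.1 hS
    simpa using hd
  g_eq S _ := Or.inr rfl
  free S := by
    have : ∀ x ∈ ds, labelClass ds id x = {x} := fun x hx => by
      ext y
      simp only [mem_labelClass, id, mem_singleton, and_iff_right_iff_imp]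
      rintro rfl
      exact hx
    simp only [cdsStart, mem_image, and_true]
    exact exists_congr fun x => and_congr_right fun hx => by rw [this x hx, eq_comm]
  adj x hx y hy h := absurd h (hi x hx y hy)
  lab_mem x hx := hx
  singleton_mem d hd := mem_image_of_mem _ hd
  nonempty := hne

/-- The labels of the nodes of `U` adjacent to `u`. -/
def nearLabels (G : SimpleGraph V) [DecidableRel G.Adj] (U : Finset V) (lab : V → V) (u : V) :
    Finset V :=
  ((G.neighborFinset u).filter fun x => x ∈ U).image lab

theorem mem_nearLabels {U : Finset V} {lab : V → V} {u l : V} :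
    l ∈ nearLabels G U lab u ↔ ∃ x ∈ U, G.Adj u x ∧ lab x = l := by
  simp only [nearLabels, mem_image, mem_filter, SimpleGraph.mem_neighborFinset]
  exact exists_congr fun x => by tauto

section Inv

variable {ds : Finset V} {D : Dual V} {U : Finset V} {lab : V → V} (h : CDSInv G ds D U lab)

include h

/-- Restricted sets contribute 0 and un-restricted ones 1; the latter are classes, counted by their
labels. -/
theorem CDSInv.sum_g (p : Finset V → Prop) [DecidablePred p] :
    ∑ S ∈ D.active with p S, D.g S = ((U.filter fun x => p (labelClass U lab x)).image lab).card := by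
  have h1 : ∑ S ∈ D.active with p S, D.g S = ((D.active.filter p).filter fun S => D.g S = 1).card := by
    rw [card_filter]
    refine sum_congr rfl fun S hS => ?_
    rcases h.g_eq S (mem_filter.1 hS).1 with e | e <;> simp [e]
  rw [h1, ← card_image_labelClass (filter_subset _ _)]
  congr 1
  ext S
  simp only [mem_filter, mem_image]
  constructor
  · rintro ⟨⟨hS, hp⟩, hg⟩
    obtain ⟨x, hx, rfl⟩ := (h.free S).1 ⟨hS, hg⟩
    exact ⟨x, ⟨hx, hp⟩, rfl⟩
  · rintro ⟨x, ⟨hx, hp⟩, rfl⟩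
    obtain ⟨hS, hg⟩ := (h.free _).2 ⟨x, hx, rfl⟩
    exact ⟨⟨hS, hp⟩, hg⟩

theorem CDSInv.sum_g_total : ∑ S ∈ D.active, D.g S = (U.image lab).card := by
  simpa using h.sum_g fun _ => True

/-- A node of `U` has the label of each of its neighbours in `U`, so a class that contains a
neighbour contains the node too and is not adjacent to it. A node outside `U` is adjacent to the
classes of its neighbours in `U`, one for each label. -/
theorem CDSInv.sumG_eq (u : V) :
    sumG G D u = if u ∈ U then 0 else (nearLabels G U lab u).card := by
  rw [sumG, h.sum_g fun S => u ∈ nbr G S]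
  split_ifs with hu
  · rw [card_eq_zero, image_eq_empty, filter_eq_empty_iff]
    intro x hx hm
    obtain ⟨hn, y, hy, hyu⟩ := mem_nbr.1 hm
    rw [mem_labelClass] at hn hy
    exact hn ⟨hu, (h.adj u hu y hy.1 hyu.symm).trans hy.2⟩
  · congr 1
    ext l
    simp only [mem_image, mem_filter, mem_nearLabels, mem_nbr, mem_labelClass]
    constructor
    · rintro ⟨x, ⟨hx, -, y, ⟨hy, e⟩, hyu⟩, rfl⟩
      exact ⟨y, hy, hyu.symm, e⟩
    · rintro ⟨x, hx, hux, rfl⟩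
      exact ⟨x, ⟨hx, fun hc => hu hc.1, x, ⟨hx, rfl⟩, hux.symm⟩, rfl⟩

/-- If all potentials are infinite, no edge leaves `U`. Following paths from a node of `U`,
connectivity then gives `U = V` with only one label, which `hT` excludes. -/
theorem CDSInv.exists_sumG_ne (hG : G.Connected) (hT : U = univ → (U.image lab).card ≠ 1) :
    ∃ u, sumG G D u ≠ 0 := by
  by_contra! hcon
  obtain ⟨x, hx⟩ := h.nonempty
  have key : ∀ y, y ∈ U ∧ lab y = lab x := by
    intro y
    have hr := (SimpleGraph.reachable_iff_reflTransGen x y).1 (hG.preconnected x y)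
    induction hr with
    | refl => exact ⟨hx, rfl⟩
    | tail _ hab ih =>
      rename_i b c _
      have hc : c ∈ U := by
        by_contra hc
        have := hcon c
        rw [h.sumG_eq, if_neg hc, card_eq_zero] at this
        exact notMem_empty _ (this ▸ mem_nearLabels.2 ⟨b, ih.1, hab.symm, rfl⟩)
      exact ⟨hc, (h.adj _ hc _ ih.1 hab.symm).trans ih.2⟩
  refine hT (eq_univ_of_forall fun y => (key y).1) (card_eq_one.2 ⟨lab x, ?_⟩)
  ext l
  simp only [mem_image, mem_singleton]
  exact ⟨fun ⟨y, _, e⟩ => e ▸ (key y).2, fun e => ⟨x, hx, e.symm⟩⟩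

theorem CDSInv.not_mem {v : V} (hv : sumG G D v ≠ 0) : v ∉ U := fun hU =>
  hv (by rw [h.sumG_eq, if_pos hU])

theorem CDSInv.mem_coll1 {v : V} {S : Finset V} :
    S ∈ coll1 G D v ↔ ∃ x ∈ U, lab x ∈ nearLabels G U lab v ∧ S = labelClass U lab x := by
  simp only [coll1, mem_filter]
  rw [← and_assoc, h.free]
  constructor
  · rintro ⟨⟨x, hx, rfl⟩, y, hy⟩
    simp only [mem_inter, mem_labelClass, mem_nbr_singleton] at hy
    exact ⟨x, hx, mem_nearLabels.2 ⟨y, hy.1.1, hy.2, hy.1.2⟩, rfl⟩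
  · rintro ⟨x, hx, hl, rfl⟩
    obtain ⟨y, hy, hvy, e⟩ := mem_nearLabels.1 hl
    refine ⟨⟨x, hx, rfl⟩, y, ?_⟩
    simp only [mem_inter, mem_labelClass, mem_nbr_singleton]
    exact ⟨⟨hy, e⟩, hvy⟩

theorem CDSInv.newSet_eq (v : V) : insert v ((coll1 G D v).biUnion id) =
    insert v (U.filter fun x => lab x ∈ nearLabels G U lab v) := by
  congr 1
  ext y
  simp only [mem_biUnion, h.mem_coll1, id, mem_filter]
  constructor
  · rintro ⟨S, ⟨x, hx, hl, rfl⟩, hy⟩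
    obtain ⟨hy, e⟩ := mem_labelClass.1 hy
    exact ⟨hy, e ▸ hl⟩
  · rintro ⟨hy, hl⟩
    exact ⟨_, ⟨y, hy, hl, rfl⟩, mem_labelClass.2 ⟨hy, rfl⟩⟩

omit h in
/-- The labels after `v` and the classes adjacent to it have been merged. -/
def mergeLabels (G : SimpleGraph V) [DecidableRel G.Adj] (U : Finset V) (lab : V → V) (v x : V) :
    V :=
  if x = v ∨ x ∈ U ∧ lab x ∈ nearLabels G U lab v then v else lab x

section Step

variable {v : V} (hv : v ∉ U) (ε : ℝ)

include hv

/-- `v` is usable as a new label: labels are elements of `U`, which is the purpose of `lab_mem`, and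
`v` is not in `U`, so no surviving class has this label. -/
theorem CDSInv.labelClass_merge {x : V} (hx : x ∈ insert v U) :
    labelClass (insert v U) (mergeLabels G U lab v) x =
      if x = v ∨ lab x ∈ nearLabels G U lab v then
        insert v (U.filter fun x => lab x ∈ nearLabels G U lab v)
      else labelClass U lab x := by
  have hne : ∀ y ∈ U, lab y ≠ v := fun y hy e => hv (e ▸ h.lab_mem y hy)
  have hvn : ∀ y ∈ U, y ≠ v := fun y hy e => hv (e ▸ hy)
  have hval : ∀ y ∈ insert v U, mergeLabels G U lab v y = v ↔
      y = v ∨ lab y ∈ nearLabels G U lab v := fun y hy => by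
    unfold mergeLabels
    rcases mem_insert.1 hy with rfl | hy
    · simp
    · by_cases hl : lab y ∈ nearLabels G U lab v <;> simp [hl, hy, hvn y hy, hne y hy]
  split_ifs with hc
  · ext y
    rw [mem_labelClass, (hval x hx).2 hc]
    constructor
    · rintro ⟨hy, e⟩
      rcases (hval y hy).1 e with rfl | hl
      · exact mem_insert_self _ _
      · rcases mem_insert.1 hy with rfl | hy
        exacts [mem_insert_self _ _, mem_insert_of_mem (mem_filter.2 ⟨hy, hl⟩)]
    · intro hy
      rcases mem_insert.1 hy with rfl | hy
      · exact ⟨mem_insert_self _ _, (hval _ (mem_insert_self _ _)).2 (Or.inl rfl)⟩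
      · obtain ⟨hy, hl⟩ := mem_filter.1 hy
        exact ⟨mem_insert_of_mem hy, (hval _ (mem_insert_of_mem hy)).2 (Or.inr hl)⟩
  · push Not at hc
    have hxU : x ∈ U := (mem_insert.1 hx).resolve_left hc.1
    have ex : mergeLabels G U lab v x = lab x := by simp [mergeLabels, hc]
    ext y
    rw [mem_labelClass, mem_labelClass, ex]
    constructor
    · rintro ⟨hy, e⟩
      have hyv : ¬ (y = v ∨ lab y ∈ nearLabels G U lab v) := fun hcy => by
        rw [(hval y hy).2 hcy] at e
        exact hne x hxU e.symm
      push Not at hyv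
      have : mergeLabels G U lab v y = lab y := by simp [mergeLabels, hyv]
      exact ⟨(mem_insert.1 hy).resolve_left hyv.1, this ▸ e⟩
    · rintro ⟨hy, e⟩
      refine ⟨mem_insert_of_mem hy, ?_⟩
      simp [mergeLabels, hvn y hy, e, hc.2]

/-- All active sets, restricted ones included, lie in `U`, but the new set contains `v`. Its
activation overwrites nothing. -/
theorem CDSInv.newSet_not_mem : insert v ((coll1 G D v).biUnion id) ∉ D.active :=
  fun hm => hv (h.active_subset _ hm (mem_insert_self _ _))

theorem CDSInv.disjoint_active :
    Disjoint (raise G D v ε).active {insert v ((coll1 G D v).biUnion id)} := by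
  rw [disjoint_singleton_right]
  exact h.newSet_not_mem hv

/-- Raising with `v` restricts exactly the classes adjacent to `v`, and these are the classes that
the new set absorbs. So the un-restricted sets again partition the enlarged `U`. -/
theorem CDSInv.update :
    CDSInv G ds (activate (raise G D v ε) {insert v ((coll1 G D v).biUnion id)}) (insert v U)
      (mergeLabels G U lab v) where
  active_subset S hS := by
    rcases mem_union.1 hS with hS | hS
    · exact (h.active_subset S hS).trans (subset_insert _ _)
    · rw [mem_singleton.1 hS, h.newSet_eq]
      exact insert_subset_insert _ (filter_subset _ _)
  g_eq S hS := by
    by_cases hS' : S = insert v ((coll1 G D v).biUnion id)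
    · exact Or.inr (if_pos (mem_singleton.2 hS'))
    · have hSa : S ∈ D.active := (mem_union.1 hS).resolve_right (by simpa using hS')
      simp only [activate, mem_singleton, hS', if_false, raise]
      split_ifs
      · exact Or.inl rfl
      · exact h.g_eq S hSa
  free S := by
    have hcls := fun x hx => h.labelClass_merge hv (x := x) hx
    have hvL : ∀ x ∈ U, v ∈ nbr G (labelClass U lab x) ↔ lab x ∈ nearLabels G U lab v := by
      intro x hx
      simp only [mem_nbr, mem_nearLabels, mem_labelClass]
      constructor
      · rintro ⟨-, y, ⟨hy, e⟩, hyv⟩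
        exact ⟨y, hy, hyv.symm, e⟩
      · rintro ⟨y, hy, hvy, e⟩
        exact ⟨fun hc => hv hc.1, y, ⟨hy, e⟩, hvy.symm⟩
    by_cases hS' : S = insert v ((coll1 G D v).biUnion id)
    · refine iff_of_true ⟨mem_union_right _ (mem_singleton.2 hS'), if_pos (mem_singleton.2 hS')⟩
        ⟨v, mem_insert_self _ _, ?_⟩
      rw [hcls v (mem_insert_self _ _), if_pos (Or.inl rfl), hS', h.newSet_eq]
    · have h1 : (S ∈ (activate (raise G D v ε) {insert v ((coll1 G D v).biUnion id)}).active ∧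
          (activate (raise G D v ε) {insert v ((coll1 G D v).biUnion id)}).g S = 1) ↔
          (S ∈ D.active ∧ D.g S = 1) ∧ v ∉ nbr G S := by
        simp only [activate, mem_union, mem_singleton, hS', or_false, if_false, raise]
        by_cases hm : S ∈ D.active <;> by_cases hvn : v ∈ nbr G S <;> simp [hm, hvn]
      rw [h1, h.free]
      constructor
      · rintro ⟨⟨x, hx, rfl⟩, hvn⟩
        rw [hvL x hx] at hvn
        refine ⟨x, mem_insert_of_mem hx, ?_⟩
        rw [hcls x (mem_insert_of_mem hx), if_neg]
        rintro (rfl | hc)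
        exacts [hv hx, hvn hc]
      · rintro ⟨x, hx, rfl⟩
        rw [hcls x hx] at hS' ⊢
        split_ifs at hS' ⊢ with hc
        · exact absurd (h.newSet_eq v).symm hS'
        · push Not at hc
          have hxU := (mem_insert.1 hx).resolve_left hc.1
          exact ⟨⟨x, hxU, rfl⟩, fun hn => hc.2 ((hvL x hxU).1 hn)⟩
  adj := by
    have main : ∀ y ∈ U, G.Adj v y → mergeLabels G U lab v y = v := fun y hy hvy =>
      if_pos (Or.inr ⟨hy, mem_nearLabels.2 ⟨y, hy, hvy, rfl⟩⟩)
    have hvv : mergeLabels G U lab v v = v := if_pos (Or.inl rfl)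
    intro x hx y hy hxy
    rcases mem_insert.1 hx with rfl | hx' <;> rcases mem_insert.1 hy with rfl | hy'
    · rfl
    · rw [main y hy' hxy, hvv]
    · rw [main x hx' hxy.symm, hvv]
    · have hxv : x ≠ v := fun e => hv (e ▸ hx')
      have hyv : y ≠ v := fun e => hv (e ▸ hy')
      simp [mergeLabels, hxv, hyv, hx', hy', h.adj x hx' y hy' hxy]
  lab_mem x hx := by
    unfold mergeLabels
    split_ifs with hc
    · exact mem_insert_self _ _
    · push Not at hc
      exact mem_insert_of_mem (h.lab_mem x ((mem_insert.1 hx).resolve_left hc.1))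
  singleton_mem d hd := mem_union_left _ (h.singleton_mem d hd)
  nonempty := ⟨v, mem_insert_self _ _⟩

theorem CDSInv.singleton_ne {d : V} (hd : d ∈ ds) :
    ({d} : Finset V) ∉ ({insert v ((coll1 G D v).biUnion id)} : Finset (Finset V)) := fun hm =>
  h.newSet_not_mem hv (mem_singleton.1 hm ▸ h.singleton_mem d hd)

theorem CDSInv.g_update {d : V} (hd : d ∈ ds) :
    (activate (raise G D v ε) {insert v ((coll1 G D v).biUnion id)}).g {d} =
      if G.Adj v d then 0 else D.g {d} := by
  refine (if_neg (h.singleton_ne hv hd)).trans ?_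
  simp [raise, h.singleton_mem d hd, mem_nbr_singleton, G.adj_comm]

theorem CDSInv.y_update {d : V} (hd : d ∈ ds) :
    (activate (raise G D v ε) {insert v ((coll1 G D v).biUnion id)}).y {d} =
      D.y {d} + D.g {d} * ε := by
  refine (if_neg (h.singleton_ne hv hd)).trans ?_
  simp [raise, h.singleton_mem d hd]

/-- As many sets are restricted as the sum at `v` says, and one is activated. The additive form
avoids truncated subtraction. The indicators do not depend on ε, so the proof raises by 0. -/
theorem CDSInv.total_update : ((insert v U).image (mergeLabels G U lab v)).card + sumG G D v =
    (U.image lab).card + 1 := by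
  rw [← (h.update hv 0).sum_g_total, ← h.sum_g_total]
  simp only [activate]
  rw [sum_union (h.disjoint_active hv 0), sum_singleton, if_pos (mem_singleton_self _)]
  have : ∑ S ∈ (raise G D v 0).active, (if S ∈ ({insert v ((coll1 G D v).biUnion id)} :
      Finset (Finset V)) then 1 else (raise G D v 0).g S) + sumG G D v = ∑ S ∈ D.active, D.g S := by
    rw [sumG, sum_filter]
    change ∑ S ∈ D.active, _ + _ = _
    rw [← sum_add_distrib]
    refine sum_congr rfl fun S hS => ?_
    have : S ∉ ({insert v ((coll1 G D v).biUnion id)} : Finset (Finset V)) := fun hm =>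
      h.newSet_not_mem hv (mem_singleton.1 hm ▸ hS)
    rw [if_neg this]
    simp only [raise, hS, true_and]
    split_ifs <;> simp
  omega

end Step

/-- The program chooses a node for each label, the algorithm one for each set. Since the sets are
classes and determine their labels, the choices can be translated. -/
theorem CDSInv.exists_choice {cds cds' : Finset V} {v : V} (m : V → V)
    (hm : ∀ l ∈ nearLabels G U lab v \ nearLabels G (U ∩ cds) lab v,
      m l ∈ U ∧ G.Adj v (m l) ∧ lab (m l) = l)
    (hcds : cds' = insert v cds ∪ (nearLabels G U lab v \ nearLabels G (U ∩ cds) lab v).image m) :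
    ∃ f : Finset V → V, (∀ S ∈ coll1 G D v \ coll2 G D cds v, f S ∈ S ∩ nbr G {v}) ∧
      cds' = insert v cds ∪ (coll1 G D v \ coll2 G D cds v).image f := by
  classical
  have hcoll : ∀ S, S ∈ coll1 G D v \ coll2 G D cds v ↔ ∃ x ∈ U,
      lab x ∈ nearLabels G U lab v \ nearLabels G (U ∩ cds) lab v ∧ S = labelClass U lab x := by
    intro S
    have h2 : ∀ x ∈ U, labelClass U lab x ∈ coll2 G D cds v ↔
        lab x ∈ nearLabels G (U ∩ cds) lab v := by
      intro x hx
      simp only [coll2, mem_filter]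
      rw [← and_assoc, h.free, mem_nearLabels]
      constructor
      · rintro ⟨-, y, hy⟩
        simp only [mem_inter, mem_labelClass, mem_nbr_singleton] at hy
        exact ⟨y, mem_inter.2 ⟨hy.1.1.1, hy.2⟩, hy.1.2, hy.1.1.2⟩
      · rintro ⟨y, hy, hvy, e⟩
        obtain ⟨hy, hyc⟩ := mem_inter.1 hy
        refine ⟨⟨x, hx, rfl⟩, y, ?_⟩
        simp only [mem_inter, mem_labelClass, mem_nbr_singleton]
        exact ⟨⟨⟨hy, e⟩, hvy⟩, hyc⟩
    simp only [mem_sdiff, h.mem_coll1]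
    constructor
    · rintro ⟨⟨x, hx, hl, rfl⟩, hc⟩
      exact ⟨x, hx, ⟨hl, fun hc' => hc ((h2 x hx).2 hc')⟩, rfl⟩
    · rintro ⟨x, hx, ⟨hl, hc⟩, rfl⟩
      exact ⟨⟨x, hx, hl, rfl⟩, fun hc' => hc ((h2 x hx).1 hc')⟩
  -- Any element of a class yields its label; the value `v` at the empty set is a default that plays
  -- no role.
  let f : Finset V → V := fun S => if hS : S.Nonempty then m (lab hS.choose) else v
  have hf : ∀ x ∈ U, f (labelClass U lab x) = m (lab x) := by
    intro x hx
    have hne : (labelClass U lab x).Nonempty := ⟨x, mem_labelClass.2 ⟨hx, rfl⟩⟩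
    simp only [f, dif_pos hne]
    rw [(mem_labelClass.1 hne.choose_spec).2]
  refine ⟨f, fun S hS => ?_, ?_⟩
  · obtain ⟨x, hx, hl, rfl⟩ := (hcoll S).1 hS
    obtain ⟨h1, h2, h3⟩ := hm _ hl
    rw [hf x hx, mem_inter, mem_labelClass, mem_nbr_singleton]
    exact ⟨⟨h1, h3⟩, h2⟩
  · rw [hcds]
    congr 1
    ext z
    simp only [mem_image, hcoll]
    constructor
    · rintro ⟨l, hl, rfl⟩
      obtain ⟨x, hx, -, rfl⟩ := mem_nearLabels.1 (mem_sdiff.1 hl).1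
      exact ⟨_, ⟨x, hx, hl, rfl⟩, hf x hx⟩
    · rintro ⟨S, ⟨x, hx, hl, rfl⟩, rfl⟩
      exact ⟨lab x, hl, (hf x hx).symm⟩

end Inv

theorem CDSInv.of_reachable {w : V → ℝ} {ds : Finset V} (hi : IsIndependent G ds)
    (hne : ds.Nonempty) {σ : CDSState V}
    (hσ : Relation.ReflTransGen (CDSStep G w) (cdsStart w ds) σ) :
    ∃ U lab, CDSInv G ds σ.dual U lab := by
  induction hσ with
  | refl => exact ⟨ds, id, CDSInv.start w hi hne⟩
  | tail _ hs ih =>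
    obtain ⟨U, lab, h⟩ := ih
    obtain ⟨v, ε, f, hsel, -, rfl⟩ := hs
    have hv : sumG G _ v ≠ 0 := fun h0 => by
      have := hsel.1
      rw [potential, if_pos h0] at this
      exact WithTop.coe_ne_top this.symm
    exact ⟨_, _, h.update (h.not_mem hv) ε⟩

end

theorem IsDominating.nonempty {n : ℕ} {G : SimpleGraph (Fin n)} [DecidableRel G.Adj]
    {ds : Finset (Fin n)} (hn : 1 ≤ n) (hd : IsDominating G ds) : ds.Nonempty := by
  rw [nonempty_iff_ne_empty]
  rintro rfl
  have : (⟨0, hn⟩ : Fin n) ∈ nbr G ∅ ∪ ∅ := by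
    rw [show nbr G ∅ ∪ ∅ = univ from hd]; exact mem_univ _
  simp [mem_nbr] at this

/-- A neighbour of `u` is chosen in each set. Different sets have different labels and adjacent
nodes of `U` equal ones, so the chosen points are more than one apart, while all are within distance
one of `p u`. -/
theorem card_free_le_five {n : ℕ} {p : Fin n → EuclideanSpace ℝ (Fin 2)} {ds : Finset (Fin n)}
    {D : Dual (Fin n)} {U : Finset (Fin n)} {lab : Fin n → Fin n}
    (h : CDSInv (udg p) ds D U lab) (u : Fin n) :
    (D.active.filter fun S => D.g S = 1 ∧ u ∈ nbr (udg p) S).card ≤ 5 := by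
  have hex : ∀ S, S ∈ D.active ∧ D.g S = 1 ∧ u ∈ nbr (udg p) S →
      ∃ x ∈ U, S = labelClass U lab x ∧ (udg p).Adj x u := by
    rintro S ⟨h1, h2, h3⟩
    obtain ⟨x, hx, rfl⟩ := (h.free S).1 ⟨h1, h2⟩
    obtain ⟨-, y, hy, hyu⟩ := mem_nbr.1 h3
    obtain ⟨hy, e⟩ := mem_labelClass.1 hy
    refine ⟨y, hy, ?_, hyu⟩
    ext z
    rw [mem_labelClass, mem_labelClass, e]
  have : Nonempty (Fin n) := ⟨u⟩
  choose! x hxU hS hxu using hex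
  refine card_le_five _ (fun S => p (x S)) (p u) (fun S hS' => ?_) fun S hS₁ S' hS₂ hne => ?_
  · rw [dist_comm]
    exact (hxu S (by simpa using hS')).2
  · have e := hS S (by simpa using hS₁)
    have e' := hS S' (by simpa using hS₂)
    have m := hxU S (by simpa using hS₁)
    have m' := hxU S' (by simpa using hS₂)
    have hlab : lab (x S) ≠ lab (x S') := fun hl => hne (by
      rw [e, e']; unfold labelClass; rw [hl])
    by_contra! hle
    refine hlab (h.adj _ m _ m' ⟨fun hx => hlab (by rw [hx]), hle⟩)

end Mule

namespace Mule

namespace Code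

/-! ## Program for Algorithm 2 -/

/-- Unmark the labels of the neighbours of the node in register `v`. -/
def unmark (v : ℕ) : Code := forNbr v (.putNat 12 (.cell 11 (.reg 13) (.const 0)) (.const 0))

/-- Is the neighbour in register `13` in an un-restricted set whose label is not marked? -/
def fresh : Test :=
  .conj (.natEq (.cell 7 (.reg 13) (.const 0)) (.const 1))
    (.natEq (.cell 12 (.cell 11 (.reg 13) (.const 0)) (.const 0)) (.const 0))

/-- Count the labels of the un-restricted sets adjacent to the node in register `11`. -/
def nearCountNode : Code :=
  .seq (unmark 11) (.seq (.putNat 6 (.reg 11) (.const 0))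
    (.branch (.natEq (.cell 7 (.reg 11) (.const 0)) (.const 0))
      (forNbr 11 (.branch fresh
        (.seq (.putNat 12 (.cell 11 (.reg 13) (.const 0)) (.const 1))
          (.putNat 6 (.reg 11) (.add (.cell 6 (.reg 11) (.const 0)) (.const 1)))) .skip)) .skip))

/-- Recompute the sums of the indicators. -/
def nearCount : Code := .forN 11 0 nearCountNode

/-- Connect the un-restricted sets adjacent to the selected node. -/
def connect : Code :=
  .branch (.natLt (.const 1) (.cell 6 (.reg 5) (.const 0)))
    (.seq (unmark 5)
    (.seq (forNbr 5 (.branch (.conj (.natEq (.cell 7 (.reg 13) (.const 0)) (.const 1))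
        (.natEq (.cell 3 (.reg 13) (.const 0)) (.const 1)))
      (.putNat 12 (.cell 11 (.reg 13) (.const 0)) (.const 1)) .skip))
    (.seq (forNbr 5 (.branch fresh
      (.seq (.putNat 12 (.cell 11 (.reg 13) (.const 0)) (.const 1))
        (.putNat 3 (.reg 13) (.const 1))) .skip))
    (.putNat 3 (.reg 5) (.const 1))))) .skip

/-- Merge the selected node and the un-restricted sets adjacent to it. -/
def merge : Code :=
  .seq (.forN 11 0 (.putNat 12 (.reg 11) (.const 0)))
  (.seq (forNbr 5 (.branch (.natEq (.cell 7 (.reg 13) (.const 0)) (.const 1))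
      (.putNat 12 (.cell 11 (.reg 13) (.const 0)) (.const 1)) .skip))
  (.seq (.forN 11 0 (.branch (.conj (.natEq (.cell 7 (.reg 11) (.const 0)) (.const 1))
      (.natEq (.cell 12 (.cell 11 (.reg 11) (.const 0)) (.const 0)) (.const 1)))
      (.putNat 11 (.reg 11) (.reg 5)) .skip))
  (.seq (.putNat 7 (.reg 5) (.const 1)) (.putNat 11 (.reg 5) (.reg 5)))))

/-- Update the number of un-restricted sets. -/
def countSets : Code :=
  .setNat 14 (.sub (.add (.reg 14) (.const 1)) (.cell 6 (.reg 5) (.const 0)))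

/-- Test whether only one un-restricted set is left. -/
def cdsTest : Code :=
  .branch (.natEq (.reg 14) (.const 1)) (.setNat 7 (.const 1)) (.setNat 7 (.const 0))

/-- The loop body of Algorithm 2. -/
def cdsBody : Code :=
  .seq selectRaise (.seq connect (.seq merge (.seq countSets (.seq nearCount cdsTest))))

/-- The initialization of the data of one node. -/
def cdsInitNode : Code :=
  .seq (.putNat 3 (.reg 11) (.cell 2 (.reg 11) (.const 0)))
  (.seq (.putNat 7 (.reg 11) (.cell 2 (.reg 11) (.const 0)))
  (.seq (.putNat 9 (.reg 11) (.cell 2 (.reg 11) (.const 0)))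
  (.seq (.putNat 11 (.reg 11) (.reg 11))
  (.seq (.putReal 3 (.reg 11)
    (.mul (.div (.ofNat (.const 99)) (.ofNat (.const 100))) (.cell 0 (.reg 11))))
  (.seq (.putReal 5 (.reg 11) (.mul (.div (.ofNat (.const 99)) (.ofNat (.const 500)))
    (.sub (.cell 0 (.reg 11)) (.ofNat (.const 2)))))
    (.putReal 4 (.reg 11) (.ofNat (.const 0))))))))

/-- Compute the sums of the initial values. -/
def initSums : Code :=
  .forN 11 0 (forNbr 11 (.branch (.natEq (.cell 2 (.reg 13) (.const 0)) (.const 1))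
    (.putReal 4 (.reg 11) (.add (.cell 4 (.reg 11)) (.cell 5 (.reg 13)))) .skip))

/-- Count the initial sets. -/
def initCount : Code :=
  .seq (.setNat 14 (.const 0))
    (.forN 11 0 (.setNat 14 (.add (.reg 14) (.cell 2 (.reg 11) (.const 0)))))

/-- The initialization of Algorithm 2. -/
def cdsInit : Code :=
  .seq (.setNat 7 (.const 0)) (.seq (.forN 11 0 cdsInitNode)
    (.seq initSums (.seq initCount nearCount)))

/-- Algorithm 2. -/
def cdsCode : Code :=
  .seq cdsInit (.seq cdsBody.repeatBounded
    (sumReal (.natEq (.cell 2 (.reg 11) (.const 0)) (.const 1)) (.cell 5 (.reg 11))))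

variable {n : ℕ} {G : SimpleGraph (Fin n)} [DecidableRel G.Adj] {s : Store}

/-- Integer arrays `7` and `11` hold the set `U` and the labels `lab`. -/
structure HoldsLabels (U : Finset (Fin n)) (lab : Fin n → Fin n) (s : Store) : Prop where
  mem : ∀ u : Fin n, s.natArr 7 u 0 = if u ∈ U then 1 else 0
  lab : ∀ u : Fin n, s.natArr 11 u 0 = lab u

theorem HoldsLabels.congr {U : Finset (Fin n)} {lab : Fin n → Fin n} {s' : Store}
    (h : HoldsLabels U lab s) (h7 : s'.natArr 7 = s.natArr 7) (h11 : s'.natArr 11 = s.natArr 11) :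
    HoldsLabels U lab s' :=
  ⟨fun u => by rw [h7, h.mem], fun u => by rw [h11, h.lab]⟩

/-- Marks are left over from earlier uses. Only labels of neighbours are going to be looked up, so
it suffices to clear these, in O(Δ) steps instead of O(n). -/
theorem unmark_spec (hg : Graphed G s) {v : ℕ} {v₀ : Fin n} (hv : s.nat v = v₀)
    {U : Finset (Fin n)} {lab : Fin n → Fin n} (h : HoldsLabels U lab s)
    (hwv : (unmark v).wN v = false := by rfl) :
    ∀ x, G.Adj v₀ x → ((unmark v).run s).natArr 12 (lab x) 0 = 0 := by
  have := forNbr_rule hg (v := v) (v₀ := v₀) hv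
    (c := .putNat 12 (.cell 11 (.reg 13) (.const 0)) (.const 0))
    (fun T s' => ∀ x ∈ T, s'.natArr 12 (lab x) 0 = 0) (by simp) (fun _ _ _ h => h)
    (fun _ _ _ h => h) (by
      intro T u r hu hadj h13 ag ih x hx
      have e : r.natArr 11 u 0 = lab u := by rw [ag.natArr 11 rfl, h.lab]
      simp only [run, NExp.eval, h13, e]
      rcases mem_insert.1 hx with rfl | hx
      · simp
      · rw [ih x hx]; simp) hwv rfl rfl
  exact fun x hx => this x (by simpa using hx)

theorem fresh_holds {U : Finset (Fin n)} {lab : Fin n → Fin n} (h : HoldsLabels U lab s)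
    {x : Fin n} (hx : s.nat 13 = x) {P : Prop} [Decidable P]
    (hP : s.natArr 12 (lab x) 0 = if P then 1 else 0) : fresh.Holds s ↔ x ∈ U ∧ ¬ P := by
  simp [fresh, Test.Holds, NExp.eval, hx, h.lab, hP, h.mem]

/-- A neighbour in `U` is counted if its label is unmarked, and then marks it, so each label is
counted once. All nodes share the array of marks, but the relevant marks are cleared before each
count. -/
theorem nearCount_spec (hg : Graphed G s) {U : Finset (Fin n)} {lab : Fin n → Fin n}
    (h : HoldsLabels U lab s) : ∀ u : Fin n,
    (nearCount.run s).natArr 6 u 0 = if u ∈ U then 0 else (nearLabels G U lab u).card := by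
  refine forN_pointwise hg.graph.size (fun _ _ => True)
    (fun u s' => s'.natArr 6 u 0 = if u ∈ U then 0 else (nearLabels G U lab u).card)
    (fun _ => trivial) (fun _ _ _ h => h) (fun _ _ _ h => h) ?_
  intro u r hu ag _
  have hr : HoldsLabels U lab r := h.congr (ag.natArr 7 rfl) (ag.natArr 11 rfl)
  have gr : Graphed G r := hg.of_agrees ag
  have hm := unmark_spec gr (v := 11) hu hr
  have a1 := agrees_run (unmark 11) r
  rw [nearCountNode, run_seq, run_seq]
  set r₁ := (unmark 11).run r with hr₁
  set r₂ := (Code.putNat 6 (.reg 11) (.const 0)).run r₁ with hr₂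
  have e11 : r₁.nat 11 = u := (a1.nat 11 rfl).trans hu
  have e6 : ∀ x : Fin n, r₂.natArr 6 x 0 = if x = u then 0 else r.natArr 6 x 0 := fun x => by
    simp only [hr₂, run, NExp.eval, e11, Fin.val_inj, a1.natArr 6 rfl, true_and, and_true]
  have h₂ : HoldsLabels U lab r₂ := hr.congr (a1.natArr 7 rfl) (a1.natArr 11 rfl)
  have g₂ : Graphed G r₂ := (gr.of_agrees a1).congr rfl rfl rfl rfl
  have hT : (Test.natEq (.cell 7 (.reg 11) (.const 0)) (.const 0)).Holds r₂ ↔ u ∉ U := by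
    have : r₂.nat 11 = u := e11
    simp [Test.Holds, NExp.eval, this, h₂.mem]
  set c₃ : Code := .branch (.natEq (.cell 7 (.reg 11) (.const 0)) (.const 0))
      (forNbr 11 (.branch fresh
        (.seq (.putNat 12 (.cell 11 (.reg 13) (.const 0)) (.const 1))
          (.putNat 6 (.reg 11) (.add (.cell 6 (.reg 11) (.const 0)) (.const 1)))) .skip)) .skip
    with hc₃
  suffices hs : (c₃.run r₂).natArr 6 u 0 = (if u ∈ U then 0 else (nearLabels G U lab u).card) ∧
      ∀ x : Fin n, x ≠ u → (c₃.run r₂).natArr 6 x 0 = r.natArr 6 x 0 from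
    ⟨hs.1, fun x hx => ⟨id, fun e => (hs.2 x hx).trans e⟩⟩
  by_cases hU : u ∈ U
  · rw [hc₃, run_neg (fun hc => hT.1 hc hU), if_pos hU]
    exact ⟨by simp [run, e6], fun x hx => by simp [run, e6, hx]⟩
  · rw [hc₃, run_pos (hT.2 hU), if_neg hU]
    have key := forNbr_rule g₂ (v := 11) (v₀ := u) e11 (c := .branch fresh
        (.seq (.putNat 12 (.cell 11 (.reg 13) (.const 0)) (.const 1))
          (.putNat 6 (.reg 11) (.add (.cell 6 (.reg 11) (.const 0)) (.const 1)))) .skip)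
      (fun T q => (∀ x, G.Adj u x → q.natArr 12 (lab x) 0 =
          if lab x ∈ (T.filter fun x => x ∈ U).image lab then 1 else 0) ∧
        q.natArr 6 u 0 = ((T.filter fun x => x ∈ U).image lab).card ∧
        ∀ x : Fin n, x ≠ u → q.natArr 6 x 0 = r.natArr 6 x 0)
      ⟨fun x hx => by simp [hr₂, run, hm x hx], by simp [e6], fun x hx => by simp [e6, hx]⟩
      (fun _ _ _ h => h) (fun _ _ _ h => h) (by
        rintro T x q hx hadj h13 aq ⟨i1, i2, i3⟩
        have hq : HoldsLabels U lab q := h₂.congr (aq.natArr 7 rfl) (aq.natArr 11 rfl)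
        have q11 : q.nat 11 = u := (aq.nat 11 rfl).trans e11
        have hf := fresh_holds hq h13 (i1 x hadj)
        by_cases hc : x ∈ U ∧ lab x ∉ (T.filter fun x => x ∈ U).image lab
        · rw [run_pos (hf.2 hc), filter_insert, if_pos hc.1, image_insert,
            card_insert_of_notMem hc.2]
          refine ⟨fun y hy => ?_, ?_, fun y hy => ?_⟩
          · simp only [run, NExp.eval, h13, hq.lab, q11, Fin.val_inj, mem_insert, i1 y hy]
            by_cases e : lab y = lab x <;> simp [e]
          · simp [run, NExp.eval, q11, i2]
          · simp [run, NExp.eval, q11, Fin.val_inj, hy, i3 y hy]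
        · rw [run_neg (mt hf.1 hc), filter_insert]
          have : (if x ∈ U then insert x (T.filter fun x => x ∈ U) else
              T.filter fun x => x ∈ U).image lab = (T.filter fun x => x ∈ U).image lab := by
            split_ifs with hxU
            · rw [image_insert, insert_eq_self]
              by_contra hn
              exact hc ⟨hxU, hn⟩
            · rfl
          rw [this]
          exact ⟨i1, i2, i3⟩)
    exact key.2

/-- The first pass marks the labels of the classes that contain a neighbour of `v` from `cds`; the
second adds the first neighbour met with each label not yet marked. The passes are separate because
a neighbour in `cds` may come late in the list. A choice `m` is supplied even if nothing is added,
since `CDSStep` asks for one in every round. -/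
theorem connect_spec (hg : Graphed G s) {U : Finset (Fin n)} {lab : Fin n → Fin n}
    (h : HoldsLabels U lab s) {v : Fin n} (hv : s.nat 5 = v) {cds : Finset (Fin n)}
    (hc : ∀ u : Fin n, s.natArr 3 u 0 = if u ∈ cds then 1 else 0) :
    ∃ (cds' : Finset (Fin n)) (m : Fin n → Fin n),
      (∀ u : Fin n, (connect.run s).natArr 3 u 0 =
        if u ∈ (if 1 < s.natArr 6 v 0 then cds' else cds) then 1 else 0) ∧
      (∀ l ∈ nearLabels G U lab v \ nearLabels G (U ∩ cds) lab v,
        m l ∈ U ∧ G.Adj v (m l) ∧ lab (m l) = l) ∧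
      cds' = insert v cds ∪
        (nearLabels G U lab v \ nearLabels G (U ∩ cds) lab v).image m := by
  have hT : (Test.natLt (.const 1) (.cell 6 (.reg 5) (.const 0))).Holds s ↔
      1 < s.natArr 6 v 0 := by simp [Test.Holds, NExp.eval, hv]
  -- a choice that does not depend on the program, for the case in which it is not needed
  by_cases h1 : 1 < s.natArr 6 v 0
  swap
  · have : ∀ l, ∃ x, l ∈ nearLabels G U lab v → x ∈ U ∧ G.Adj v x ∧ lab x = l := fun l => by
      by_cases hl : l ∈ nearLabels G U lab v
      · obtain ⟨x, hx⟩ := mem_nearLabels.1 hl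
        exact ⟨x, fun _ => hx⟩
      · exact ⟨l, fun hc => absurd hc hl⟩
    choose m hm using this
    refine ⟨_, m, fun u => ?_, fun l hl => hm l (mem_sdiff.1 hl).1, rfl⟩
    rw [connect, run_neg (mt hT.1 h1), if_neg h1]
    exact hc u
  simp only [if_pos h1]
  rw [connect, run_pos (hT.2 h1), run_seq, run_seq, run_seq]
  set c₂ : Code := forNbr 5 (.branch (.conj (.natEq (.cell 7 (.reg 13) (.const 0)) (.const 1))
        (.natEq (.cell 3 (.reg 13) (.const 0)) (.const 1)))
      (.putNat 12 (.cell 11 (.reg 13) (.const 0)) (.const 1)) .skip) with hc₂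
  set c₃ : Code := forNbr 5 (.branch fresh
      (.seq (.putNat 12 (.cell 11 (.reg 13) (.const 0)) (.const 1))
        (.putNat 3 (.reg 13) (.const 1))) .skip) with hc₃
  have a1 := agrees_run (unmark 5) s
  have m1 := unmark_spec hg hv h
  set s₁ := (unmark 5).run s
  have a2 : c₂.Agrees s₁ (c₂.run s₁) := agrees_run _ _
  have g1 : Graphed G s₁ := hg.of_agrees a1
  have l1 : HoldsLabels U lab s₁ := h.congr (a1.natArr 7 rfl) (a1.natArr 11 rfl)
  have v1 : s₁.nat 5 = v := (a1.nat 5 rfl).trans hv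
  have key2 := forNbr_rule g1 (v := 5) (v₀ := v) v1
    (c := .branch (.conj (.natEq (.cell 7 (.reg 13) (.const 0)) (.const 1))
        (.natEq (.cell 3 (.reg 13) (.const 0)) (.const 1)))
      (.putNat 12 (.cell 11 (.reg 13) (.const 0)) (.const 1)) .skip)
    (fun T q => ∀ x, G.Adj v x → q.natArr 12 (lab x) 0 =
      if lab x ∈ (T.filter fun x => x ∈ U ∩ cds).image lab then 1 else 0)
    (fun x hx => by simpa using m1 x hx) (fun _ _ _ h => h) (fun _ _ _ h => h) (by
      intro T x q hx hadj h13 aq ih y hy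
      have hq : HoldsLabels U lab q := l1.congr (aq.natArr 7 rfl) (aq.natArr 11 rfl)
      have q3 : q.natArr 3 x 0 = if x ∈ cds then 1 else 0 := by
        rw [aq.natArr 3 rfl, a1.natArr 3 rfl, hc]
      have hf : (Test.conj (.natEq (.cell 7 (.reg 13) (.const 0)) (.const 1))
          (.natEq (.cell 3 (.reg 13) (.const 0)) (.const 1))).Holds q ↔ x ∈ U ∩ cds := by
        simp [Test.Holds, NExp.eval, h13, hq.mem, q3]
      rw [filter_insert]
      by_cases hxc : x ∈ U ∩ cds
      · rw [run_pos (hf.2 hxc), if_pos hxc, image_insert]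
        simp only [run, NExp.eval, h13, hq.lab, Fin.val_inj, mem_insert, ih y hy]
        by_cases e : lab y = lab x <;> simp [e]
      · rw [run_neg (mt hf.1 hxc), if_neg hxc]
        exact ih y hy)
  rw [← hc₂] at key2
  set s₂ := c₂.run s₁
  have hL2 : ((G.neighborFinset v).filter fun x => x ∈ U ∩ cds).image lab =
      nearLabels G (U ∩ cds) lab v := rfl
  rw [hL2] at key2
  set L₂ := nearLabels G (U ∩ cds) lab v
  have g2 : Graphed G s₂ := g1.of_agrees a2
  have l2 : HoldsLabels U lab s₂ := l1.congr (a2.natArr 7 rfl) (a2.natArr 11 rfl)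
  have v2 : s₂.nat 5 = v := (a2.nat 5 rfl).trans v1
  have e3 : ∀ u : Fin n, s₂.natArr 3 u 0 = if u ∈ cds then 1 else 0 := fun u => by
    rw [a2.natArr 3 rfl, a1.natArr 3 rfl, hc]
  obtain ⟨-, m, hm, h3⟩ := forNbr_rule g2 (v := 5) (v₀ := v) v2
    (c := .branch fresh (.seq (.putNat 12 (.cell 11 (.reg 13) (.const 0)) (.const 1))
        (.putNat 3 (.reg 13) (.const 1))) .skip)
    (fun T q => (∀ x, G.Adj v x → q.natArr 12 (lab x) 0 =
        if lab x ∈ L₂ ∪ (T.filter fun x => x ∈ U).image lab then 1 else 0) ∧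
      ∃ m : Fin n → Fin n, (∀ l ∈ (T.filter fun x => x ∈ U).image lab \ L₂,
          m l ∈ U ∧ G.Adj v (m l) ∧ lab (m l) = l) ∧
        ∀ u : Fin n, q.natArr 3 u 0 =
          if u ∈ cds ∪ ((T.filter fun x => x ∈ U).image lab \ L₂).image m then 1 else 0)
    ⟨fun x hx => by simpa using key2 x hx, id, by simp, fun u => by simpa using e3 u⟩
    (fun _ _ _ h => h) (fun _ _ _ h => h) (by
      rintro T x q hx hadj h13 aq ⟨i1, m, i2, i3⟩
      have hq : HoldsLabels U lab q := l2.congr (aq.natArr 7 rfl) (aq.natArr 11 rfl)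
      have hf := fresh_holds hq h13 (i1 x hadj)
      by_cases hcx : x ∈ U ∧ lab x ∉ L₂ ∪ (T.filter fun x => x ∈ U).image lab
      · rw [run_pos (hf.2 hcx), filter_insert, if_pos hcx.1, image_insert]
        have hxL : lab x ∉ L₂ := fun hn => hcx.2 (mem_union_left _ hn)
        have hxT : lab x ∉ (T.filter fun x => x ∈ U).image lab :=
          fun hn => hcx.2 (mem_union_right _ hn)
        have hne : ∀ l ∈ (T.filter fun x => x ∈ U).image lab \ L₂, l ≠ lab x :=
          fun l hl e => hxT (e ▸ (mem_sdiff.1 hl).1)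
        refine ⟨fun y hy => ?_, Function.update m (lab x) x, fun l hl => ?_, fun u => ?_⟩
        · simp only [run, NExp.eval, h13, hq.lab, Fin.val_inj, mem_insert, mem_union, i1 y hy]
          by_cases e : lab y = lab x <;> simp [e]
        · rw [insert_sdiff_of_notMem _ hxL] at hl
          rcases mem_insert.1 hl with rfl | hl
          · rw [Function.update_self]
            exact ⟨hcx.1, hadj, rfl⟩
          · rw [Function.update_of_ne (hne l hl)]
            exact i2 l hl
        · rw [insert_sdiff_of_notMem _ hxL, image_insert, Function.update_self]
          -- The label of `x` is new, so the update does not affect earlier choices.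
          have : ((T.filter fun x => x ∈ U).image lab \ L₂).image (Function.update m (lab x) x) =
              ((T.filter fun x => x ∈ U).image lab \ L₂).image m :=
            image_congr fun l hl => Function.update_of_ne (hne l hl) _ _
          rw [this, union_insert]
          simp only [run, NExp.eval, h13, Fin.val_inj, mem_insert, i3]
          by_cases e : u = x <;> simp [e]
      · have : (if x ∈ U then insert x (T.filter fun x => x ∈ U) else
            T.filter fun x => x ∈ U).image lab \ L₂ = (T.filter fun x => x ∈ U).image lab \ L₂ ∧
            L₂ ∪ (if x ∈ U then insert x (T.filter fun x => x ∈ U) else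
            T.filter fun x => x ∈ U).image lab = L₂ ∪ (T.filter fun x => x ∈ U).image lab := by
          split_ifs with hxU
          · have : lab x ∈ L₂ ∪ (T.filter fun x => x ∈ U).image lab := by
              by_contra hn
              exact hcx ⟨hxU, hn⟩
            rw [image_insert]
            refine ⟨?_, by rw [union_insert, insert_eq_self.2 this]⟩
            rcases mem_union.1 this with hl | hl
            · rw [insert_sdiff_of_mem _ hl]
            · rw [insert_eq_self.2 hl]
          · exact ⟨rfl, rfl⟩
        rw [run_neg (mt hf.1 hcx), filter_insert, this.1, this.2]
        exact ⟨i1, m, i2, i3⟩)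
  rw [← hc₃] at h3
  have a3 : c₃.Agrees s₂ (c₃.run s₂) := agrees_run _ _
  have v3 : (c₃.run s₂).nat 5 = v := (a3.nat 5 rfl).trans v2
  refine ⟨_, m, fun u => ?_, hm, rfl⟩
  simp only [run, NExp.eval, v3, Fin.val_inj, h3]
  by_cases e : u = v
  · simp [e]
  · simp only [e, false_and, and_false, if_false, mem_union, mem_insert, false_or]
    rfl

/-- Relabelling looks up the mark for the label of every node, not only of neighbours, so here all
marks are cleared first. -/
theorem merge_spec (hg : Graphed G s) {U : Finset (Fin n)} {lab : Fin n → Fin n}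
    (h : HoldsLabels U lab s) {v : Fin n} (hv : s.nat 5 = v) :
    HoldsLabels (insert v U) (mergeLabels G U lab v) (merge.run s) := by
  rw [merge, run_seq, run_seq, run_seq]
  set c₁ : Code := .forN 11 0 (.putNat 12 (.reg 11) (.const 0)) with hc₁
  set c₂ : Code := forNbr 5 (.branch (.natEq (.cell 7 (.reg 13) (.const 0)) (.const 1))
      (.putNat 12 (.cell 11 (.reg 13) (.const 0)) (.const 1)) .skip) with hc₂
  set c₃ : Code := .forN 11 0 (.branch (.conj (.natEq (.cell 7 (.reg 11) (.const 0)) (.const 1))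
      (.natEq (.cell 12 (.cell 11 (.reg 11) (.const 0)) (.const 0)) (.const 1)))
      (.putNat 11 (.reg 11) (.reg 5)) .skip) with hc₃
  have a1 : c₁.Agrees s (c₁.run s) := agrees_run _ _
  have m1 := forN_pointwise (n := n) (i := 11) (b := 0) (c := .putNat 12 (.reg 11) (.const 0))
    hg.graph.size (fun _ _ => True) (fun u s' => s'.natArr 12 u 0 = 0) (fun _ => trivial)
    (fun _ _ _ h => h) (fun _ _ _ h => h) (fun u s' hu ag _ => ⟨by simp [run, NExp.eval, hu],
      fun x hx => ⟨id, by simp [run, NExp.eval, hu, Fin.val_inj, hx]⟩⟩)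
  rw [← hc₁] at m1
  set s₁ := c₁.run s
  have g1 : Graphed G s₁ := hg.of_agrees a1
  have l1 : HoldsLabels U lab s₁ := h.congr (a1.natArr 7 rfl) (a1.natArr 11 rfl)
  have v1 : s₁.nat 5 = v := (a1.nat 5 rfl).trans hv
  have key2 := forNbr_rule g1 (v := 5) (v₀ := v) v1
    (c := .branch (.natEq (.cell 7 (.reg 13) (.const 0)) (.const 1))
      (.putNat 12 (.cell 11 (.reg 13) (.const 0)) (.const 1)) .skip)
    (fun T q => ∀ l : Fin n, q.natArr 12 l 0 =
      if l ∈ (T.filter fun x => x ∈ U).image lab then 1 else 0)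
    (fun x => by simpa using m1 x) (fun _ _ _ h => h) (fun _ _ _ h => h) (by
      intro T x q hx hadj h13 aq ih y
      have hq : HoldsLabels U lab q := l1.congr (aq.natArr 7 rfl) (aq.natArr 11 rfl)
      have hf : (Test.natEq (.cell 7 (.reg 13) (.const 0)) (.const 1)).Holds q ↔ x ∈ U := by
        simp [Test.Holds, NExp.eval, h13, hq.mem]
      rw [filter_insert]
      by_cases hxc : x ∈ U
      · rw [run_pos (hf.2 hxc), if_pos hxc, image_insert]
        simp only [run, NExp.eval, h13, hq.lab, Fin.val_inj, mem_insert, ih y]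
        by_cases e : y = lab x <;> simp [e]
      · rw [run_neg (mt hf.1 hxc), if_neg hxc]
        exact ih y)
  rw [← hc₂] at key2
  have a2 : c₂.Agrees s₁ (c₂.run s₁) := agrees_run _ _
  set s₂ := c₂.run s₁
  have hL : ((G.neighborFinset v).filter fun x => x ∈ U).image lab = nearLabels G U lab v := rfl
  rw [hL] at key2
  have g2 : Graphed G s₂ := g1.of_agrees a2
  have l2 : HoldsLabels U lab s₂ := l1.congr (a2.natArr 7 rfl) (a2.natArr 11 rfl)
  have v2 : s₂.nat 5 = v := (a2.nat 5 rfl).trans v1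
  have key3 := forN_pointwise (n := n) (i := 11) (b := 0)
    (c := .branch (.conj (.natEq (.cell 7 (.reg 11) (.const 0)) (.const 1))
      (.natEq (.cell 12 (.cell 11 (.reg 11) (.const 0)) (.const 0)) (.const 1)))
      (.putNat 11 (.reg 11) (.reg 5)) .skip)
    g2.graph.size (fun u s' => s'.natArr 11 u 0 = lab u)
    (fun u s' => s'.natArr 11 u 0 =
      if u ∈ U ∧ lab u ∈ nearLabels G U lab v then (v : ℕ) else lab u) (fun u => l2.lab u)
    (fun _ _ _ h => h) (fun _ _ _ h => h) (by
      intro u q hu aq h11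
      have hf : (Test.conj (.natEq (.cell 7 (.reg 11) (.const 0)) (.const 1))
          (.natEq (.cell 12 (.cell 11 (.reg 11) (.const 0)) (.const 0)) (.const 1))).Holds q ↔
          u ∈ U ∧ lab u ∈ nearLabels G U lab v := by
        simp [Test.Holds, NExp.eval, hu, h11, aq.natArr 7 rfl, aq.natArr 12 rfl, key2, l2.mem]
      have q5 : q.nat 5 = v := (aq.nat 5 rfl).trans v2
      by_cases hc : u ∈ U ∧ lab u ∈ nearLabels G U lab v
      · rw [run_pos (hf.2 hc), if_pos hc]
        exact ⟨by simp [run, NExp.eval, hu, q5], fun x hx => by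
          simp [run, NExp.eval, hu, Fin.val_inj, hx]⟩
      · rw [run_neg (mt hf.1 hc), if_neg hc]
        exact ⟨h11, fun x hx => ⟨id, id⟩⟩)
  rw [← hc₃] at key3
  have a3 : c₃.Agrees s₂ (c₃.run s₂) := agrees_run _ _
  set s₃ := c₃.run s₂
  have v3 : s₃.nat 5 = v := (a3.nat 5 rfl).trans v2
  refine ⟨fun u => ?_, fun u => ?_⟩
  · simp only [run, NExp.eval, v3, Fin.val_inj, a3.natArr 7 rfl, l2.mem, mem_insert]
    by_cases e : u = v <;> simp [e]
  · simp only [run, NExp.eval, v3, Fin.val_inj, key3, mergeLabels]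
    by_cases e : u = v
    · simp [e]
    · simp only [e, false_and, and_false, if_false, false_or]
      by_cases e' : u ∈ U ∧ lab u ∈ nearLabels G U lab v <;> simp [e']

/-- The memory represents the state of Algorithm 2. -/
structure CDSRep (G : SimpleGraph (Fin n)) [DecidableRel G.Adj] (w : Fin n → ℝ)
    (ds : Finset (Fin n)) (σ : CDSState (Fin n)) (U : Finset (Fin n)) (lab : Fin n → Fin n)
    (s : Store) : Prop where
  inv : CDSInv G ds σ.dual U lab
  graphed : Graphed G s
  cap : ∀ u : Fin n, s.realArr 3 u = 99 / 100 * w u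
  dsArr : ∀ u : Fin n, s.natArr 2 u 0 = if u ∈ ds then 1 else 0
  cdsArr : ∀ u : Fin n, s.natArr 3 u 0 = if u ∈ σ.cds then 1 else 0
  labels : HoldsLabels U lab s
  flag : ∀ u ∈ ds, s.natArr 9 u 0 = σ.dual.g {u}
  sumG : ∀ u : Fin n, s.natArr 6 u 0 = Mule.sumG G σ.dual u
  sumY : ∀ u : Fin n, s.realArr 4 u = Mule.sumY G σ.dual u
  y : ∀ u ∈ ds, s.realArr 5 u = σ.dual.y {u}
  count : s.nat 14 = (U.image lab).card

theorem cdsBody_spec (hG : G.Connected) {w : Fin n → ℝ} {ds : Finset (Fin n)}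
    {σ : CDSState (Fin n)} {U : Finset (Fin n)} {lab : Fin n → Fin n}
    (h : CDSRep G w ds σ U lab s) (hne : ∃ u, Mule.sumG G σ.dual u ≠ 0) :
    ∃ σ', CDSStep G w σ σ' ∧
      (∃ U' lab', U'.card = U.card + 1 ∧ CDSRep G w ds σ' U' lab' (cdsBody.run s)) ∧
      (∑ S ∈ σ'.dual.active, σ'.dual.g S = 1 ∧ (cdsBody.run s).nat 7 = 1 ∨
        ¬ ∑ S ∈ σ'.dual.active, σ'.dual.g S = 1 ∧ (cdsBody.run s).nat 7 = 0 ∧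
          ∃ u, Mule.sumG G σ'.dual u ≠ 0) := by
  obtain ⟨v, ε, hs, hv, h5, hY, hy, hf⟩ :=
    selectRaise_spec h.graphed h.cap h.sumY h.sumG hne
  have hvU := h.inv.not_mem hv
  set s₁ := selectRaise.run s with hs₁
  set s₂ := connect.run s₁ with hs₂
  set s₃ := merge.run s₂ with hs₃
  set s₄ := countSets.run s₃ with hs₄
  set s₅ := nearCount.run s₄ with hs₅
  have a1 : selectRaise.Agrees s s₁ := agrees_run _ _
  have a2 : connect.Agrees s₁ s₂ := agrees_run _ _
  have a3 : merge.Agrees s₂ s₃ := agrees_run _ _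
  have a4 : countSets.Agrees s₃ s₄ := agrees_run _ _
  have a5 : nearCount.Agrees s₄ s₅ := agrees_run _ _
  have a6 : cdsTest.Agrees s₅ (cdsTest.run s₅) := agrees_run _ _
  have g1 := h.graphed.of_agrees a1
  have g2 := g1.of_agrees a2
  have g3 := g2.of_agrees a3
  have g4 := g3.of_agrees a4
  have g5 := g4.of_agrees a5
  have l1 : HoldsLabels U lab s₁ := h.labels.congr (a1.natArr 7 rfl) (a1.natArr 11 rfl)
  have e6 : s₁.natArr 6 v 0 = Mule.sumG G σ.dual v := by rw [a1.natArr 6 rfl, h.sumG]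
  obtain ⟨cds', m, hc3, hm, hcds'⟩ := connect_spec g1 l1 h5 (cds := σ.cds) (fun u => by
    rw [a1.natArr 3 rfl, h.cdsArr])
  rw [← hs₂, e6] at hc3
  obtain ⟨f, hf1, hf2⟩ := h.inv.exists_choice m hm hcds'
  have l2 : HoldsLabels U lab s₂ := l1.congr (a2.natArr 7 rfl) (a2.natArr 11 rfl)
  have v2 : s₂.nat 5 = v := (a2.nat 5 rfl).trans h5
  have l3 := merge_spec g2 l2 v2
  rw [← hs₃] at l3
  have l4 : HoldsLabels (insert v U) (mergeLabels G U lab v) s₄ :=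
    l3.congr (a4.natArr 7 rfl) (a4.natArr 11 rfl)
  have hcnt := nearCount_spec g4 l4
  rw [← hs₅] at hcnt
  have inv' := h.inv.update hvU ε
  have htot := h.inv.total_update hvU
  -- `countSets` reads the sum at `v` before `nearCount` overwrites array `6`; by `htot` its
  -- truncated subtraction is exact.
  have c14 : s₅.nat 14 = ((insert v U).image (mergeLabels G U lab v)).card := by
    rw [a5.nat 14 rfl]
    have : s₃.nat 5 = v := (a3.nat 5 rfl).trans v2
    simp only [hs₄, countSets, run, NExp.eval, if_true, this, a3.nat 14 rfl, a3.natArr 6 rfl,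
      a2.nat 14 rfl, a2.natArr 6 rfl, a1.nat 14 rfl, e6, h.count]
    omega
  have hrep : CDSRep G w ds (cdsUpdate G σ v ε f) (insert v U) (mergeLabels G U lab v)
      (cdsBody.run s) := by
    change CDSRep G w ds (cdsUpdate G σ v ε f) (insert v U) (mergeLabels G U lab v)
      (cdsTest.run s₅)
    refine ⟨inv', g5.of_agrees a6, fun u => ?_, fun u => ?_, fun u => ?_,
      l4.congr ((a6.natArr 7 rfl).trans (a5.natArr 7 rfl))
        ((a6.natArr 11 rfl).trans (a5.natArr 11 rfl)),
      fun u hu => ?_, fun u => ?_, fun u => ?_, fun u hu => ?_, ?_⟩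
    · rw [a6.realArr 3 rfl, a5.realArr 3 rfl, a4.realArr 3 rfl, a3.realArr 3 rfl,
        a2.realArr 3 rfl, a1.realArr 3 rfl, h.cap]
    · rw [a6.natArr 2 rfl, a5.natArr 2 rfl, a4.natArr 2 rfl, a3.natArr 2 rfl, a2.natArr 2 rfl,
        a1.natArr 2 rfl, h.dsArr]
    · rw [a6.natArr 3 rfl, a5.natArr 3 rfl, a4.natArr 3 rfl, a3.natArr 3 rfl, hc3]
      simp only [cdsUpdate, ← hf2]
    · rw [a6.natArr 9 rfl, a5.natArr 9 rfl, a4.natArr 9 rfl, a3.natArr 9 rfl, a2.natArr 9 rfl,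
        hf, h.flag u hu]
      exact (h.inv.g_update hvU ε hu).symm
    · rw [a6.natArr 6 rfl, hcnt]
      exact (inv'.sumG_eq u).symm
    · rw [a6.realArr 4 rfl, a5.realArr 4 rfl, a4.realArr 4 rfl, a3.realArr 4 rfl,
        a2.realArr 4 rfl, hY]
      exact (sumY_activate _ (h.inv.disjoint_active hvU ε) u).symm
    · rw [a6.realArr 5 rfl, a5.realArr 5 rfl, a4.realArr 5 rfl, a3.realArr 5 rfl,
        a2.realArr 5 rfl, hy, h.y u hu, h.flag u hu]
      exact (h.inv.y_update hvU ε hu).symm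
    · rw [a6.nat 14 rfl, c14]
  refine ⟨_, ⟨v, ε, f, hs, hf1, rfl⟩, ⟨_, _, card_insert_of_notMem hvU, hrep⟩, ?_⟩
  have ht := inv'.sum_g_total
  change (∑ S ∈ (cdsUpdate G σ v ε f).dual.active, (cdsUpdate G σ v ε f).dual.g S) = _ at ht
  have hT : (Test.natEq (.reg 14) (.const 1)).Holds s₅ ↔
      ∑ S ∈ (cdsUpdate G σ v ε f).dual.active, (cdsUpdate G σ v ε f).dual.g S = 1 := by
    simp only [Test.Holds, NExp.eval, c14, ht]
  have hrun : cdsBody.run s = cdsTest.run s₅ := rfl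
  rw [hrun, cdsTest]
  by_cases hone : ∑ S ∈ (cdsUpdate G σ v ε f).dual.active, (cdsUpdate G σ v ε f).dual.g S = 1
  · rw [run_pos (hT.2 hone)]
    exact Or.inl ⟨hone, by simp [run, NExp.eval]⟩
  · rw [run_neg (mt hT.1 hone)]
    exact Or.inr ⟨hone, by simp [run, NExp.eval],
      inv'.exists_sumG_ne hG fun _ hc => hone (ht.trans hc)⟩

/-- Unlike in Algorithm 1, the initial values need not be zero, so the initial sums have to be
computed. -/
theorem sumY_cdsStart (w : Fin n → ℝ) (ds : Finset (Fin n)) (u : Fin n) :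
    Mule.sumY G (cdsStart w ds).dual u =
      ∑ x ∈ G.neighborFinset u with x ∈ ds, 99 / 500 * (w x - 2) := by
  simp only [Mule.sumY, cdsStart, filter_image]
  rw [sum_image fun a _ b _ h => singleton_injective h]
  refine sum_congr (ext fun x => ?_) fun x _ => by simp
  simp only [mem_filter, mem_nbr_singleton, SimpleGraph.mem_neighborFinset, G.adj_comm x u]
  tauto

theorem cdsInit_spec (hg : Graphed G s) {w : Fin n → ℝ} {ds : Finset (Fin n)}
    (hi : IsIndependent G ds) (hne : ds.Nonempty) (hw : StoresReals 0 w s)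
    (hds : StoresSet 2 ds s) :
    (cdsInit.run s).nat 7 = 0 ∧ CDSRep G w ds (cdsStart w ds) ds id (cdsInit.run s) := by
  have hinv := CDSInv.start w hi hne
  set s₁ := (Code.forN 11 0 cdsInitNode).run ((Code.setNat 7 (.const 0)).run s) with hs₁
  set s₂ := initSums.run s₁ with hs₂
  set s₃ := initCount.run s₂ with hs₃
  have a1 : (Code.forN 11 0 cdsInitNode).Agrees _ s₁ := agrees_run _ _
  have a2 : initSums.Agrees s₁ s₂ := agrees_run _ _
  have a3 : initCount.Agrees s₂ s₃ := agrees_run _ _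
  have a4 : nearCount.Agrees s₃ (nearCount.run s₃) := agrees_run _ _
  have g0 : Graphed G ((Code.setNat 7 (.const 0)).run s) := hg.congr rfl rfl rfl rfl
  have g1 := g0.of_agrees a1
  have g2 := g1.of_agrees a2
  have g3 := g2.of_agrees a3
  have e2 : ∀ u : Fin n, s₁.natArr 2 u 0 = if u ∈ ds then 1 else 0 := fun u => by
    rw [a1.natArr 2 rfl]; exact hds u
  have k1 : ∀ u : Fin n, s₁.natArr 3 u 0 = (if u ∈ ds then 1 else 0) ∧
      s₁.natArr 7 u 0 = (if u ∈ ds then 1 else 0) ∧ s₁.natArr 9 u 0 = (if u ∈ ds then 1 else 0) ∧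
      s₁.natArr 11 u 0 = u ∧ s₁.realArr 3 u = 99 / 100 * w u ∧
      s₁.realArr 5 u = 99 / 500 * (w u - 2) ∧ s₁.realArr 4 u = 0 := by
    refine forN_pointwise g0.graph.size (fun _ _ => True) (fun u s' =>
      s'.natArr 3 u 0 = (if u ∈ ds then 1 else 0) ∧
      s'.natArr 7 u 0 = (if u ∈ ds then 1 else 0) ∧ s'.natArr 9 u 0 = (if u ∈ ds then 1 else 0) ∧
      s'.natArr 11 u 0 = u ∧ s'.realArr 3 u = 99 / 100 * w u ∧
      s'.realArr 5 u = 99 / 500 * (w u - 2) ∧ s'.realArr 4 u = 0) (fun _ => trivial)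
      (fun _ _ _ h => h) (fun _ _ _ h => h) ?_
    intro u q hu aq _
    have q2 : q.natArr 2 u 0 = if u ∈ ds then 1 else 0 := by
      rw [aq.natArr 2 rfl]; exact hds u
    have q0 : q.realArr 0 u = w u := by
      rw [aq.realArr 0 rfl]; exact hw u
    exact ⟨by simp [cdsInitNode, run, NExp.eval, RExp.eval, hu, q2, q0], fun x hx => ⟨id,
      by simp [cdsInitNode, run, NExp.eval, hu, Fin.val_inj, hx]⟩⟩
  have k2 : ∀ u : Fin n, s₂.realArr 4 u = Mule.sumY G (cdsStart w ds).dual u := by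
    refine forN_pointwise g1.graph.size (fun u q => q.realArr 4 u = 0) (fun u q =>
      q.realArr 4 u = Mule.sumY G (cdsStart w ds).dual u) (fun u => (k1 u).2.2.2.2.2.2)
      (fun _ _ _ h => h) (fun _ _ _ h => h) ?_
    intro u q hu aq hq
    have gq : Graphed G q := g1.of_agrees aq
    have key := forNbr_rule gq (v := 11) (v₀ := u) hu
      (c := .branch (.natEq (.cell 2 (.reg 13) (.const 0)) (.const 1))
        (.putReal 4 (.reg 11) (.add (.cell 4 (.reg 11)) (.cell 5 (.reg 13)))) .skip)
      (fun T r => r.realArr 4 u = ∑ x ∈ T with x ∈ ds, 99 / 500 * (w x - 2) ∧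
        ∀ x : Fin n, x ≠ u → r.realArr 4 x = q.realArr 4 x)
      ⟨by simpa using hq, fun _ _ => rfl⟩ (fun _ _ _ h => h) (fun _ _ _ h => h) (by
        rintro T x r hx hadj h13 ar ⟨i1, i2⟩
        have r11 : r.nat 11 = u := (ar.nat 11 rfl).trans hu
        have r2 : r.natArr 2 x 0 = if x ∈ ds then 1 else 0 := by
          rw [ar.natArr 2 rfl, aq.natArr 2 rfl, e2]
        have r5 : r.realArr 5 x = 99 / 500 * (w x - 2) := by
          rw [ar.realArr 5 rfl, aq.realArr 5 rfl, (k1 x).2.2.2.2.2.1]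
        have hT : (Test.natEq (.cell 2 (.reg 13) (.const 0)) (.const 1)).Holds r ↔ x ∈ ds := by
          simp [Test.Holds, NExp.eval, h13, r2]
        rw [filter_insert]
        by_cases hc : x ∈ ds
        · rw [run_pos (hT.2 hc), if_pos hc, sum_insert (by simp [hx])]
          exact ⟨by simp [run, NExp.eval, RExp.eval, r11, h13, i1, r5, add_comm], fun y hy => by
            simp [run, NExp.eval, r11, Fin.val_inj, hy, i2 y hy]⟩
        · rw [run_neg (mt hT.1 hc), if_neg hc]
          exact ⟨i1, i2⟩)
    refine ⟨key.1.trans (sumY_cdsStart w ds u).symm, fun x hx => ⟨fun e => (key.2 x hx).trans e,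
      fun e => (key.2 x hx).trans e⟩⟩
  have k3 : s₃.nat 14 = ds.card := by
    have := forN_rule_univ (n := n) (i := 11) (b := 0)
      (c := .setNat 14 (.add (.reg 14) (.cell 2 (.reg 11) (.const 0))))
      (s₀ := (Code.setNat 14 (.const 0)).run s₂) g2.graph.size
      (fun T q => q.nat 14 = ∑ u ∈ T, if u ∈ ds then 1 else 0) (by simp [run, NExp.eval])
      (fun _ _ _ h => h) (by
        intro T u q hu hq aq ih
        have : q.natArr 2 u 0 = if u ∈ ds then 1 else 0 := by
          rw [aq.natArr 2 rfl, ← e2 u]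
          exact congrFun (congrFun (a2.natArr 2 rfl) _) _
        rw [sum_insert hu]
        simp only [run, NExp.eval, if_true, ih, hq, this]
        omega)
    refine Eq.trans this ?_
    simp
  have l3 : HoldsLabels ds (id : Fin n → Fin n) s₃ :=
    ⟨fun u => by rw [a3.natArr 7 rfl, a2.natArr 7 rfl, (k1 u).2.1],
      fun u => by rw [a3.natArr 11 rfl, a2.natArr 11 rfl, (k1 u).2.2.2.1]; rfl⟩
  have k4 := nearCount_spec g3 l3
  have hrun : cdsInit.run s = nearCount.run s₃ := rfl
  rw [hrun]
  refine ⟨?_, hinv, g3.of_agrees a4, fun u => ?_, fun u => ?_, fun u => ?_,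
    l3.congr (a4.natArr 7 rfl) (a4.natArr 11 rfl), fun u hu => ?_, fun u => ?_, fun u => ?_,
    fun u hu => ?_, ?_⟩
  · rw [a4.nat 7 rfl, a3.nat 7 rfl, a2.nat 7 rfl, a1.nat 7 rfl]
    simp [run, NExp.eval]
  · rw [a4.realArr 3 rfl, a3.realArr 3 rfl, a2.realArr 3 rfl, (k1 u).2.2.2.2.1]
  · rw [a4.natArr 2 rfl, a3.natArr 2 rfl, a2.natArr 2 rfl, e2]
  · rw [a4.natArr 3 rfl, a3.natArr 3 rfl, a2.natArr 3 rfl, (k1 u).1]; rfl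
  · rw [a4.natArr 9 rfl, a3.natArr 9 rfl, a2.natArr 9 rfl, (k1 u).2.2.1, if_pos hu]; rfl
  · rw [k4, hinv.sumG_eq]
  · rw [a4.realArr 4 rfl, a3.realArr 4 rfl, k2]
  · rw [a4.realArr 5 rfl, a3.realArr 5 rfl, a2.realArr 5 rfl, (k1 u).2.2.2.2.2.1]
    simp [cdsStart]
  · rw [a4.nat 14 rfl, k3, image_id]

/-- The round counter is `|U|`: it rises by one per round, and is below `n` while some node has
finite potential, since that node lies outside `U`. The inclusion `ds ⊆ cds` is carried along
because the later search for nearest nodes needs `cds` to be non-empty. -/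
theorem cdsCode_spec (hg : Graphed G s) (hn : 1 ≤ n) (hG : G.Connected)
    (hd : ∀ u, ∃ y, G.Adj u y) {w : Fin n → ℝ} {ds : Finset (Fin n)}
    (hi : IsIndependent G ds) (hdom : IsDominating G ds) (hw : StoresReals 0 w s)
    (hds : StoresSet 2 ds s) :
    ∃ (cds : Finset (Fin n)) (LB2 : ℝ), CDSReturns G w ds cds LB2 ∧
      StoresSet 3 cds (cdsCode.run s) ∧ (cdsCode.run s).real 0 = LB2 ∧ cds.Nonempty := by
  have hne := hdom.nonempty hn
  obtain ⟨h7, h0⟩ := cdsInit_spec hg hi hne hw hds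
  obtain ⟨k, σ, hrep, ⟨U, lab, -, h⟩, hsub⟩ := repeatBounded_rule (n := n) (c := cdsBody)
    (body := CDSStep G w)
    (halt := fun τ => ∑ S ∈ τ.dual.active, τ.dual.g S = 1) h0.graphed.graph.size h7
    (fun k σ s => (∃ U lab, U.card = k ∧ CDSRep G w ds σ U lab s) ∧ ds ⊆ σ.cds)
    (fun k σ _ => ∃ u, Mule.sumG G σ.dual u ≠ 0) ds.card ⟨⟨ds, id, rfl, h0⟩, Subset.rfl⟩
    -- The body runs before the first test, even if there is only one initial set. Every node has a
    -- neighbour, so the independent set `ds` is not all of `V`, and some potential is finite.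
    (h0.inv.exists_sumG_ne hG fun hu => by
      obtain ⟨d, hd'⟩ := hne
      obtain ⟨y, hy⟩ := hd d
      exact absurd hy (hi d hd' y (hu ▸ mem_univ y)))
    (by
      rintro k σ s m ⟨⟨U, lab, hk, h⟩, hc⟩
      exact ⟨⟨U, lab, hk, h.inv, h.graphed.congr rfl rfl rfl rfl, h.cap, h.dsArr, h.cdsArr,
        h.labels.congr rfl rfl, h.flag, h.sumG, h.sumY, h.y, h.count⟩, hc⟩)
    (fun _ _ _ _ h => h)
    (fun k σ s ⟨⟨U, lab, hk, h⟩, _⟩ ⟨u, hu⟩ => by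
      have := card_lt_univ_of_notMem (h.inv.not_mem hu)
      rwa [Fintype.card_fin, hk] at this)
    (fun k σ s ⟨⟨U, lab, hk, h⟩, hc⟩ hl => by
      obtain ⟨σ', hs, ⟨U', lab', hk', h'⟩, hr⟩ := cdsBody_spec hG h hl
      refine ⟨σ', hs, ⟨⟨U', lab', by omega, h'⟩, ?_⟩, hr⟩
      obtain ⟨v, ε, f, -, -, rfl⟩ := hs
      refine hc.trans ?_
      simp only [cdsUpdate]
      split_ifs
      · exact (subset_insert _ _).trans subset_union_left
      · exact Subset.rfl)
  set s₂ := cdsBody.repeatBounded.run (cdsInit.run s)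
  have a := agrees_run
    (sumReal (.natEq (.cell 2 (.reg 11) (.const 0)) (.const 1)) (.cell 5 (.reg 11))) s₂
  have hsum := sumReal_spec (cond := .natEq (.cell 2 (.reg 11) (.const 0)) (.const 1))
    (val := .cell 5 (.reg 11)) h.graphed.graph.size ds (fun u => σ.dual.y {u}) (fun s' u ag hu => by
      refine ⟨by simp [Test.Holds, NExp.eval, hu, ag.natArr 2 rfl, h.dsArr], fun hu' => ?_⟩
      simp [NExp.eval, RExp.eval, hu, ag.realArr 5 rfl, h.y u hu'])
  exact ⟨σ.cds, _, ⟨σ, hrep, rfl, rfl⟩, fun u =>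
    (congrFun (congrFun (a.natArr 3 rfl) _) _).trans (h.cdsArr u), hsum, hne.mono hsub⟩

end Code

end Mule

namespace Mule

namespace Code

/-! ## Program for Algorithm 3 -/

/-- The distance between the nodes in registers `a` and `b`. -/
def distExp (a b : ℕ) : RExp :=
  .sqrt (.add (.mul (.sub (.cell 1 (.reg a)) (.cell 1 (.reg b)))
      (.sub (.cell 1 (.reg a)) (.cell 1 (.reg b))))
    (.mul (.sub (.cell 2 (.reg a)) (.cell 2 (.reg b)))
      (.sub (.cell 2 (.reg a)) (.cell 2 (.reg b)))))

/-- Compute the weights for the location in register `16`. -/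
def weights : Code :=
  .forN 11 0 (.putReal 0 (.reg 11)
    (.add (.mul (.ofNat (.const 2)) (distExp 16 11)) (.reg 5)))

/-- Keep the current candidate. -/
def keep : Code :=
  .seq (.setNat 17 (.const 1)) (.seq (.setReal 7 (.reg 0)) (.seq (.setReal 8 (.reg 6))
    (.seq (.setNat 18 (.reg 8)) (.seq (.setNat 19 (.reg 16))
      (.forN 11 0 (.putNat 13 (.reg 11) (.cell 3 (.reg 11) (.const 0))))))))

/-- Run Algorithms 1 and 2 for the location in register `16`. -/
def produce : Code :=
  .seq weights (.seq dsCode (.seq (.setReal 6 (.reg 0)) (.seq cdsCode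
    (.seq (.setReal 6 (.add (.reg 6) (.reg 0)))
      (sumReal (.natEq (.cell 3 (.reg 11) (.const 0)) (.const 1)) (.cell 0 (.reg 11)))))))

/-- Treat the location in register `16`. -/
def tryLocation : Code :=
  .seq produce
    (.branch (.neg (.conj (.natEq (.reg 17) (.const 1)) (.neg (.realLt (.reg 0) (.reg 7)))))
      keep .skip)

/-- The loop over the locations. -/
def searchCode : Code := .seq (.setNat 17 (.const 0)) (.forN 16 0 tryLocation)

/-- Initialization of breadth first search. -/
def bfsInit : Code :=
  .seq (.forN 11 0 (.seq (.putNat 14 (.reg 11) (.const 0)) (.putNat 15 (.reg 11) (.const 0))))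
    (.seq (.putNat 17 (.const 0) (.reg 18)) (.seq (.putNat 14 (.reg 18) (.const 1))
      (.setNat 21 (.const 1))))

/-- Visit the node in register `13` from the node in register `22`, if it is not yet visited. -/
def visit : Code :=
  .branch (.conj (.natEq (.cell 13 (.reg 13) (.const 0)) (.const 1))
      (.natEq (.cell 14 (.reg 13) (.const 0)) (.const 0)))
    (.seq (.putNat 14 (.reg 13) (.const 1)) (.seq (.putNat 15 (.reg 13) (.const 1))
      (.seq (.putNat 16 (.reg 13) (.reg 22)) (.seq (.putNat 17 (.reg 21) (.reg 13))
        (.setNat 21 (.add (.reg 21) (.const 1))))))) .skip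

/-- Treat the next node of the queue, if there is one. -/
def bfsRound : Code :=
  .branch (.natLt (.reg 20) (.reg 21))
    (.seq (.setNat 22 (.cell 17 (.reg 20) (.const 0))) (forNbr 22 visit)) .skip

/-- Breadth first search. -/
def bfsCode : Code := .seq bfsInit (.forN 20 0 bfsRound)

/-- Output the edge from the node in register `23` to the node `e`. -/
def emit (e : NExp) : Code :=
  .seq (.putNat 4 (.reg 2) (.reg 23)) (.seq (.putNat 5 (.reg 2) e)
    (.setNat 2 (.add (.reg 2) (.const 1))))

/-- Find a node of the set in array `13` that is nearest to the node in register `23`. -/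
def nearest : Code := argmin (.natEq (.cell 13 (.reg 11) (.const 0)) (.const 1)) (distExp 23 11)

/-- Output the edge that leaves the node in register `23`. -/
def edgeOut : Code :=
  .branch (.natEq (.reg 23) (.reg 18)) .skip
    (.branch (.natEq (.cell 13 (.reg 23) (.const 0)) (.const 1))
      (.branch (.natEq (.cell 15 (.reg 23) (.const 0)) (.const 1))
        (emit (.cell 16 (.reg 23) (.const 0))) .skip)
      (.seq nearest (emit (.reg 5))))

/-- Output all edges. -/
def edgesCode : Code := .seq (.setNat 2 (.const 0)) (.forN 23 0 edgeOut)

/-- Algorithm 3. -/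
def treeCode : Code :=
  .seq (.setReal 5 (.reg 0)) (.seq searchCode (.seq bfsCode (.seq edgesCode
    (.seq (.setNat 1 (.reg 19)) (.setReal 1 (.div (.reg 7) (.reg 8)))))))

variable {n : ℕ} {s : Store}

/-! ### The search over the locations -/

section Search

variable {p : Fin n → EuclideanSpace ℝ (Fin 2)}

/-- Real arrays `1` and `2` hold the coordinates of the points. -/
structure HoldsPoints (p : Fin n → EuclideanSpace ℝ (Fin 2)) (s : Store) : Prop where
  fst : ∀ v : Fin n, s.realArr 1 v = p v 0
  snd : ∀ v : Fin n, s.realArr 2 v = p v 1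

theorem HoldsPoints.congr {s' : Store} (h : HoldsPoints p s) (h1 : s'.realArr 1 = s.realArr 1)
    (h2 : s'.realArr 2 = s.realArr 2) : HoldsPoints p s' :=
  ⟨fun v => by rw [h1, h.fst], fun v => by rw [h2, h.snd]⟩

theorem distExp_eval (h : HoldsPoints p s) {a b : ℕ} {u v : Fin n} (ha : s.nat a = u)
    (hb : s.nat b = v) : (distExp a b).eval s = dist (p u) (p v) := by
  rw [EuclideanSpace.dist_eq, Fin.sum_univ_two, Real.dist_eq, Real.dist_eq, sq_abs, sq_abs]
  simp only [distExp, RExp.eval, NExp.eval, ha, hb, h.fst, h.snd, sq]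

theorem weights_spec (hn : s.nat 0 = n) (h : HoldsPoints p s) {C : ℝ} (hC : s.real 5 = C)
    {m : Fin n} (hm : s.nat 16 = m) :
    StoresReals 0 (fun v => 2 * dist (p m) (p v) + C) (weights.run s) := by
  refine forN_pointwise hn (fun _ _ => True)
    (fun u s' => s'.realArr 0 u = 2 * dist (p m) (p u) + C) (fun _ => trivial)
    (fun _ _ _ h => h) (fun _ _ _ h => h) ?_
  intro u q hu aq _
  have hd := distExp_eval (s := q) (h.congr (aq.realArr 1 rfl) (aq.realArr 2 rfl))
    ((aq.nat 16 rfl).trans hm) hu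
  refine ⟨?_, fun x hx => ⟨id, ?_⟩⟩
  · simp [run, NExp.eval, RExp.eval, hu, hd, aq.real 5 rfl, hC]
  · simp [run, NExp.eval, hu, Fin.val_inj, hx]

/-- The memory holds the candidate `b`. -/
structure HoldsBest (b : Candidate (Fin n)) (s : Store) : Prop where
  found : s.nat 17 = 1
  loc : s.nat 19 = b.m
  root : s.nat 18 = b.r
  set : ∀ u : Fin n, s.natArr 13 u 0 = if u ∈ b.cds then 1 else 0
  weight : s.real 7 = b.weight
  bound : s.real 8 = b.LB
  nonempty : b.cds.Nonempty

theorem HoldsBest.of_agrees {b : Candidate (Fin n)} {s' : Store} (h : HoldsBest b s) {c : Code}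
    (a : c.Agrees s s') (h17 : c.wN 17 = false := by rfl) (h18 : c.wN 18 = false := by rfl)
    (h19 : c.wN 19 = false := by rfl) (h13 : c.wNA 13 = false := by rfl)
    (h7 : c.wR 7 = false := by rfl) (h8 : c.wR 8 = false := by rfl) : HoldsBest b s' :=
  ⟨(a.nat 17 h17).trans h.found, (a.nat 19 h19).trans h.loc, (a.nat 18 h18).trans h.root,
    fun u => by rw [a.natArr 13 h13, h.set], (a.real 7 h7).trans h.weight,
    (a.real 8 h8).trans h.bound, h.nonempty⟩

/-- The set is copied to array `13` because the next location overwrites array `3`. -/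
theorem keep_spec (hn : s.nat 0 = n) {a : Candidate (Fin n)} (hm : s.nat 16 = a.m)
    (hr : s.nat 8 = a.r) (hc : ∀ u : Fin n, s.natArr 3 u 0 = if u ∈ a.cds then 1 else 0)
    (hW : s.real 0 = a.weight) (hL : s.real 6 = a.LB) (hne : a.cds.Nonempty) :
    HoldsBest a (keep.run s) := by
  set s₁ := (Code.setNat 19 (.reg 16)).run ((Code.setNat 18 (.reg 8)).run
    ((Code.setReal 8 (.reg 6)).run ((Code.setReal 7 (.reg 0)).run
      ((Code.setNat 17 (.const 1)).run s)))) with hs₁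
  have key := forN_pointwise (n := n) (i := 11) (b := 0) (s₀ := s₁)
    (c := .putNat 13 (.reg 11) (.cell 3 (.reg 11) (.const 0))) hn (fun _ _ => True)
    (fun u s' => s'.natArr 13 u 0 = if u ∈ a.cds then 1 else 0) (fun _ => trivial)
    (fun _ _ _ h => h) (fun _ _ _ h => h) (by
      intro u q hu aq _
      have : q.natArr 3 u 0 = if u ∈ a.cds then 1 else 0 := by
        rw [aq.natArr 3 rfl]; exact hc u
      exact ⟨by simp [run, NExp.eval, hu, this], fun x hx => ⟨id, by
        simp [run, NExp.eval, hu, Fin.val_inj, hx]⟩⟩)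
  have ag := agrees_run (.forN 11 0 (.putNat 13 (.reg 11) (.cell 3 (.reg 11) (.const 0)))) s₁
  refine ⟨(ag.nat 17 rfl).trans ?_, (ag.nat 19 rfl).trans ?_, (ag.nat 18 rfl).trans ?_, key,
    (ag.real 7 rfl).trans ?_, (ag.real 8 rfl).trans ?_, hne⟩
  · simp [hs₁, run, NExp.eval]
  · simp [hs₁, run, NExp.eval, hm]
  · simp [hs₁, run, NExp.eval, hr]
  · simp [hs₁, run, RExp.eval, hW]
  · simp [hs₁, run, RExp.eval, hL]

theorem produce_spec (hg : Graphed (udg p) s) (hn : 1 ≤ n) (hG : (udg p).Connected)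
    (hd : ∀ u, ∃ y, (udg p).Adj u y) (h : HoldsPoints p s) {C : ℝ} (hC : s.real 5 = C)
    {m : Fin n} (hm : s.nat 16 = m) :
    ∃ a : Candidate (Fin n), Produces (udg p) (fun v => 2 * dist (p m) (p v) + C) m a ∧
      a.m = m ∧ (produce.run s).nat 8 = a.r ∧
      (∀ u : Fin n, (produce.run s).natArr 3 u 0 = if u ∈ a.cds then 1 else 0) ∧
      (produce.run s).real 0 = a.weight ∧ (produce.run s).real 6 = a.LB ∧ a.cds.Nonempty := by
  have hw := weights_spec hg.graph.size h hC hm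
  have a1 := agrees_run weights s
  rw [produce, run_seq, run_seq, run_seq, run_seq, run_seq]
  set s₁ := weights.run s
  have g1 := hg.of_agrees a1
  obtain ⟨ds, LB1, r, hds, hi, hdom, h2, h0, h8⟩ := dsCode_spec g1 hn hd hw
  have a2 := agrees_run dsCode s₁
  set s₂ := dsCode.run s₁
  have g2 := g1.of_agrees a2
  set s₃ := (Code.setReal 6 (.reg 0)).run s₂ with hs₃
  have g3 : Graphed (udg p) s₃ := g2.congr rfl rfl rfl rfl
  have hw3 : StoresReals 0 (fun v => 2 * dist (p m) (p v) + C) s₃ := fun v =>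
    (congrFun (a2.realArr 0 rfl) _).trans (hw v)
  obtain ⟨cds, LB2, hcds, h3, h0', hne⟩ := cdsCode_spec g3 hn hG hd hi hdom hw3 h2
  have a4 := agrees_run cdsCode s₃
  set s₄ := cdsCode.run s₃
  have g4 := g3.of_agrees a4
  set s₅ := (Code.setReal 6 (.add (.reg 6) (.reg 0))).run s₄ with hs₅
  have a5 := agrees_run (.setReal 6 (.add (.reg 6) (.reg 0))) s₄
  rw [← hs₅] at a5
  have e6 : s₅.real 6 = LB1 + LB2 := by
    have : s₄.real 6 = LB1 := by
      rw [a4.real 6 rfl]; simp [hs₃, run, RExp.eval, h0]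
    simp [hs₅, run, RExp.eval, this, h0']
  have g5 := g4.of_agrees a5
  have e3 : ∀ u : Fin n, s₅.natArr 3 u 0 = if u ∈ cds then 1 else 0 := fun u => by
    rw [a5.natArr 3 rfl, h3]
  have e0 : ∀ u : Fin n, s₅.realArr 0 u = 2 * dist (p m) (p u) + C := fun u => by
    rw [a5.realArr 0 rfl, a4.realArr 0 rfl, hw3]
  have e8 : s₅.nat 8 = r := by rw [a5.nat 8 rfl, a4.nat 8 rfl, ← h8]; rfl
  clear_value s₅
  have hsum := sumReal_spec (s := s₅) (cond := .natEq (.cell 3 (.reg 11) (.const 0)) (.const 1))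
    (val := .cell 0 (.reg 11)) g5.graph.size cds (fun v => 2 * dist (p m) (p v) + C)
    (fun q u aq hu => ⟨by simp [Test.Holds, NExp.eval, hu, aq.natArr 3 rfl, e3], fun _ => by
      simp [NExp.eval, RExp.eval, hu, aq.realArr 0 rfl, e0]⟩)
  have a6 := agrees_run
    (sumReal (.natEq (.cell 3 (.reg 11) (.const 0)) (.const 1)) (.cell 0 (.reg 11))) s₅
  refine ⟨⟨m, cds, ∑ v ∈ cds, (2 * dist (p m) (p v) + C), LB1 + LB2, r⟩, ⟨ds, LB1, LB2, hds, hcds, rfl, rfl, rfl⟩, rfl, ?_,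
    fun u => ?_, hsum, ?_, hne⟩
  · exact (a6.nat 8 rfl).trans e8
  · rw [a6.natArr 3 rfl, e3]
  · exact (a6.real 6 rfl).trans e6

theorem searchCode_spec (hg : Graphed (udg p) s) (hn : 1 ≤ n) (hG : (udg p).Connected)
    (hd : ∀ u, ∃ y, (udg p).Adj u y) (h : HoldsPoints p s) {C : ℝ} (hC : s.real 5 = C) :
    ∃ b : Candidate (Fin n), Search (udg p) (fun m v => 2 * dist (p m) (p v) + C)
      (List.finRange n) none (some b) ∧ HoldsBest b (searchCode.run s) := by
  have := forN_rule (M := n) (i := 16) (b := 0) (c := tryLocation)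
    (s₀ := (Code.setNat 17 (.const 0)).run s) hg.graph.size
    -- `Search` consumes its list from the front, so the invariant says that any search of the
    -- remaining locations extends to one of all locations.
    (fun k s' => ∃ best, (∀ res, Search (udg p) (fun m v => 2 * dist (p m) (p v) + C)
        ((List.finRange n).drop k) best res → Search (udg p)
        (fun m v => 2 * dist (p m) (p v) + C) (List.finRange n) none res) ∧
      (best = none ∧ k = 0 ∧ s'.nat 17 = 0 ∨ ∃ b, best = some b ∧ HoldsBest b s'))
    ⟨none, fun _ h => h, Or.inl ⟨rfl, rfl, by simp [run, NExp.eval]⟩⟩ (by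
      rintro k q m ⟨best, h1, h2 | ⟨b, rfl, h2⟩⟩
      · exact ⟨best, h1, Or.inl h2⟩
      · exact ⟨_, h1, Or.inr ⟨b, rfl, h2.found, h2.loc, h2.root, h2.set, h2.weight, h2.bound,
          h2.nonempty⟩⟩) (by
      rintro k q hk hq aq ⟨best, h1, h2⟩
      have gq : Graphed (udg p) q :=
        (hg.congr (s' := (Code.setNat 17 (.const 0)).run s) rfl rfl rfl rfl).of_agrees aq
      obtain ⟨a, ha, hm, h8, h3, h0, h6, hne⟩ := produce_spec gq hn hG hd
        (h.congr (aq.realArr 1 rfl) (aq.realArr 2 rfl)) ((aq.real 5 rfl).trans hC)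
        (m := ⟨k, hk⟩) hq
      have hdrop : (List.finRange n).drop k = ⟨k, hk⟩ :: (List.finRange n).drop (k + 1) := by
        rw [List.drop_eq_getElem_cons (by simpa using hk)]
        simp
      rw [hdrop] at h1
      refine ⟨keepBetter best a, fun res hres => h1 res (.cons ha hres), Or.inr ?_⟩
      have ap := agrees_run produce q
      rw [tryLocation, run_seq]
      set t := produce.run q
      have gt : Graphed (udg p) t := gq.of_agrees ap
      have hkeep := keep_spec gt.graph.size (a := a)
        (by rw [hm]; exact (ap.nat 16 rfl).trans hq) h8 h3 h0 h6 hne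
      rcases h2 with ⟨rfl, -, h17⟩ | ⟨b, rfl, hb⟩
      · rw [run_pos (by simp [Test.Holds, NExp.eval, ap.nat 17 rfl, h17])]
        exact ⟨a, rfl, hkeep⟩
      · have hb' := hb.of_agrees ap
        have hT : (Test.neg (.conj (.natEq (.reg 17) (.const 1))
            (.neg (.realLt (.reg 0) (.reg 7))))).Holds t ↔ a.weight < b.weight := by
          simp [Test.Holds, NExp.eval, RExp.eval, hb'.found, hb'.weight, h0]
        by_cases hlt : a.weight < b.weight
        · rw [run_pos (hT.2 hlt)]
          exact ⟨a, by simp [keepBetter, hlt], hkeep⟩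
        · rw [run_neg (mt hT.1 hlt)]
          exact ⟨b, by simp [keepBetter, hlt], hb'⟩)
  obtain ⟨best, h1, ⟨-, h2, -⟩ | ⟨b, rfl, h2⟩⟩ := this
  -- No candidate after `n` locations would mean `n = 0`.
  · omega
  · refine ⟨b, h1 _ ?_, h2⟩
    rw [List.drop_eq_nil_of_le (by simp)]
    exact .nil _

end Search

/-! ### Breadth first search -/

section BFS

variable {G : SimpleGraph (Fin n)} [DecidableRel G.Adj] {U : Finset (Fin n)}

/-- Arrays `15` and `16` hold the predecessors. -/
structure HoldsPre (pre : Fin n → Option (Fin n)) (s : Store) : Prop where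
  none : ∀ u : Fin n, pre u = none → s.natArr 15 u 0 = 0
  some : ∀ u v : Fin n, pre u = some v → s.natArr 15 u 0 = 1 ∧ s.natArr 16 u 0 = v

/-- The state of breadth first search; `Q` lists the nodes in the order of their visits. -/
structure BFSRep (Q : List (Fin n)) (pre : Fin n → Option (Fin n)) (s : Store) : Prop where
  nodup : Q.Nodup
  visited : ∀ u : Fin n, s.natArr 14 u 0 = if u ∈ Q then 1 else 0
  pre : HoldsPre pre s
  tail : s.nat 21 = Q.length
  queue : ∀ (i : ℕ) (hi : i < Q.length), s.natArr 17 i 0 = Q[i]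

theorem BFSRep.visit {Q : List (Fin n)} {pre : Fin n → Option (Fin n)} (h : BFSRep Q pre s)
    {x u : Fin n} (hx : s.nat 13 = x) (hu : s.nat 22 = u)
    (hU : ∀ u : Fin n, s.natArr 13 u 0 = if u ∈ U then 1 else 0) :
    (x ∈ U ∧ x ∉ Q → BFSRep (Q ++ [x]) (fun y => if y = x then some u else pre y)
      (Code.visit.run s)) ∧ (¬ (x ∈ U ∧ x ∉ Q) → Code.visit.run s = s) := by
  have hT : (Test.conj (.natEq (.cell 13 (.reg 13) (.const 0)) (.const 1))
      (.natEq (.cell 14 (.reg 13) (.const 0)) (.const 0))).Holds s ↔ x ∈ U ∧ x ∉ Q := by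
    simp [Test.Holds, NExp.eval, hx, hU, h.visited]
  refine ⟨fun hc => ?_, fun hc => by rw [Code.visit, run_neg (mt hT.1 hc)]; rfl⟩
  rw [Code.visit, run_pos (hT.2 hc)]
  refine ⟨?_, fun y => ?_, ⟨fun y hy => ?_, fun y z hy => ?_⟩, ?_, fun i hi => ?_⟩
  · exact List.nodup_append.2 ⟨h.nodup, by simp, by
      rintro a ha b hb rfl; simp at hb; exact hc.2 (hb ▸ ha)⟩
  · simp only [run, NExp.eval, hx, Fin.val_inj, h.visited, List.mem_append, List.mem_singleton]
    by_cases e : y = x <;> simp [e]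
  · have hne : y ≠ x := by rintro rfl; simp at hy
    rw [if_neg hne] at hy
    simpa [run, NExp.eval, hx, Fin.val_inj, hne] using h.pre.none y hy
  · by_cases hne : y = x
    · subst hne
      simp only [if_true, Option.some.injEq] at hy
      subst hy
      simp [run, NExp.eval, hx, hu]
    · rw [if_neg hne] at hy
      simpa [run, NExp.eval, hx, Fin.val_inj, hne] using h.pre.some y z hy
  · simp [run, NExp.eval, h.tail]
  · rw [List.length_append, List.length_singleton] at hi
    rcases Nat.lt_succ_iff_lt_or_eq.1 hi with hlt | rfl
    · rw [List.getElem_append_left hlt]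
      simpa [run, NExp.eval, h.tail, hx, hlt.ne] using h.queue i hlt
    · simp [run, NExp.eval, h.tail, hx]

/-- `Q` is frozen at the start of the round and `l` collects the new nodes; testing against `Q ++ l`
prevents second visits. -/
theorem bfsRound_visits (hg : Graphed G s) {Q : List (Fin n)} {pre : Fin n → Option (Fin n)}
    (h : BFSRep Q pre s) {u : Fin n} (hu : s.nat 22 = u)
    (hU : ∀ u : Fin n, s.natArr 13 u 0 = if u ∈ U then 1 else 0) :
    ∃ l : List (Fin n), l.Nodup ∧ (∀ x, x ∈ l ↔ x ∈ U ∧ x ∉ Q ∧ G.Adj u x) ∧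
      BFSRep (Q ++ l) (fun x => if x ∈ l then some u else pre x)
        ((forNbr 22 Code.visit).run s) := by
  have := forNbr_rule hg (v := 22) (v₀ := u) hu (c := Code.visit)
    (fun T q => ∃ l : List (Fin n), l.Nodup ∧ (∀ x, x ∈ l ↔ x ∈ U ∧ x ∉ Q ∧ x ∈ T) ∧
      BFSRep (Q ++ l) (fun x => if x ∈ l then some u else pre x) q)
    ⟨[], by simp, by simp, by simpa using h⟩
    (fun T q m ⟨l, h1, h2, h3⟩ => ⟨l, h1, h2, h3.nodup, h3.visited, ⟨h3.pre.none, h3.pre.some⟩,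
      h3.tail, h3.queue⟩)
    (fun T q m ⟨l, h1, h2, h3⟩ => ⟨l, h1, h2, h3.nodup, h3.visited, ⟨h3.pre.none, h3.pre.some⟩,
      h3.tail, h3.queue⟩) (by
      rintro T x q hx hadj h13 aq ⟨l, h1, h2, h3⟩
      have qu : q.nat 22 = u := (aq.nat 22 rfl).trans hu
      have qU : ∀ u : Fin n, q.natArr 13 u 0 = if u ∈ U then 1 else 0 := fun u => by
        rw [aq.natArr 13 rfl, hU]
      obtain ⟨hpos, hneg⟩ := h3.visit h13 qu qU
      by_cases hc : x ∈ U ∧ x ∉ Q ++ l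
      · have hc' := hc.2
        rw [List.mem_append, not_or] at hc'
        refine ⟨l ++ [x], ?_, fun y => ?_, ?_⟩
        · exact List.nodup_append.2 ⟨h1, by simp, by
            rintro a ha b hb rfl; simp at hb; exact hc'.2 (hb ▸ ha)⟩
        · simp only [List.mem_append, List.mem_singleton, h2, mem_insert]
          constructor
          · rintro (⟨a, b, c⟩ | rfl)
            exacts [⟨a, b, Or.inr c⟩, ⟨hc.1, hc'.1, Or.inl rfl⟩]
          · rintro ⟨a, b, rfl | c⟩
            exacts [Or.inr rfl, Or.inl ⟨a, b, c⟩]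
        · have := hpos hc
          rw [List.append_assoc] at this
          convert this using 2 with y
          simp only [List.mem_append, List.mem_singleton]
          by_cases e : y = x <;> by_cases e' : y ∈ l <;> simp [e, e']
      · rw [hneg hc]
        refine ⟨l, h1, fun y => ?_, h3⟩
        rw [h2, mem_insert]
        constructor
        · rintro ⟨a, b, c⟩
          exact ⟨a, b, Or.inr c⟩
        · rintro ⟨a, b, rfl | c⟩
          · rw [List.mem_append, not_and, not_not] at hc
            exact (h2 y).1 ((hc a).resolve_left b)
          · exact ⟨a, b, c⟩)
  simpa using this

/-- Nothing is removed from the stored list `Q`; round `k` treats `Q[k]`, so the queue of `BFS` is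
`Q.drop k`. Once it is empty the remaining rounds are idle. -/
theorem bfsCode_spec (hg : Graphed G s) {r : Fin n} (hr : s.nat 18 = r)
    (hU : ∀ u : Fin n, s.natArr 13 u 0 = if u ∈ U then 1 else 0) :
    ∃ pre, BFS G U [r] {r} (fun _ => none) pre ∧ HoldsPre pre (bfsCode.run s) := by
  have a0 := agrees_run bfsInit s
  have hinit : BFSRep [r] (fun _ => none) (bfsInit.run s) := by
    have key := forN_pointwise (n := n) (i := 11) (b := 0) (s₀ := s)
      (c := .seq (.putNat 14 (.reg 11) (.const 0)) (.putNat 15 (.reg 11) (.const 0)))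
      hg.graph.size (fun _ _ => True)
      (fun u q => q.natArr 14 u 0 = 0 ∧ q.natArr 15 u 0 = 0) (fun _ => trivial)
      (fun _ _ _ h => h) (fun _ _ _ h => h) (fun u q hu aq _ =>
        ⟨by simp [run, NExp.eval, hu], fun x hx => ⟨id, by
          simp [run, NExp.eval, hu, Fin.val_inj, hx]⟩⟩)
    have a1 := agrees_run (.forN 11 0
      (.seq (.putNat 14 (.reg 11) (.const 0)) (.putNat 15 (.reg 11) (.const 0)))) s
    rw [bfsInit, run_seq]
    set t := (Code.forN 11 0
      (.seq (.putNat 14 (.reg 11) (.const 0)) (.putNat 15 (.reg 11) (.const 0)))).run s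
    have ht : t.nat 18 = r := (a1.nat 18 rfl).trans hr
    refine ⟨by simp, fun u => ?_, ⟨fun u _ => ?_, fun u v h => by cases h⟩, ?_, fun i hi => ?_⟩
    · simp [run, NExp.eval, ht, Fin.val_inj, key u]
    · simp [run, key u]
    · simp [run, NExp.eval]
    · obtain rfl : i = 0 := by simpa using hi
      simp [run, NExp.eval, ht]
  have g0 : Graphed G (bfsInit.run s) := hg.of_agrees a0
  obtain ⟨Q, pre, hrep, hb⟩ := forN_rule (M := n) (i := 20) (b := 0) (c := bfsRound)
    g0.graph.size (fun k q => ∃ Q pre, BFSRep Q pre q ∧ ∀ pre',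
      BFS G U (Q.drop k) Q.toFinset pre pre' → BFS G U [r] {r} (fun _ => none) pre')
    ⟨[r], _, hinit, fun pre' h => by simpa using h⟩
    (fun k q m ⟨Q, pre, h1, h2⟩ => ⟨Q, pre, ⟨h1.nodup, h1.visited, ⟨h1.pre.none, h1.pre.some⟩,
      h1.tail, h1.queue⟩, h2⟩) (by
      rintro k q hk hq aq ⟨Q, pre, h1, h2⟩
      have hT : (Test.natLt (.reg 20) (.reg 21)).Holds q ↔ k < Q.length := by
        simp [Test.Holds, NExp.eval, hq, h1.tail]
      by_cases hlt : k < Q.length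
      · rw [bfsRound, run_pos (hT.2 hlt), run_seq]
        set t := (Code.setNat 22 (.cell 17 (.reg 20) (.const 0))).run q with ht
        have gt : Graphed G t := (g0.of_agrees aq).congr rfl rfl rfl rfl
        have t22 : t.nat 22 = Q[k] := by
          simp [ht, run, NExp.eval, hq, h1.queue k hlt]
        have h1' : BFSRep Q pre t := ⟨h1.nodup, h1.visited, ⟨h1.pre.none, h1.pre.some⟩,
          h1.tail, h1.queue⟩
        obtain ⟨l, hl, hmem, hrep⟩ := bfsRound_visits gt h1' t22 (U := U) (fun u => by
          rw [← hU u, ← a0.natArr 13 rfl, ← aq.natArr 13 rfl]; rfl)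
        refine ⟨Q ++ l, _, hrep, fun pre' hp => h2 pre' ?_⟩
        rw [List.drop_eq_getElem_cons hlt]
        rw [List.drop_append_of_le_length (by omega), List.toFinset_append] at hp
        exact .cons hl (fun x => by rw [hmem, List.mem_toFinset]) hp
      · rw [bfsRound, run_neg (mt hT.1 hlt)]
        refine ⟨Q, pre, h1, fun pre' hp => h2 pre' ?_⟩
        rw [List.drop_eq_nil_of_le (by omega)] at hp ⊢
        exact hp)
  refine ⟨pre, hb _ ?_, hrep.pre⟩
  -- `Q` has no repetitions, so `n` rounds exhaust it.
  have : Q.length ≤ n := by simpa using hrep.nodup.length_le_card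
  rw [List.drop_eq_nil_of_le this]
  exact .nil _ _

end BFS

/-! ### Listing the edges -/

section Edges

theorem StoresEdges.emit {E : Finset (Fin n × Fin n)} (h : StoresEdges E s) {u w : Fin n}
    (hE : (u, w) ∉ E) {e : NExp} (hu : s.nat 23 = u)
    (he : e.eval ((Code.putNat 4 (.reg 2) (.reg 23)).run s) = w) :
    StoresEdges (insert (u, w) E) ((Code.emit e).run s) := by
  have hc : (insert (u, w) E).card = E.card + 1 := card_insert_of_notMem hE
  have h4 : ∀ i, ((Code.emit e).run s).natArr 4 i 0 = if i = E.card then (u : ℕ) else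
      s.natArr 4 i 0 := fun i => by
    simp [Code.emit, run, NExp.eval, h.size, hu]
  have h5 : ∀ i, ((Code.emit e).run s).natArr 5 i 0 = if i = E.card then (w : ℕ) else
      s.natArr 5 i 0 := fun i => by
    have : ∀ j, (Code.emit e).run s = j → ((Code.emit e).run s).natArr 5 i 0 =
        if i = E.card then e.eval ((Code.putNat 4 (.reg 2) (.reg 23)).run s) else
          s.natArr 5 i 0 := by
      intro j _
      simp [Code.emit, run, NExp.eval, h.size]
    rw [this _ rfl, he]
  refine ⟨?_, fun a b => ?_⟩
  · simp [Code.emit, run, NExp.eval, h.size, hc]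
  · rw [mem_insert, h.edge, hc]
    constructor
    · rintro (e | ⟨i, hi, h1, h2⟩)
      · obtain ⟨rfl, rfl⟩ := Prod.mk.inj e
        exact ⟨E.card, by omega, by rw [h4, if_pos rfl], by rw [h5, if_pos rfl]⟩
      · exact ⟨i, by omega, by rw [h4, if_neg hi.ne, h1], by rw [h5, if_neg hi.ne, h2]⟩
    · rintro ⟨i, hi, h1, h2⟩
      rw [h4] at h1
      rw [h5] at h2
      by_cases e : i = E.card
      · rw [if_pos e] at h1 h2
        exact Or.inl (Prod.ext (Fin.ext h1.symm) (Fin.ext h2.symm))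
      · rw [if_neg e] at h1 h2
        exact Or.inr ⟨i, by omega, h1, h2⟩

/-- The edges that leave the nodes of `T`. -/
def outEdges (U : Finset (Fin n)) (r : Fin n) (pre : Fin n → Option (Fin n)) (near : Fin n → Fin n)
    (T : Finset (Fin n)) : Finset (Fin n × Fin n) :=
  univ.filter fun e => e.1 ∈ T ∧
    ((e.1 ∈ U \ {r} ∧ pre e.1 = some e.2) ∨ (e.1 ∉ U ∪ {r} ∧ e.2 = near e.1))

theorem mem_outEdges {U T : Finset (Fin n)} {r : Fin n} {pre : Fin n → Option (Fin n)}
    {near : Fin n → Fin n} {a b : Fin n} : (a, b) ∈ outEdges U r pre near T ↔ a ∈ T ∧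
      (((a ∈ U ∧ a ≠ r) ∧ pre a = some b) ∨ ((a ∉ U ∧ a ≠ r) ∧ b = near a)) := by
  simp [outEdges]
  tauto

variable {p : Fin n → EuclideanSpace ℝ (Fin 2)} {U : Finset (Fin n)} {r : Fin n}
  {pre : Fin n → Option (Fin n)}

/-- Each node emits at most one edge and is its tail, so nothing is listed twice. No edge leaves the
root or a node of `U` without predecessor. The function `near` is built up node by node. -/
theorem edgesCode_spec (hn : s.nat 0 = n) (hp : HoldsPoints p s) (hr : s.nat 18 = r)
    (hU : ∀ u : Fin n, s.natArr 13 u 0 = if u ∈ U then 1 else 0) (hne : U.Nonempty)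
    (hpre : HoldsPre pre s) :
    ∃ near : Fin n → Fin n, (∀ u, u ∉ U ∪ {r} → near u ∈ U ∧ ∀ x ∈ U,
        dist (p u) (p (near u)) ≤ dist (p u) (p x)) ∧
      StoresEdges (outEdges U r pre near univ) (edgesCode.run s) := by
  obtain ⟨near, h1, h2⟩ := forN_rule_univ (n := n) (i := 23) (b := 0) (c := edgeOut)
    (s₀ := (Code.setNat 2 (.const 0)).run s) hn
    (fun T q => ∃ near : Fin n → Fin n, (∀ u ∈ T, u ∉ U ∪ {r} → near u ∈ U ∧ ∀ x ∈ U,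
        dist (p u) (p (near u)) ≤ dist (p u) (p x)) ∧ StoresEdges (outEdges U r pre near T) q)
    ⟨id, by simp, by simp [outEdges, run, NExp.eval], fun u v => by simp [outEdges]⟩
    (fun T q m ⟨near, h1, h2⟩ => ⟨near, h1, h2.size, h2.edge⟩) (by
      rintro T u q hu hq aq ⟨near, h1, h2⟩
      have q18 : q.nat 18 = r := (aq.nat 18 rfl).trans hr
      have qU : ∀ u : Fin n, q.natArr 13 u 0 = if u ∈ U then 1 else 0 := fun u => by
        rw [← hU u, aq.natArr 13 rfl]; rfl
      have qp : HoldsPoints p q := hp.congr (aq.realArr 1 rfl) (aq.realArr 2 rfl)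
      have q15 : q.natArr 15 = s.natArr 15 := aq.natArr 15 rfl
      have q16 : q.natArr 16 = s.natArr 16 := aq.natArr 16 rfl
      have hfresh : ∀ w, (u, w) ∉ outEdges U r pre near T := fun w hw =>
        hu (mem_outEdges.1 hw).1
      have hT1 : (Test.natEq (.reg 23) (.reg 18)).Holds q ↔ u = r := by
        simp [Test.Holds, NExp.eval, hq, q18, Fin.val_inj]
      have hT2 : (Test.natEq (.cell 13 (.reg 23) (.const 0)) (.const 1)).Holds q ↔ u ∈ U := by
        simp [Test.Holds, NExp.eval, hq, qU]
      have hT3 : (Test.natEq (.cell 15 (.reg 23) (.const 0)) (.const 1)).Holds q ↔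
          s.natArr 15 u 0 = 1 := by
        simp [Test.Holds, NExp.eval, hq, q15]
      rw [edgeOut]
      by_cases hur : u = r
      · rw [run_pos (hT1.2 hur)]
        have : outEdges U r pre near (insert u T) = outEdges U r pre near T := by
          ext ⟨a, b⟩
          simp only [mem_outEdges, mem_insert]
          have : a = u → a ≠ r → False := fun e e' => e' (e.trans hur)
          tauto
        exact ⟨near, fun x hx hxU => h1 x ((mem_insert.1 hx).resolve_left (by
          rintro rfl; exact hxU (by simp [hur]))) hxU, this ▸ h2⟩
      rw [run_neg (mt hT1.1 hur)]
      by_cases huU : u ∈ U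
      · rw [run_pos (hT2.2 huU)]
        have hn1 : ∀ x ∈ insert u T, x ∉ U ∪ {r} → near x ∈ U ∧ ∀ y ∈ U,
            dist (p x) (p (near x)) ≤ dist (p x) (p y) := fun x hx hxU =>
          h1 x ((mem_insert.1 hx).resolve_left (by rintro rfl; exact hxU (by simp [huU]))) hxU
        rcases hpu : pre u with _ | w
        · rw [run_neg (by rw [hT3, hpre.none u hpu]; exact zero_ne_one)]
          have : outEdges U r pre near (insert u T) = outEdges U r pre near T := by
            ext ⟨a, b⟩
            simp only [mem_outEdges, mem_insert]
            by_cases e : a = u <;> simp [e, hu, hpu, huU]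
          exact ⟨near, hn1, this ▸ h2⟩
        · obtain ⟨e15, e16⟩ := hpre.some u w hpu
          rw [run_pos (hT3.2 e15)]
          have : outEdges U r pre near (insert u T) =
              insert (u, w) (outEdges U r pre near T) := by
            ext ⟨a, b⟩
            simp only [mem_outEdges, mem_insert, Prod.mk.injEq]
            by_cases e : a = u <;> simp [e, hu, hpu, huU, hur, eq_comm]
          refine ⟨near, hn1, this ▸ StoresEdges.emit h2 (hfresh w) hq ?_⟩
          simp [run, NExp.eval, hq, q16, e16]
      · rw [run_neg (mt hT2.1 huU), run_seq]
        obtain ⟨v, h5, hv, -, hmin⟩ := argmin_spec (s := q)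
          (cond := .natEq (.cell 13 (.reg 11) (.const 0)) (.const 1)) (val := distExp 23 11)
          ((aq.nat 0 rfl).trans hn) (fun x => x ∈ U) (fun x => dist (p u) (p x))
          (fun q' x aq' hx => ⟨by simp [Test.Holds, NExp.eval, hx, aq'.natArr 13 rfl, qU],
            distExp_eval (qp.congr (aq'.realArr 1 rfl) (aq'.realArr 2 rfl))
              ((aq'.nat 23 rfl).trans hq) hx⟩) hne
        have an := agrees_run nearest q
        set t := nearest.run q with ht
        have t5 : t.nat 5 = v := h5
        have h2' : StoresEdges (outEdges U r pre near T) t :=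
          ⟨(an.nat 2 rfl).trans h2.size, fun a b => by
            rw [h2.edge, an.natArr 4 rfl, an.natArr 5 rfl]⟩
        -- Since `u ∉ T`, redefining `near` at `u` leaves the edges of `T` unchanged.
        have : outEdges U r pre (Function.update near u v) (insert u T) =
            insert (u, v) (outEdges U r pre near T) := by
          ext ⟨a, b⟩
          simp only [mem_outEdges, mem_insert, Prod.mk.injEq]
          by_cases e : a = u
          · subst e; simp [hu, huU, hur]
          · simp [e]
        refine ⟨Function.update near u v, fun x hx hxU => ?_, this ▸ StoresEdges.emit h2' (hfresh v)
          ((an.nat 23 rfl).trans hq) ?_⟩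
        · rcases mem_insert.1 hx with rfl | hx'
          · rw [Function.update_self]
            exact ⟨hv, hmin⟩
          · rw [Function.update_of_ne (by rintro rfl; exact hu hx')]
            exact h1 x hx' hxU
        · simp [run, NExp.eval, t5])
  exact ⟨near, fun u hu => h1 u (mem_univ u) hu, h2⟩

end Edges

theorem treeCode_spec {p : Fin n → EuclideanSpace ℝ (Fin 2)} (hg : Graphed (udg p) s) (hn : 1 ≤ n)
    (hG : (udg p).Connected) (hd : ∀ u, ∃ y, (udg p).Adj u y) (h : HoldsPoints p s) {C : ℝ}
    (hC : s.real 0 = C) :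
    ∃ (E : Finset (Fin n × Fin n)) (m : Fin n) (α : ℝ), TreeReturns p C E m α ∧
      StoresEdges E (treeCode.run s) ∧ (treeCode.run s).nat 1 = m ∧
      (treeCode.run s).real 1 = α := by
  -- The constant is moved away from real register `0`, which `sumReal` overwrites.
  set s₁ := (Code.setReal 5 (.reg 0)).run s with hs₁
  have g1 : Graphed (udg p) s₁ := hg.congr rfl rfl rfl rfl
  have p1 : HoldsPoints p s₁ := h.congr rfl rfl
  obtain ⟨b, hsearch, hb⟩ := searchCode_spec g1 hn hG hd p1 (C := C)
    (by simp [hs₁, run, RExp.eval, hC])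
  have a2 := agrees_run searchCode s₁
  set s₂ := searchCode.run s₁
  have g2 := g1.of_agrees a2
  obtain ⟨pre, hbfs, hpre⟩ := bfsCode_spec g2 hb.root hb.set
  have a3 := agrees_run bfsCode s₂
  set s₃ := bfsCode.run s₂
  have g3 := g2.of_agrees a3
  have b3 := hb.of_agrees a3
  obtain ⟨near, hnear, hE⟩ := edgesCode_spec g3.graph.size
    (p1.congr ((a3.realArr 1 rfl).trans (a2.realArr 1 rfl))
      ((a3.realArr 2 rfl).trans (a2.realArr 2 rfl))) b3.root b3.set b3.nonempty hpre
  have a4 := agrees_run edgesCode s₃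
  have b4 := b3.of_agrees a4
  set s₄ := edgesCode.run s₃
  have hrun : treeCode.run s =
      (Code.setReal 1 (.div (.reg 7) (.reg 8))).run ((Code.setNat 1 (.reg 19)).run s₄) := rfl
  refine ⟨_, b.m, b.weight / b.LB, ⟨List.finRange n, b, pre, near, List.nodup_finRange n,
    List.mem_finRange, hsearch, hbfs, hnear, rfl, rfl, rfl⟩, ?_, ?_, ?_⟩
  · have : outEdges b.cds b.r pre near univ = univ.filter (fun e : Fin n × Fin n =>
        (e.1 ∈ b.cds \ {b.r} ∧ pre e.1 = some e.2) ∨ (e.1 ∉ b.cds ∪ {b.r} ∧ e.2 = near e.1)) := by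
      simp [outEdges]
    rw [← this, hrun]
    exact ⟨hE.size, hE.edge⟩
  · rw [hrun]
    simp [run, NExp.eval, b4.loc]
  · rw [hrun]
    simp [run, RExp.eval, b4.weight, b4.bound]

end Code

end Mule
-- The five statements
theorem exists_udg_adj {n : ℕ} {p : Fin n → EuclideanSpace ℝ (Fin 2)} (hn : 2 ≤ n)
    (hG : (udg p).Connected) (u : Fin n) : ∃ y, (udg p).Adj u y := by
  have : Nontrivial (Fin n) := Fin.nontrivial_iff_two_le.2 hn
  exact hG.preconnected.exists_adj_of_nontrivial u

theorem mainTheorem4 :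
    -- Algorithm 1 can be implemented in time `O(n² Δ(G))`
    (∃ (P : Prog) (K : ℕ), ∀ (n : ℕ) (p : Fin n → EuclideanSpace ℝ (Fin 2)) (w : Fin n → ℝ)
      (s : Store), 2 ≤ n → (udg p).Connected → (∀ v, 0 < w v) →
      StoresGraph (udg p) s → StoresReals 0 w s →
      ∃ (s' : Store) (t : ℕ), Exec P s s' t ∧ t ≤ K * (n ^ 2 * (udg p).maxDegree) ∧
        ∃ (ds : Finset (Fin n)) (LB1 : ℝ) (r : Fin n), DSReturns (udg p) w ds LB1 r ∧
          StoresSet 2 ds s' ∧ s'.real 0 = LB1) ∧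
    -- Algorithm 2 can be implemented in time `O(n² Δ(G))`
    (∃ (P : Prog) (K : ℕ), ∀ (n : ℕ) (p : Fin n → EuclideanSpace ℝ (Fin 2)) (w : Fin n → ℝ)
      (ds : Finset (Fin n)) (s : Store), 2 ≤ n → (udg p).Connected → (∀ v, 0 < w v) →
      IsIndependent (udg p) ds → IsDominating (udg p) ds →
      StoresGraph (udg p) s → StoresReals 0 w s → StoresSet 2 ds s →
      ∃ (s' : Store) (t : ℕ), Exec P s s' t ∧ t ≤ K * (n ^ 2 * (udg p).maxDegree) ∧
        ∃ (cds : Finset (Fin n)) (LB2 : ℝ), CDSReturns (udg p) w ds cds LB2 ∧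
          StoresSet 3 cds s' ∧ s'.real 0 = LB2) ∧
    -- Algorithm 3 can be implemented in time `O(n³ Δ(G))`
    (∃ (P : Prog) (K : ℕ), ∀ (RM : ℝ) (n : ℕ) (p : Fin n → EuclideanSpace ℝ (Fin 2))
      (s : Store), 0 < RM → RM < 3 / 10 → 2 ≤ n → (udg p).Connected →
      StoresGraph (udg p) s → StoresReals 1 (fun v => p v 0) s →
      StoresReals 2 (fun v => p v 1) s → s.real 0 = weightConst RM →
      ∃ (s' : Store) (t : ℕ), Exec P s s' t ∧ t ≤ K * (n ^ 3 * (udg p).maxDegree) ∧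
        ∃ (E : Finset (Fin n × Fin n)) (m : Fin n) (α : ℝ),
          TreeReturns p (weightConst RM) E m α ∧
          StoresEdges E s' ∧ s'.nat 1 = m ∧ s'.real 1 = α) ∧
    -- Algorithm 1 never has more than `2n` active subsets
    (∀ (n : ℕ) (p : Fin n → EuclideanSpace ℝ (Fin 2)) (w : Fin n → ℝ), 2 ≤ n →
      (udg p).Connected → (∀ v, 0 < w v) →
      ∀ σ, Relation.ReflTransGen (DSStep (udg p) w) dsStart σ → σ.dual.active.card ≤ 2 * n) ∧
    -- in Algorithm 2, a node is never adjacent to more than five un-restricted active subsets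
    (∀ (n : ℕ) (p : Fin n → EuclideanSpace ℝ (Fin 2)) (w : Fin n → ℝ) (ds : Finset (Fin n)),
      2 ≤ n → (udg p).Connected → (∀ v, 0 < w v) →
      IsIndependent (udg p) ds → IsDominating (udg p) ds →
      ∀ σ, Relation.ReflTransGen (CDSStep (udg p) w) (cdsStart w ds) σ → ∀ u,
        (σ.dual.active.filter fun S => σ.dual.g S = 1 ∧ u ∈ nbr (udg p) S).card ≤ 5) := by
  refine ⟨?_, ?_, ?_, ?_, ?_⟩
  -- The nesting depths are computed by `decide`: rounds and nodes give `n ^ (p + 1)`, the loop over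
  -- neighbours the factor Δ.
  · obtain ⟨K, hK⟩ := Code.exec_withDegree (p := 1) Code.dsCode rfl rfl rfl (by decide) (by decide)
    refine ⟨Code.dsCode.withDegree, K, fun n p w s hn hG _ hs hw => ?_⟩
    obtain ⟨s₁, t, hg, -, -, hr, hex, ht⟩ := hK n (udg p) s hn hG hs
    obtain ⟨ds, LB1, r, h, -, -, hds, h0, -⟩ := Code.dsCode_spec (w := w) hg (by omega)
      (exists_udg_adj hn hG) (fun v => by rw [hr]; exact hw v)
    exact ⟨_, t, hex, ht, ds, LB1, r, h, hds, h0⟩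
  · obtain ⟨K, hK⟩ := Code.exec_withDegree (p := 1) Code.cdsCode rfl rfl rfl (by decide) (by decide)
    refine ⟨Code.cdsCode.withDegree, K, fun n p w ds s hn hG _ hi hdom hs hw hds => ?_⟩
    obtain ⟨s₁, t, hg, hna, -, hr, hex, ht⟩ := hK n (udg p) s hn hG hs
    obtain ⟨cds, LB2, h, hcds, h0, -⟩ := Code.cdsCode_spec (w := w) hg (by omega) hG
      (exists_udg_adj hn hG) hi hdom (fun v => by rw [hr]; exact hw v)
      (fun v => by rw [hna]; exact hds v)
    exact ⟨_, t, hex, ht, cds, LB2, h, hcds, h0⟩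
  -- The loop over the locations adds one level.
  · obtain ⟨K, hK⟩ := Code.exec_withDegree (p := 2) Code.treeCode rfl rfl rfl (by decide) (by decide)
    refine ⟨Code.treeCode.withDegree, K, fun RM n p s _ _ hn hG hs h1 h2 hC => ?_⟩
    obtain ⟨s₁, t, hg, -, hre, hr, hex, ht⟩ := hK n (udg p) s hn hG hs
    obtain ⟨E, m, α, h, hE, hm, hα⟩ := Code.treeCode_spec hg (by omega) hG (exists_udg_adj hn hG)
      ⟨fun v => by rw [hr]; exact h1 v, fun v => by rw [hr]; exact h2 v⟩ ((congrFun hre 0).trans hC)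
    exact ⟨_, t, hex, ht, E, m, α, h, hE, hm, hα⟩
  · intro n p w hn hG _ σ hσ
    simpa using card_active_le hσ
  · intro n p w ds hn hG _ hi hdom σ hσ u
    obtain ⟨U, lab, h⟩ := CDSInv.of_reachable hi
      (hdom.nonempty (by omega)) hσ
    exact card_free_le_five h u
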